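/- **Symmetric multicategories.** A *symmetric multicategory* $Q$ consists of a category $\mathbb C=o(Q)$ of objects; for all $k\ge 0$ and objects $x_1,\dots,x_k,x$ a set $Q(x_1,\dots,x_k;x)$ of arrows; for each morphism $a:x\to y$ of $\mathbb C$ (an *object-morphism*) an arrow $\iota(a)\in Q(x;y)$; composites $f\circ(g_1,\dots,g_k)$; and for $\sigma\in\mathbf S_k$ an action $f\mapsto f\sigma$, $Q(x_1,\dots,x_k;x)\to Q(x_{\sigma(1)},\dots,x_{\sigma(k)};x)$. Composition is associative with units $\iota(1_x)$, $(f\sigma)\sigma'=f(\sigma\sigma')$ and $f\cdot 1=f$, the action is compatible with composition in both variables, and $\iota(b\circ a)=\iota(b)\circ\iota(a)$. A *morphism* $\phi:Q\to R$ is a functor $o(Q)\to o(R)$ together with maps on arrows preserving sources, targets, $\iota$, composition and the symmetric actions. It is an *equivalence* if the functor $o(Q)\to o(R)$ is an equivalence of categories and each map $Q(x_1,\dots,x_k;x)\to R(\phi x_1,\dots,\phi x_k;\phi x)$ is a bijection. **Generalised multicategories.** A *generalised multicategory* $M$ has a set $o(M)$ of objects, a set $a(M)$ of arrows, each arrow $f$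 having a target $t(f)\in o(M)$ and a source $s(f)=(s(f)_1,\dots,s(f)_k)$, $k\ge 0$; identities $1_x$, with source $(x)$ and target $x$; and, whenever $t(g)=s(f)_p$, a composite $f\circ_p g$ with target $t(f)$, together with *amalgamating maps*: a bijection from the disjoint union of the source positions of $f$ other than $p$ and the source positions of $g$ to the source positions of $f\circ_p g$, preserving the objects at these positions. Identities are units for $\circ$, with trivial amalgamating maps. Substituting $g$ at a position $p$ of $f$ and $h$ at a position $q$ of $g$ gives the same arrow in either order ($(f\circ_p g)\circ h=f\circ_p(g\circ_q h)$), as does substituting $g$ and $h$ at two distinct positions of $f$; in both cases the amalgamating maps of the two sides agree on the source positions of $f$, $g$ and $h$. **The functor $\xi$.** The symmetric multicategory $\xi(M)$ has the discrete category on $o(M)$ as its category of objects. Its arrows $(x_1,\dots,x_k)\to x$ are the pairs $(g,\sigma)$ with $g\in a(M)$ of arity $k$ and target $x$, $\sigma\in\mathbf S_k$, and $s(g)_p=x_{\sigma(p)}$; that is, arrows of $M$ whose source positions are numbered bijectively by $1,\dots,k$. Composites are formed by successive composition in $M$, the numbering of the source positions being carried along the amalgamating maps, and permutations act on the numbering.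 **The slice $Q^+$.** Let $Q$ be a symmetric multicategory with category of objects $\mathbb C$. The objects of $Q^+$ are the arrows of $Q$. A morphism from $g:(x_1,\dots,x_m)\to x$ to $g':(y_1,\dots,y_m)\to y$ in $o(Q^+)$ consists of $\sigma\in\mathbf S_m$, morphisms $f_i:y_{\sigma(i)}\to x_i$ and $f:x\to y$ of $\mathbb C$ such that $\iota(f)\circ g\circ(\iota(f_1),\dots,\iota(f_m))=g'\sigma$. An arrow $(f_1,\dots,f_n)\to f$ of $Q^+$ is a triple $(T,\rho,\tau)$, where $T$ is a planar tree with $n$ nodes (possibly $n=0$), $\tau$ is a bijection from its nodes to $\{1,\dots,n\}$, a node $N$ being labelled by the arrow $f_{\tau(N)}$ and having one incoming edge for each source position of it, the edges of $T$ are labelled by morphisms of $\mathbb C$ from the object supplied at the upper end of the edge to the one required at the lower end, $\rho$ is a numbering of the leaves of $T$, and the composite in $Q$ of the arrows at the nodes and the edge labels according to $T$, with its inputs permuted by $\rho$, is $f$. Composition replaces a node by a tree, composing edge labels and matching the leaves of that tree by their numbers with the edges into the node; $\iota$ of a morphism of $o(Q^+)$ is the corresponding tree with one node; $(T,\rho,\tau)\sigma=(T,\rho,\sigma^{-1}\tau)$.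 **The slice $M_+$.** Let $M$ be a generalised multicategory. The objects of the generalised multicategory $M_+$ are the arrows of $M$. Its arrows are the planar trees $T$ (possibly without nodes) with nodes labelled by arrows of $M$ and edges labelled by objects of $M$, the incoming edges of a node labelled $f$ being labelled by the source $s(f)$, from left to right, and the outgoing one by $t(f)$. One fixes, arbitrarily, for every $T$ with $n$ nodes a bijection $\tau_T$ from its nodes to $\{1,\dots,n\}$. The source of $T$ is the list of the labels of its nodes in the order $\tau_T$; its target is the composite in $M$ of these arrows according to $T$, whose amalgamating maps identify the leaves of $T$ with the source positions of the composite. The composite $T_1\circ_m T_2$ is obtained by replacing the node $\tau_{T_1}^{-1}(m)$ of $T_1$ by $T_2$, the leaves of $T_2$ being matched with the edges into that node by this identification; the amalgamating maps of $M_+$ compare the orders $\tau_{T_1}$, $\tau_{T_2}$ and $\tau_T$, where $T=T_1\circ_mT_2$. The identity of $f$ is the tree with one node, labelled $f$. (This is a special case of the multicategory of function replacement.) **The morphism $\phi^+$.** Let $\phi:Q\to\xi(M)$ be a morphism of symmetric multicategories. The morphism $\phi^+:Q^+\to\xi(M_+)$ sends an object $f$ of $Q^+$ to $g$, where $\phi(f)=(g,\sigma)$;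 it sends all morphisms of $o(Q^+)$ to identities; and it sends an arrow $(T,\rho,\tau)$ to $(\overline T,\tau\circ\tau_{\overline T}^{-1})$, where $\overline T$ is obtained from $T$ by replacing each node label $f$, with $\phi(f)=(g,\sigma)$, by $g$, permuting the incoming edges of the node (with the subtrees above them) according to $\sigma$, making all edge labels identities, and forgetting the numbering of the leaves. **Proposition.** Let $Q$ be a symmetric multicategory, $M$ a generalised multicategory, let a choice of the bijections $\tau_T$ for the trees $T$ of arrows of $M$ be given, and let $\phi:Q\to\xi(M)$ be a morphism of symmetric multicategories. If $\phi$ is an equivalence, then $\phi^+:Q^+\to\xi(M_+)$ is an equivalence. -/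

import Mathlib

open CategoryTheory

universe u v w u' v' w'
set_option linter.checkUnivs false
set_option linter.unusedSimpArgs false

/-! ## Symmetric multicategories -/

/-- The bijection `{1,…,k} ≃ {(1,1),…,(1,k)}`, both sides in their order. -/
def idCompPerm (k : ℕ) : Fin k ≃ Fin (∑ _i : Fin 1, k) :=
  (Equiv.uniqueSigma (fun _ : Fin 1 => Fin k)).symm.trans finSigmaFinEquiv

/-- The bijection `{1,…,k} ≃ {(1,1),…,(k,1)}`, both sides in their order. -/
def compIdPerm (k : ℕ) : Fin k ≃ Fin (∑ _i : Fin k, 1) :=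
  (Equiv.sigmaUnique (Fin k) (fun _ => Fin 1)).symm.trans finSigmaFinEquiv

/-- The order preserving bijection between the two ways of listing the triples `(i, j, l)`
lexicographically: as `(i, (j, l))` and as `((i, j), l)`. -/
def assocPerm {k : ℕ} {m : Fin k → ℕ} (n : ∀ i, Fin (m i) → ℕ) :
    Fin (∑ i, ∑ j, n i j) ≃
      Fin (∑ q : Fin (∑ i, m i), n (finSigmaFinEquiv.symm q).1 (finSigmaFinEquiv.symm q).2) :=
  finSigmaFinEquiv.symm.trans <|
    (Equiv.sigmaCongrRight fun _ => finSigmaFinEquiv.symm).trans <|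
      (Equiv.sigmaAssoc fun i j => Fin (n i j)).symm.trans <|
        (Equiv.sigmaCongrLeft (β := fun p : Σ i, Fin (m i) => Fin (n p.1 p.2))
          finSigmaFinEquiv.symm).symm.trans finSigmaFinEquiv

/-- The block permutation induced by `σ`: it sends `(i, j)` to `(σ i, j)`. -/
def blockPerm {k l : ℕ} (m : Fin k → ℕ) (σ : Fin l ≃ Fin k) :
    Fin (∑ i, m (σ i)) ≃ Fin (∑ i, m i) :=
  finSigmaFinEquiv.symm.trans <|
    (Equiv.sigmaCongrLeft (β := fun i => Fin (m i)) σ).trans finSigmaFinEquiv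

/-- The permutation obtained by juxtaposing the `τ i`: it sends `(i, j)` to `(i, τ i j)`. -/
def juxtPerm {k : ℕ} {m m' : Fin k → ℕ} (τ : ∀ i, Fin (m' i) ≃ Fin (m i)) :
    Fin (∑ i, m' i) ≃ Fin (∑ i, m i) :=
  finSigmaFinEquiv.symm.trans <| (Equiv.sigmaCongrRight τ).trans finSigmaFinEquiv

theorem assocPerm_symm {k : ℕ} {m : Fin k → ℕ} (n : ∀ i, Fin (m i) → ℕ)
    (q : Fin (∑ i, m i)) (l) : (assocPerm n).symm (finSigmaFinEquiv ⟨q, l⟩) =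
      finSigmaFinEquiv ⟨(finSigmaFinEquiv.symm q).1,
        finSigmaFinEquiv ⟨(finSigmaFinEquiv.symm q).2, l⟩⟩ := by
  simp [assocPerm]
  rfl

theorem assocPerm_triple {k : ℕ} {m : Fin k → ℕ} (n : ∀ i, Fin (m i) → ℕ)
    (i : Fin (∑ i, ∑ j, n i j)) :
    (⟨_, _, (finSigmaFinEquiv.symm (assocPerm n i)).2⟩ : Σ i, Σ j, Fin (n i j)) =
      ⟨(finSigmaFinEquiv.symm i).1, finSigmaFinEquiv.symm (finSigmaFinEquiv.symm i).2⟩ := by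
  obtain ⟨q, rfl⟩ := (assocPerm n).symm.surjective i
  obtain ⟨⟨q, l⟩, rfl⟩ := finSigmaFinEquiv.surjective q
  rw [Equiv.apply_symm_apply, assocPerm_symm, Equiv.symm_apply_apply, Equiv.symm_apply_apply]
  change _ = (⟨_, finSigmaFinEquiv.symm (finSigmaFinEquiv _)⟩ : Σ i, Σ j, Fin (n i j))
  rw [Equiv.symm_apply_apply]

theorem split_idCompPerm (k : ℕ) (i : Fin k) :
    finSigmaFinEquiv.symm (idCompPerm k i) = ⟨0, i⟩ := by
  rw [Equiv.symm_apply_eq]; rfl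

theorem split_compIdPerm (k : ℕ) (i : Fin k) :
    finSigmaFinEquiv.symm (compIdPerm k i) = ⟨i, 0⟩ := by
  rw [Equiv.symm_apply_eq]; rfl

theorem split_blockPerm {k l : ℕ} (m : Fin k → ℕ) (σ : Fin l ≃ Fin k)
    (q : Fin (∑ i, m (σ i))) : finSigmaFinEquiv.symm (blockPerm m σ q) =
      ⟨σ (finSigmaFinEquiv.symm q).1, (finSigmaFinEquiv.symm q).2⟩ := by
  rw [Equiv.symm_apply_eq]; rfl

theorem split_juxtPerm {k : ℕ} {m m' : Fin k → ℕ} (τ : ∀ i, Fin (m' i) ≃ Fin (m i))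
    (q : Fin (∑ i, m' i)) : finSigmaFinEquiv.symm (juxtPerm τ q) =
      ⟨(finSigmaFinEquiv.symm q).1, τ _ (finSigmaFinEquiv.symm q).2⟩ := by
  rw [Equiv.symm_apply_eq]; rfl

/-- A symmetric multicategory with a category of objects.

`Arr k` is the set of all arrows of arity `k`, with source `(src f 1, …, src f k)` and target
`tgt f`, so that `Q(x₁,…,x_k;x)` is `SymMulticat.Hom`, the fibre of `(src, tgt)`.

Permutations are written as bijections `Fin l ≃ Fin k` (which force `l = k`), so that the
arities `m + 0`, `∑ i : Fin 1, m`, … need not be literally equal to `m`; for `l = k` this is the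
action of the symmetric group. In the same way the unit and associativity laws mention the order
preserving identification of the (equal) arities of their two sides. -/
structure SymMulticat where
  Obj : Type u
  [cat : Category.{v} Obj]
  Arr : ℕ → Type w
  src : ∀ {k : ℕ}, Arr k → Fin k → Obj
  tgt : ∀ {k : ℕ}, Arr k → Obj
  /-- the arrow given by an object-morphism -/
  ι : ∀ {x y : Obj}, (x ⟶ y) → Arr 1
  src_ι : ∀ {x y : Obj} (a : x ⟶ y) (i : Fin 1), src (ι a) i = x
  tgt_ι : ∀ {x y : Obj} (a : x ⟶ y), tgt (ι a) = y
  /-- the composite `f ∘ (g₁, …, g_k)` -/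
  comp : ∀ {k : ℕ} {m : Fin k → ℕ} (f : Arr k) (g : ∀ i, Arr (m i)),
    (∀ i, tgt (g i) = src f i) → Arr (∑ i, m i)
  src_comp : ∀ {k : ℕ} {m : Fin k → ℕ} (f : Arr k) (g : ∀ i, Arr (m i))
    (h : ∀ i, tgt (g i) = src f i) (i : Fin k) (j : Fin (m i)),
    src (comp f g h) (finSigmaFinEquiv ⟨i, j⟩) = src (g i) j
  tgt_comp : ∀ {k : ℕ} {m : Fin k → ℕ} (f : Arr k) (g : ∀ i, Arr (m i))
    (h : ∀ i, tgt (g i) = src f i), tgt (comp f g h) = tgt f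
  /-- the symmetric action `f ↦ f σ` -/
  act : ∀ {k l : ℕ}, Arr k → (Fin l ≃ Fin k) → Arr l
  src_act : ∀ {k l : ℕ} (f : Arr k) (σ : Fin l ≃ Fin k) (i : Fin l),
    src (act f σ) i = src f (σ i)
  tgt_act : ∀ {k l : ℕ} (f : Arr k) (σ : Fin l ≃ Fin k), tgt (act f σ) = tgt f
  id_comp : ∀ {k : ℕ} (f : Arr k) (h : ∀ i : Fin 1, tgt f = src (ι (𝟙 (tgt f))) i),
    act (comp (ι (𝟙 (tgt f))) (fun _ => f) h) (idCompPerm k) = f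
  comp_id : ∀ {k : ℕ} (f : Arr k) (h : ∀ i, tgt (ι (𝟙 (src f i))) = src f i),
    act (comp f (fun i => ι (𝟙 (src f i))) h) (compIdPerm k) = f
  assoc : ∀ {k : ℕ} {m : Fin k → ℕ} {n : ∀ i, Fin (m i) → ℕ} (f : Arr k)
    (g : ∀ i, Arr (m i)) (h : ∀ i j, Arr (n i j))
    (hg : ∀ i, tgt (g i) = src f i) (hh : ∀ i j, tgt (h i j) = src (g i) j)
    (hgh : ∀ i, tgt (comp (g i) (h i) (hh i)) = src f i)
    (hfg : ∀ q, tgt (h (finSigmaFinEquiv.symm q).1 (finSigmaFinEquiv.symm q).2) =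
      src (comp f g hg) q),
    comp f (fun i => comp (g i) (h i) (hh i)) hgh =
      act (comp (comp f g hg)
        (fun q => h (finSigmaFinEquiv.symm q).1 (finSigmaFinEquiv.symm q).2) hfg) (assocPerm n)
  act_refl : ∀ {k : ℕ} (f : Arr k), act f (Equiv.refl _) = f
  act_act : ∀ {k l r : ℕ} (f : Arr k) (σ : Fin l ≃ Fin k) (σ' : Fin r ≃ Fin l),
    act (act f σ) σ' = act f (σ'.trans σ)
  act_comp : ∀ {k l : ℕ} {m : Fin k → ℕ} (f : Arr k) (g : ∀ i, Arr (m i))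
    (h : ∀ i, tgt (g i) = src f i) (σ : Fin l ≃ Fin k)
    (h' : ∀ i, tgt (g (σ i)) = src (act f σ) i),
    comp (act f σ) (fun i => g (σ i)) h' = act (comp f g h) (blockPerm m σ)
  comp_act : ∀ {k : ℕ} {m m' : Fin k → ℕ} (f : Arr k) (g : ∀ i, Arr (m i))
    (h : ∀ i, tgt (g i) = src f i) (τ : ∀ i, Fin (m' i) ≃ Fin (m i))
    (h' : ∀ i, tgt (act (g i) (τ i)) = src f i),
    comp f (fun i => act (g i) (τ i)) h' = act (comp f g h) (juxtPerm τ)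
  ι_comp : ∀ {x y z : Obj} (a : x ⟶ y) (b : y ⟶ z) (h : ∀ i : Fin 1, tgt (ι a) = src (ι b) i),
    ι (a ≫ b) = act (comp (ι b) (fun _ => ι a) h) (idCompPerm 1)

attribute [instance] SymMulticat.cat

namespace SymMulticat

/-- The set `Q(x₁, …, x_k; y)`. -/
def Hom (Q : SymMulticat.{u, v, w}) {k : ℕ} (x : Fin k → Q.Obj) (y : Q.Obj) : Type w :=
  {f : Q.Arr k // Q.src f = x ∧ Q.tgt f = y}

/-- A morphism of symmetric multicategories. -/
structure Mor (Q : SymMulticat.{u, v, w}) (R : SymMulticat.{u', v', w'}) where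
  F : Q.Obj ⥤ R.Obj
  map : ∀ {k : ℕ}, Q.Arr k → R.Arr k
  src_map : ∀ {k : ℕ} (f : Q.Arr k) (i : Fin k), R.src (map f) i = F.obj (Q.src f i)
  tgt_map : ∀ {k : ℕ} (f : Q.Arr k), R.tgt (map f) = F.obj (Q.tgt f)
  map_ι : ∀ {x y : Q.Obj} (a : x ⟶ y), map (Q.ι a) = R.ι (F.map a)
  map_comp : ∀ {k : ℕ} {m : Fin k → ℕ} (f : Q.Arr k) (g : ∀ i, Q.Arr (m i))
    (h : ∀ i, Q.tgt (g i) = Q.src f i) (h' : ∀ i, R.tgt (map (g i)) = R.src (map f) i),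
    map (Q.comp f g h) = R.comp (map f) (fun i => map (g i)) h'
  map_act : ∀ {k l : ℕ} (f : Q.Arr k) (σ : Fin l ≃ Fin k), map (Q.act f σ) = R.act (map f) σ

/-- The induced function `Q(x₁, …, x_k; y) → R(Fx₁, …, Fx_k; Fy)`. -/
def Mor.onHom {Q : SymMulticat.{u, v, w}} {R : SymMulticat.{u', v', w'}} (φ : Q.Mor R)
    {k : ℕ} (x : Fin k → Q.Obj) (y : Q.Obj) (f : Q.Hom x y) :
    R.Hom (fun i => φ.F.obj (x i)) (φ.F.obj y) :=
  ⟨φ.map f.1, by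
    obtain ⟨f, rfl, rfl⟩ := f
    exact ⟨funext fun i => φ.src_map f i, φ.tgt_map f⟩⟩

/-- A morphism is an equivalence if it is an equivalence on the categories of objects and full
and faithful on arrows. -/
def Mor.IsEquivalence {Q : SymMulticat.{u, v, w}} {R : SymMulticat.{u', v', w'}}
    (φ : Q.Mor R) : Prop :=
  φ.F.IsEquivalence ∧
    ∀ (k : ℕ) (x : Fin k → Q.Obj) (y : Q.Obj), Function.Bijective (φ.onHom x y)

end SymMulticat

/-! ## Generalised multicategories -/

/-- A (1-level) generalised multicategory. For `t(g) = s(f)_p`, the bijection `amalg f p g _`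
consists of the two amalgamating maps: `ψ[f,g,p]` is its restriction along `Sum.inl` and
`φ[f,g,p]` its restriction along `Sum.inr`. Arrows that are equal have equal arities, and source
elements of equal arrows are compared as numbers. -/
structure GenMulticat where
  Obj : Type u
  Arr : Type w
  ar : Arr → ℕ
  src : ∀ f : Arr, Fin (ar f) → Obj
  tgt : Arr → Obj
  comp : ∀ (f : Arr) (p : Fin (ar f)) (g : Arr), tgt g = src f p → Arr
  tgt_comp : ∀ (f : Arr) (p : Fin (ar f)) (g : Arr) (h : tgt g = src f p),
    tgt (comp f p g h) = tgt f
  amalg : ∀ (f : Arr) (p : Fin (ar f)) (g : Arr) (h : tgt g = src f p),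
    {q : Fin (ar f) // q ≠ p} ⊕ Fin (ar g) ≃ Fin (ar (comp f p g h))
  src_inl : ∀ (f : Arr) (p : Fin (ar f)) (g : Arr) (h : tgt g = src f p)
    (q : {q : Fin (ar f) // q ≠ p}), src (comp f p g h) (amalg f p g h (Sum.inl q)) = src f q
  src_inr : ∀ (f : Arr) (p : Fin (ar f)) (g : Arr) (h : tgt g = src f p) (r : Fin (ar g)),
    src (comp f p g h) (amalg f p g h (Sum.inr r)) = src g r
  id : Obj → Arr
  ar_id : ∀ x, ar (id x) = 1
  src_id : ∀ x i, src (id x) i = x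
  tgt_id : ∀ x, tgt (id x) = x
  id_comp : ∀ (f : Arr) (p : Fin (ar (id (tgt f)))) (h : tgt f = src (id (tgt f)) p),
    comp (id (tgt f)) p f h = f
  id_comp_inr : ∀ (f : Arr) (p : Fin (ar (id (tgt f)))) (h : tgt f = src (id (tgt f)) p)
    (r : Fin (ar f)), (amalg (id (tgt f)) p f h (Sum.inr r) : ℕ) = r
  comp_id : ∀ (f : Arr) (p : Fin (ar f)) (h : tgt (id (src f p)) = src f p),
    comp f p (id (src f p)) h = f
  comp_id_inl : ∀ (f : Arr) (p : Fin (ar f)) (h : tgt (id (src f p)) = src f p)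
    (q : {q : Fin (ar f) // q ≠ p}), (amalg f p (id (src f p)) h (Sum.inl q) : ℕ) = (q : Fin (ar f))
  comp_id_inr : ∀ (f : Arr) (p : Fin (ar f)) (h : tgt (id (src f p)) = src f p)
    (r : Fin (ar (id (src f p)))), (amalg f p (id (src f p)) h (Sum.inr r) : ℕ) = p
  assoc : ∀ (f : Arr) (p : Fin (ar f)) (g : Arr) (q : Fin (ar g)) (h : Arr)
    (e₁ : tgt g = src f p) (e₂ : tgt h = src g q)
    (e₃ : tgt h = src (comp f p g e₁) (amalg f p g e₁ (Sum.inr q)))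
    (e₄ : tgt (comp g q h e₂) = src f p),
    comp (comp f p g e₁) (amalg f p g e₁ (Sum.inr q)) h e₃ = comp f p (comp g q h e₂) e₄
  /-- coherence on the source elements of `f` -/
  assoc_left : ∀ (f : Arr) (p : Fin (ar f)) (g : Arr) (q : Fin (ar g)) (h : Arr)
    (e₁ : tgt g = src f p) (e₂ : tgt h = src g q)
    (e₃ : tgt h = src (comp f p g e₁) (amalg f p g e₁ (Sum.inr q)))
    (e₄ : tgt (comp g q h e₂) = src f p) (r : {r : Fin (ar f) // r ≠ p})
    (n₁ : amalg f p g e₁ (Sum.inl r) ≠ amalg f p g e₁ (Sum.inr q)),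
    (amalg (comp f p g e₁) (amalg f p g e₁ (Sum.inr q)) h e₃
      (Sum.inl ⟨amalg f p g e₁ (Sum.inl r), n₁⟩) : ℕ) =
    amalg f p (comp g q h e₂) e₄ (Sum.inl r)
  /-- coherence on the source elements of `g` -/
  assoc_mid : ∀ (f : Arr) (p : Fin (ar f)) (g : Arr) (q : Fin (ar g)) (h : Arr)
    (e₁ : tgt g = src f p) (e₂ : tgt h = src g q)
    (e₃ : tgt h = src (comp f p g e₁) (amalg f p g e₁ (Sum.inr q)))
    (e₄ : tgt (comp g q h e₂) = src f p) (r : {r : Fin (ar g) // r ≠ q})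
    (n₁ : amalg f p g e₁ (Sum.inr r) ≠ amalg f p g e₁ (Sum.inr q)),
    (amalg (comp f p g e₁) (amalg f p g e₁ (Sum.inr q)) h e₃
      (Sum.inl ⟨amalg f p g e₁ (Sum.inr r), n₁⟩) : ℕ) =
    amalg f p (comp g q h e₂) e₄ (Sum.inr (amalg g q h e₂ (Sum.inl r)))
  /-- coherence on the source elements of `h` -/
  assoc_right : ∀ (f : Arr) (p : Fin (ar f)) (g : Arr) (q : Fin (ar g)) (h : Arr)
    (e₁ : tgt g = src f p) (e₂ : tgt h = src g q)
    (e₃ : tgt h = src (comp f p g e₁) (amalg f p g e₁ (Sum.inr q)))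
    (e₄ : tgt (comp g q h e₂) = src f p) (r : Fin (ar h)),
    (amalg (comp f p g e₁) (amalg f p g e₁ (Sum.inr q)) h e₃ (Sum.inr r) : ℕ) =
    amalg f p (comp g q h e₂) e₄ (Sum.inr (amalg g q h e₂ (Sum.inr r)))
  comm : ∀ (f : Arr) (p q : Fin (ar f)) (hpq : p ≠ q) (g h : Arr)
    (e₁ : tgt g = src f p) (e₂ : tgt h = src f q)
    (e₃ : tgt h = src (comp f p g e₁) (amalg f p g e₁ (Sum.inl ⟨q, hpq.symm⟩)))
    (e₄ : tgt g = src (comp f q h e₂) (amalg f q h e₂ (Sum.inl ⟨p, hpq⟩))),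
    comp (comp f p g e₁) (amalg f p g e₁ (Sum.inl ⟨q, hpq.symm⟩)) h e₃ =
      comp (comp f q h e₂) (amalg f q h e₂ (Sum.inl ⟨p, hpq⟩)) g e₄
  /-- coherence on the source elements of `f` -/
  comm_left : ∀ (f : Arr) (p q : Fin (ar f)) (hpq : p ≠ q) (g h : Arr)
    (e₁ : tgt g = src f p) (e₂ : tgt h = src f q)
    (e₃ : tgt h = src (comp f p g e₁) (amalg f p g e₁ (Sum.inl ⟨q, hpq.symm⟩)))
    (e₄ : tgt g = src (comp f q h e₂) (amalg f q h e₂ (Sum.inl ⟨p, hpq⟩)))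
    (r : Fin (ar f)) (hp : r ≠ p) (hq : r ≠ q)
    (n₁ : amalg f p g e₁ (Sum.inl ⟨r, hp⟩) ≠ amalg f p g e₁ (Sum.inl ⟨q, hpq.symm⟩))
    (n₂ : amalg f q h e₂ (Sum.inl ⟨r, hq⟩) ≠ amalg f q h e₂ (Sum.inl ⟨p, hpq⟩)),
    (amalg (comp f p g e₁) (amalg f p g e₁ (Sum.inl ⟨q, hpq.symm⟩)) h e₃
      (Sum.inl ⟨amalg f p g e₁ (Sum.inl ⟨r, hp⟩), n₁⟩) : ℕ) =
    amalg (comp f q h e₂) (amalg f q h e₂ (Sum.inl ⟨p, hpq⟩)) g e₄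
      (Sum.inl ⟨amalg f q h e₂ (Sum.inl ⟨r, hq⟩), n₂⟩)
  /-- coherence on the source elements of `g`, and, exchanging the roles of `(p, g)` and
  `(q, h)`, on those of `h` -/
  comm_right : ∀ (f : Arr) (p q : Fin (ar f)) (hpq : p ≠ q) (g h : Arr)
    (e₁ : tgt g = src f p) (e₂ : tgt h = src f q)
    (e₃ : tgt h = src (comp f p g e₁) (amalg f p g e₁ (Sum.inl ⟨q, hpq.symm⟩)))
    (e₄ : tgt g = src (comp f q h e₂) (amalg f q h e₂ (Sum.inl ⟨p, hpq⟩)))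
    (r : Fin (ar g))
    (n₁ : amalg f p g e₁ (Sum.inr r) ≠ amalg f p g e₁ (Sum.inl ⟨q, hpq.symm⟩)),
    (amalg (comp f p g e₁) (amalg f p g e₁ (Sum.inl ⟨q, hpq.symm⟩)) h e₃
      (Sum.inl ⟨amalg f p g e₁ (Sum.inr r), n₁⟩) : ℕ) =
    amalg (comp f q h e₂) (amalg f q h e₂ (Sum.inl ⟨p, hpq⟩)) g e₄ (Sum.inr r)

/-! ## Terms with labelled inputs -/

/-- A calculus of terms over a category `C`. An element of `Tm x y`, for a family of objects
`x : K → C`, is thought of as an arrow with target `y` and finitely many inputs, each of them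
labelled by an element `k : K` and then of type `x k`; `supp` is the multiset of the labels.
`bind` substitutes a term for each input according to its label, `var k` is the identity arrow of
`x k` with its input labelled `k`, and `post` composes with an object-morphism at the target. -/
structure TermCalc (C : Type u) [Category.{v} C] where
  Tm : ∀ {K : Type}, (K → C) → C → Type w
  var : ∀ {K : Type} {x : K → C} (k : K), Tm x (x k)
  bind : ∀ {K K' : Type} {x : K → C} {z : K' → C} {y : C},
    Tm x y → (∀ k, Tm z (x k)) → Tm z y
  post : ∀ {K : Type} {x : K → C} {y y' : C}, Tm x y → (y ⟶ y') → Tm x y'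
  supp : ∀ {K : Type} {x : K → C} {y : C}, Tm x y → Multiset K
  var_bind : ∀ {K K' : Type} {x : K → C} {z : K' → C} (k : K) (s : ∀ k, Tm z (x k)),
    bind (var k) s = s k
  bind_var : ∀ {K : Type} {x : K → C} {y : C} (t : Tm x y), bind t (fun k => var k) = t
  bind_bind : ∀ {K K' K'' : Type} {x : K → C} {z : K' → C} {z' : K'' → C} {y : C}
    (t : Tm x y) (s : ∀ k, Tm z (x k)) (r : ∀ k, Tm z' (z k)),
    bind (bind t s) r = bind t (fun k => bind (s k) r)
  post_id : ∀ {K : Type} {x : K → C} {y : C} (t : Tm x y), post t (𝟙 y) = t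
  post_post : ∀ {K : Type} {x : K → C} {y y' y'' : C} (t : Tm x y) (a : y ⟶ y') (b : y' ⟶ y''),
    post (post t a) b = post t (a ≫ b)
  post_bind : ∀ {K K' : Type} {x : K → C} {z : K' → C} {y y' : C}
    (t : Tm x y) (a : y ⟶ y') (s : ∀ k, Tm z (x k)), bind (post t a) s = post (bind t s) a
  supp_var : ∀ {K : Type} {x : K → C} (k : K), supp (var (x := x) k) = {k}
  supp_bind : ∀ {K K' : Type} {x : K → C} {z : K' → C} {y : C}
    (t : Tm x y) (s : ∀ k, Tm z (x k)), supp (bind t s) = (supp t).bind fun k => supp (s k)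
  supp_post : ∀ {K : Type} {x : K → C} {y y' : C} (t : Tm x y) (a : y ⟶ y'),
    supp (post t a) = supp t

namespace TermCalc

variable {C : Type u} [Category.{v} C] (𝒯 : TermCalc.{u, v, w} C)

/-- Relabelling of the inputs. -/
def map {K K' : Type} {x : K → C} {z : K' → C} {y : C} (t : 𝒯.Tm x y) (e : K → K')
    (h : ∀ k, z (e k) = x k) : 𝒯.Tm z y :=
  𝒯.bind t fun k => 𝒯.post (𝒯.var (e k)) (eqToHom (h k))

variable {𝒯}

theorem map_bind {K K' K'' : Type} {x : K → C} {z : K' → C} {z' : K'' → C} {y : C}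
    (t : 𝒯.Tm x y) (e : K → K') (h : ∀ k, z (e k) = x k) (s : ∀ k, 𝒯.Tm z' (z k)) :
    𝒯.bind (𝒯.map t e h) s = 𝒯.bind t fun k => 𝒯.post (s (e k)) (eqToHom (h k)) := by
  simp only [map, 𝒯.bind_bind, 𝒯.post_bind, 𝒯.var_bind]

theorem bind_map {K K' K'' : Type} {x : K → C} {z : K' → C} {z' : K'' → C} {y : C}
    (t : 𝒯.Tm x y) (s : ∀ k, 𝒯.Tm z (x k)) (e : K' → K'') (h : ∀ k, z' (e k) = z k) :
    𝒯.map (𝒯.bind t s) e h = 𝒯.bind t fun k => 𝒯.map (s k) e h := by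
  simp only [map, 𝒯.bind_bind]

theorem post_map {K K' : Type} {x : K → C} {z : K' → C} {y y' : C} (t : 𝒯.Tm x y)
    (a : y ⟶ y') (e : K → K') (h : ∀ k, z (e k) = x k) :
    𝒯.map (𝒯.post t a) e h = 𝒯.post (𝒯.map t e h) a := by
  simp only [map, 𝒯.post_bind]

theorem var_map {K K' : Type} {x : K → C} {z : K' → C} (k : K) (e : K → K')
    (h : ∀ k, z (e k) = x k) :
    𝒯.map (𝒯.var (x := x) k) e h = 𝒯.post (𝒯.var (e k)) (eqToHom (h k)) := by
  simp only [map, 𝒯.var_bind]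

theorem map_map {K K' K'' : Type} {x : K → C} {z : K' → C} {z' : K'' → C} {y : C}
    (t : 𝒯.Tm x y) (e : K → K') (h : ∀ k, z (e k) = x k) (e' : K' → K'')
    (h' : ∀ k, z' (e' k) = z k) :
    𝒯.map (𝒯.map t e h) e' h' = 𝒯.map t (fun k => e' (e k)) (fun k => (h' _).trans (h k)) := by
  simp only [map, 𝒯.bind_bind, 𝒯.post_bind, 𝒯.var_bind, 𝒯.post_post, eqToHom_trans]

theorem map_id {K : Type} {x : K → C} {y : C} (t : 𝒯.Tm x y) (e : K → K) (he : ∀ k, e k = k)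
    (h : ∀ k, x (e k) = x k) : 𝒯.map t e h = t := by
  obtain rfl : e = fun k => k := funext he
  simp only [map, eqToHom_refl, 𝒯.post_id, 𝒯.bind_var]

theorem supp_map {K K' : Type} {x : K → C} {z : K' → C} {y : C} (t : 𝒯.Tm x y) (e : K → K')
    (h : ∀ k, z (e k) = x k) : 𝒯.supp (𝒯.map t e h) = (𝒯.supp t).map e := by
  simp only [map, 𝒯.supp_bind, 𝒯.supp_post, 𝒯.supp_var, Multiset.bind_singleton]

variable (𝒯)

/-- A term with inputs labelled by `1, …, k`, each label being used exactly once. -/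
structure Lin (k : ℕ) where
  src : Fin k → C
  tgt : C
  tm : 𝒯.Tm src tgt
  lin : 𝒯.supp tm = Finset.univ.val

variable {𝒯}

theorem Lin.ext' {k : ℕ} (F F' : 𝒯.Lin k) (h₁ : ∀ i, F'.src i = F.src i) (h₂ : F.tgt = F'.tgt)
    (h₃ : 𝒯.map (𝒯.post F.tm (eqToHom h₂)) (fun i => i) h₁ = F'.tm) : F = F' := by
  obtain ⟨s, t, a, l⟩ := F
  obtain ⟨s', t', a', l'⟩ := F'
  obtain rfl : s' = s := funext h₁
  obtain rfl : t = t' := h₂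
  simp only [eqToHom_refl, 𝒯.post_id] at h₃
  rw [map_id _ _ (fun _ => rfl)] at h₃
  subst h₃
  rfl

theorem univ_map_equiv {α β : Type} [Fintype α] [Fintype β] (e : α ≃ β) :
    (Finset.univ.val : Multiset α).map e = Finset.univ.val := by
  have := Finset.map_univ_equiv e
  rw [← this]; rfl

theorem univ_sigma_bind {k : ℕ} {m : Fin k → ℕ} :
    (Finset.univ.val : Multiset (Fin k)).bind (fun i =>
      (Finset.univ.val : Multiset (Fin (m i))).map fun j => finSigmaFinEquiv ⟨i, j⟩) =
    Finset.univ.val := by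
  rw [← univ_map_equiv (finSigmaFinEquiv (n := m))]
  rw [← Finset.univ_sigma_univ]
  change _ = Multiset.map _ ((Finset.univ.val : Multiset (Fin k)).sigma
    fun i => (Finset.univ.val : Multiset (Fin (m i))))
  rw [Multiset.sigma, Multiset.map_bind]
  simp only [Multiset.map_map, Function.comp_def]

end TermCalc

namespace TermCalc

variable {C : Type u} [Category.{v} C] {𝒯 : TermCalc.{u, v, w} C}

theorem Lin.src_congr {k : ℕ} {m : Fin k → ℕ} (G : ∀ i, 𝒯.Lin (m i)) {s s' : Σ i, Fin (m i)}
    (h : s = s') : (G s.1).src s.2 = (G s'.1).src s'.2 := by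
  subst h; rfl

theorem Lin.bind_lin {k : ℕ} {m : Fin k → ℕ} (F : 𝒯.Lin k) (G : ∀ i, 𝒯.Lin (m i))
    (h : ∀ i, (G i).tgt = F.src i) :
    𝒯.supp (𝒯.bind F.tm fun i => 𝒯.post (𝒯.map (z := fun q =>
      (G (finSigmaFinEquiv.symm q).1).src (finSigmaFinEquiv.symm q).2) (G i).tm
      (fun j => finSigmaFinEquiv ⟨i, j⟩)
      (fun j => Lin.src_congr G (finSigmaFinEquiv.symm_apply_apply ⟨i, j⟩))) (eqToHom (h i))) =
    (Finset.univ : Finset (Fin (∑ i, m i))).val := by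
  rw [𝒯.supp_bind, F.lin, ← univ_sigma_bind]
  refine congrArg _ (funext fun i => ?_)
  rw [𝒯.supp_post, supp_map, (G i).lin]

/-- The composite `F ∘ (G₁, …, G_k)`: substitute `G_i` for the `i`-th input and number the
inputs of the result lexicographically. -/
abbrev Lin.comp {k : ℕ} {m : Fin k → ℕ} (F : 𝒯.Lin k) (G : ∀ i, 𝒯.Lin (m i))
    (h : ∀ i, (G i).tgt = F.src i) : 𝒯.Lin (∑ i, m i) where
  src q := (G (finSigmaFinEquiv.symm q).1).src (finSigmaFinEquiv.symm q).2
  tgt := F.tgt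
  tm := 𝒯.bind F.tm fun i => 𝒯.post (𝒯.map (G i).tm (fun j => finSigmaFinEquiv ⟨i, j⟩)
    (fun j => Lin.src_congr G (finSigmaFinEquiv.symm_apply_apply ⟨i, j⟩))) (eqToHom (h i))
  lin := Lin.bind_lin F G h

/-- The action of a permutation `σ`: an input with label `j` is relabelled `σ⁻¹ j`. -/
abbrev Lin.act {k l : ℕ} (F : 𝒯.Lin k) (σ : Fin l ≃ Fin k) : 𝒯.Lin l where
  src i := F.src (σ i)
  tgt := F.tgt
  tm := 𝒯.map F.tm σ.symm (fun j => congrArg F.src (σ.apply_symm_apply j))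
  lin := by rw [supp_map, F.lin, univ_map_equiv]

/-- The unary arrow given by an object-morphism. -/
abbrev Lin.ι (𝒯 : TermCalc.{u, v, w} C) {x y : C} (a : x ⟶ y) : 𝒯.Lin 1 where
  src _ := x
  tgt := y
  tm := 𝒯.post (𝒯.var (x := fun _ : Fin 1 => x) 0) a
  lin := by rw [𝒯.supp_post, 𝒯.supp_var]; rfl

theorem Lin.mk_eq {k : ℕ} {s s' : Fin k → C} {t : C} {a : 𝒯.Tm s t} {a' : 𝒯.Tm s' t}
    {l : 𝒯.supp a = Finset.univ.val} {l' : 𝒯.supp a' = Finset.univ.val}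
    (h₁ : ∀ i, s' i = s i) (h₃ : 𝒯.map a (fun i => i) h₁ = a') :
    (⟨s, t, a, l⟩ : 𝒯.Lin k) = ⟨s', t, a', l'⟩ := by
  obtain rfl : s' = s := funext h₁
  rw [map_id _ _ (fun _ => rfl)] at h₃
  subst h₃
  rfl

theorem map_congr {K K' : Type} {x : K → C} {z : K' → C} {y : C} (t : 𝒯.Tm x y)
    {e e' : K → K'} (h : ∀ k, z (e k) = x k) (he : ∀ k, e k = e' k) :
    𝒯.map t e h = 𝒯.map t e' (fun k => he k ▸ h k) := by
  obtain rfl : e = e' := funext he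
  rfl

theorem bind_congr {K K' : Type} {x : K → C} {z : K' → C} {y : C} (t : 𝒯.Tm x y)
    {s s' : ∀ k, 𝒯.Tm z (x k)} (h : ∀ k, s k = s' k) : 𝒯.bind t s = 𝒯.bind t s' :=
  congrArg _ (funext h)

theorem Lin.tm_congr {k : ℕ} {m : Fin k → ℕ}
    {n : ∀ i, Fin (m i) → ℕ} (L : ∀ i j, 𝒯.Lin (n i j)) {K : Type} {z : K → C} {y : C}
    {s s' : Σ i, Fin (m i)} (hs : s = s') (e : ∀ s : Σ i, Fin (m i), Fin (n s.1 s.2) → K)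
    (h : ∀ s j, z (e s j) = (L s.1 s.2).src j) (ht : (L s.1 s.2).tgt = y)
    (ht' : (L s'.1 s'.2).tgt = y) :
    𝒯.post (𝒯.map (L s.1 s.2).tm (e s) (h s)) (eqToHom ht) =
      𝒯.post (𝒯.map (L s'.1 s'.2).tm (e s') (h s')) (eqToHom ht') := by
  subst hs; rfl

/-- The symmetric multicategory of the terms in which each label is used exactly once. -/
def toSymMulticat (𝒯 : TermCalc.{u, v, w} C) : SymMulticat.{u, v, max u w} where
  Obj := C
  Arr := 𝒯.Lin
  src := Lin.src
  tgt := Lin.tgt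
  ι := Lin.ι 𝒯
  src_ι _ _ := rfl
  tgt_ι _ := rfl
  comp := Lin.comp
  src_comp F G h i j := Lin.src_congr G (finSigmaFinEquiv.symm_apply_apply ⟨i, j⟩)
  tgt_comp _ _ _ := rfl
  act := Lin.act
  src_act _ _ _ := rfl
  tgt_act _ _ := rfl
  id_comp {k} F h := by
    refine Lin.mk_eq (fun i => ?_) ?_
    · simp [Lin.comp, idCompPerm]
    · dsimp only [Lin.comp, Lin.ι, Lin.act]
      simp only [𝒯.post_id, 𝒯.var_bind, map_map, eqToHom_refl]
      refine map_id _ _ (fun k => ?_) _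
      simp [idCompPerm, Equiv.symm_apply_eq]; rfl
  comp_id {k} F h := by
    refine Lin.mk_eq (fun i => ?_) ?_
    · simp [Lin.comp, compIdPerm, Lin.ι]
    · dsimp only [Lin.comp, Lin.ι, Lin.act]
      simp only [𝒯.post_id, map_map, bind_map, var_map, post_map, 𝒯.post_post,
        eqToHom_trans]
      refine map_id F.tm (fun k' => (compIdPerm k).symm (finSigmaFinEquiv ⟨k', 0⟩))
        (fun k' => ?_) ?_
      simp [compIdPerm, Equiv.symm_apply_eq]
  assoc {k m n} F G H hG hH hGH hFG := by
    refine Lin.mk_eq (fun i => ?_) ?_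
    · exact congrArg (fun s : Σ i, Σ j, Fin (n i j) => (H s.1 s.2.1).src s.2.2)
        (assocPerm_triple n i)
    · dsimp only [Lin.comp, Lin.ι, Lin.act]
      simp only [𝒯.bind_bind, bind_map, post_map, 𝒯.post_bind, map_bind, 𝒯.post_post,
        map_map, eqToHom_trans]
      refine bind_congr _ fun i => congrArg (fun t => 𝒯.post t _) (bind_congr _ fun j => ?_)
      refine (Lin.tm_congr H (s := ⟨i, j⟩) (s' := finSigmaFinEquiv.symm (finSigmaFinEquiv ⟨i, j⟩))
        (Equiv.symm_apply_apply _ _).symm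
        (fun s l => finSigmaFinEquiv (n := fun i => ∑ j, n i j)
          ⟨s.1, finSigmaFinEquiv (n := n s.1) ⟨s.2, l⟩⟩)
        (fun s l => ?_) _ _).trans (congrArg (fun t => 𝒯.post t _) (map_congr _ _ fun l => ?_))
      · refine (congrArg (fun s : Σ i, Σ j, Fin (n i j) => (H s.1 s.2.1).src s.2.2)
          (assocPerm_triple n _)).trans ?_
        rw [Equiv.symm_apply_apply]
        change (fun s : Σ j, Fin (n _ j) => (H _ s.1).src s.2)
          (finSigmaFinEquiv.symm (finSigmaFinEquiv _)) = _
        rw [Equiv.symm_apply_apply]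
      · rw [assocPerm_symm]
  act_refl F := by
    refine Lin.mk_eq (fun i => rfl) ?_
    dsimp only [Lin.comp, Lin.ι, Lin.act, Equiv.refl_apply]
    exact (map_map _ _ _ _ _).trans (map_id _ _ (fun _ => rfl) _)
  act_act F σ σ' := by
    refine Lin.mk_eq (fun i => rfl) ?_
    dsimp only [Lin.comp, Lin.ι, Lin.act, Equiv.trans_apply]
    simp only [map_map]
    exact map_map _ _ _ _ _
  act_comp {k l m} F G h σ h' := by
    refine Lin.mk_eq (fun i => ?_) ?_
    · refine Lin.src_congr G (s := finSigmaFinEquiv.symm (blockPerm _ σ i))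
        (s' := ⟨σ (finSigmaFinEquiv.symm i).1, (finSigmaFinEquiv.symm i).2⟩) ?_
      simp [blockPerm]
    · dsimp only [Lin.comp, Lin.ι, Lin.act]
      simp only [𝒯.bind_bind, bind_map, post_map, 𝒯.post_bind, map_bind, 𝒯.post_post,
        map_map, eqToHom_trans]
      refine bind_congr _ fun i => ?_
      have key : ∀ (z : Fin (∑ i, m (σ i)) → C) (j : Fin l) (_ : σ j = i) (h₁ h₂ h₃ h₄),
          𝒯.post (𝒯.map (z := z) (G (σ j)).tm (fun k => finSigmaFinEquiv ⟨j, k⟩) h₁)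
            (eqToHom h₂) =
          𝒯.post (𝒯.map (z := z) (G i).tm
            (fun k => (blockPerm _ σ).symm (finSigmaFinEquiv ⟨i, k⟩)) h₃)
            (eqToHom (Y := F.src i) h₄) := by
        rintro z j rfl h₁ h₂ h₃ h₄
        refine congrArg (fun t => 𝒯.post t _) (map_congr _ _ fun l => ?_)
        simp [blockPerm, Equiv.eq_symm_apply]
      exact key _ _ (σ.apply_symm_apply i) _ _ _ _
  comp_act F G h τ h' := by
    refine Lin.mk_eq (fun i => ?_) ?_
    · refine Lin.src_congr G (s := finSigmaFinEquiv.symm (juxtPerm τ i))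
        (s' := ⟨(finSigmaFinEquiv.symm i).1, τ _ (finSigmaFinEquiv.symm i).2⟩) ?_
      simp [juxtPerm]
    · dsimp only [Lin.comp, Lin.ι, Lin.act]
      simp only [𝒯.bind_bind, bind_map, post_map, 𝒯.post_bind, map_bind, 𝒯.post_post,
        map_map, eqToHom_trans]
      refine bind_congr _ fun i => congrArg (fun t => 𝒯.post t _) ?_
      refine map_congr _ _ fun j => ?_
      simp [juxtPerm, Equiv.eq_symm_apply]
  ι_comp a b h := by
    refine Lin.mk_eq (fun i => rfl) ?_
    dsimp only [Lin.comp, Lin.ι, Lin.act]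
    simp only [𝒯.post_bind, 𝒯.var_bind, 𝒯.post_post, map_map, post_map, var_map, eqToHom_trans]
    rw [show (idCompPerm 1).symm (finSigmaFinEquiv ⟨0, 0⟩) = 0 from Subsingleton.elim _ _]
    simp only [eqToHom_refl, Category.id_comp, Category.comp_id]

end TermCalc

/-! ## Labelled trees -/

/-- A list of source objects and a target object. -/
structure Shape (C : Type u) where
  ar : ℕ
  src : Fin ar → C
  tgt : C

/-- Planar trees with nodes labelled in `N`, leaves labelled in `L` and edges labelled by
object-morphisms. A node labelled `i` has `(f i).ar` incoming edges. An edge from a node labelled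
`i` carries a morphism with domain `(f i).tgt`, an edge from a leaf labelled `l` one with domain
`x l`; the edge into the `p`-th input of a node labelled `i` carries a morphism with codomain
`(f i).src p`, and the root edge one with codomain the index `y`. -/
inductive PTree {C : Type u} [Category.{v} C] {N L : Type} (f : N → Shape C) (x : L → C) :
    C → Type (max u v)
  | leaf {y : C} (l : L) (a : x l ⟶ y) : PTree f x y
  | node {y : C} (i : N) (a : (f i).tgt ⟶ y)
      (ch : ∀ p : Fin (f i).ar, PTree f x ((f i).src p)) : PTree f x y

namespace PTree

variable {C : Type u} [Category.{v} C] {N N' N'' L L' L'' : Type} {f : N → Shape C}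
  {f' : N' → Shape C} {f'' : N'' → Shape C} {x : L → C} {x' : L' → C} {x'' : L'' → C}

/-- Compose the label of the root edge with `b`. -/
def post {y z : C} : PTree f x y → (y ⟶ z) → PTree f x z
  | leaf l a, b => leaf l (a ≫ b)
  | node i a ch, b => node i (a ≫ b) ch

/-- Graft trees onto the leaves, composing the labels of the edges that are joined. -/
def bind {y : C} : PTree f x y → (∀ l, PTree f x' (x l)) → PTree f x' y
  | leaf l a, s => (s l).post a
  | node i a ch, s => node i a fun p => (ch p).bind s

/-- Replace each node labelled `i` by the tree `s i`, the `p`-th input of the node being joined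
to the leaf of `s i` labelled `p`. -/
def subst {y : C} : PTree f x y → (∀ i, PTree f' (f i).src (f i).tgt) → PTree f' x y
  | leaf l a, _ => leaf l a
  | node i a ch, s => ((s i).bind fun p => (ch p).subst s).post a

/-- The tree with a single node, labelled `i`, and identities as edge labels. -/
def corolla (i : N) : PTree f (f i).src (f i).tgt :=
  node i (𝟙 _) fun p => leaf p (𝟙 _)

/-- The labels of the nodes, in depth first order (a node before those above it, and these
from left to right). -/
def nodes {y : C} : PTree f x y → List N
  | leaf _ _ => []
  | node i _ ch => i :: (List.finRange (f i).ar).flatMap fun p => (ch p).nodes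

@[simp] theorem post_leaf {y z : C} (l : L) (a : x l ⟶ y) (b : y ⟶ z) :
    (leaf l a : PTree f x y).post b = leaf l (a ≫ b) := rfl

@[simp] theorem post_node {y z : C} (i : N) (a : (f i).tgt ⟶ y)
    (ch : ∀ p, PTree f x ((f i).src p)) (b : y ⟶ z) :
    (node i a ch).post b = node i (a ≫ b) ch := rfl

theorem post_id {y : C} (t : PTree f x y) : t.post (𝟙 y) = t := by
  cases t <;> simp

theorem post_post {y y' y'' : C} (t : PTree f x y) (a : y ⟶ y') (b : y' ⟶ y'') :
    (t.post a).post b = t.post (a ≫ b) := by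
  cases t <;> simp

theorem post_bind {y y' : C} (t : PTree f x y) (a : y ⟶ y') (s : ∀ l, PTree f x' (x l)) :
    (t.post a).bind s = (t.bind s).post a := by
  cases t <;> simp [bind, post_post]

theorem bind_bind {y : C} (t : PTree f x y) (s : ∀ l, PTree f x' (x l))
    (r : ∀ l, PTree f x'' (x' l)) : (t.bind s).bind r = t.bind fun l => (s l).bind r := by
  induction t with
  | leaf l a => simp [bind, post_bind]
  | node i a ch ih => simp [bind, ih]

theorem bind_leaf {y : C} (t : PTree f x y) : (t.bind fun l => leaf l (𝟙 _)) = t := by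
  induction t with
  | leaf l a => simp [bind, post]
  | node i a ch ih => simp [bind, ih]

theorem post_subst {y y' : C} (t : PTree f x y) (a : y ⟶ y')
    (s : ∀ i, PTree f' (f i).src (f i).tgt) : (t.post a).subst s = (t.subst s).post a := by
  cases t <;> simp [subst, post_post]

theorem bind_subst {y : C} (t : PTree f x y) (s : ∀ l, PTree f x' (x l))
    (r : ∀ i, PTree f' (f i).src (f i).tgt) :
    (t.bind s).subst r = (t.subst r).bind fun l => (s l).subst r := by
  induction t with
  | leaf l a => simp [bind, subst, post_subst]
  | node i a ch ih => simp [bind, subst, ih, post_bind, bind_bind]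

theorem subst_subst {y : C} (t : PTree f x y) (s : ∀ i, PTree f' (f i).src (f i).tgt)
    (r : ∀ i, PTree f'' (f' i).src (f' i).tgt) :
    (t.subst s).subst r = t.subst fun i => (s i).subst r := by
  induction t with
  | leaf l a => simp [subst]
  | node i a ch ih => simp [subst, post_subst, bind_subst, ih]

theorem subst_corolla {y : C} (t : PTree f x y) : t.subst corolla = t := by
  induction t with
  | leaf l a => simp [subst]
  | node i a ch ih => simp [subst, corolla, bind, ih, post_id]

theorem corolla_subst (i : N) (s : ∀ i, PTree f' (f i).src (f i).tgt) :
    (corolla i).subst s = s i := by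
  simp [corolla, subst, bind_leaf, post_id]

theorem nodes_post {y y' : C} (t : PTree f x y) (a : y ⟶ y') : (t.post a).nodes = t.nodes := by
  cases t <;> simp [nodes]

theorem coe_nodes_node {y : C} (i : N) (a : (f i).tgt ⟶ y)
    (ch : ∀ p, PTree f x ((f i).src p)) : ((node i a ch).nodes : Multiset N) =
      i ::ₘ (Finset.univ.val : Multiset (Fin (f i).ar)).bind fun p => ((ch p).nodes : Multiset N) := by
  simp only [nodes, ← Multiset.cons_coe]
  rw [← Multiset.coe_bind]
  rfl

/-- The composite of a tree, given a term for each node. -/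
def eval (𝒯 : TermCalc.{u, v, w} C) (g : ∀ i, 𝒯.Tm (f i).src (f i).tgt) {y : C} :
    PTree f x y → 𝒯.Tm x y
  | leaf l a => 𝒯.post (𝒯.var l) a
  | node i a ch => 𝒯.post (𝒯.bind (g i) fun p => (ch p).eval 𝒯 g) a

variable {𝒯 : TermCalc.{u, v, w} C} {g : ∀ i, 𝒯.Tm (f i).src (f i).tgt}
  {g' : ∀ i, 𝒯.Tm (f' i).src (f' i).tgt}

theorem eval_post {y y' : C} (t : PTree f x y) (a : y ⟶ y') :
    (t.post a).eval 𝒯 g = 𝒯.post (t.eval 𝒯 g) a := by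
  cases t <;> simp [eval, 𝒯.post_post]

theorem eval_bind {y : C} (t : PTree f x y) (s : ∀ l, PTree f x' (x l)) :
    (t.bind s).eval 𝒯 g = 𝒯.bind (t.eval 𝒯 g) fun l => (s l).eval 𝒯 g := by
  induction t with
  | leaf l a => simp [bind, eval, eval_post, 𝒯.post_bind, 𝒯.var_bind]
  | node i a ch ih => simp [bind, eval, ih, 𝒯.post_bind, 𝒯.bind_bind]

theorem eval_subst {y : C} (t : PTree f x y) (s : ∀ i, PTree f' (f i).src (f i).tgt)
    (h : ∀ i, (s i).eval 𝒯 g' = g i) : (t.subst s).eval 𝒯 g' = t.eval 𝒯 g := by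
  induction t with
  | leaf l a => simp [subst, eval]
  | node i a ch ih => simp [subst, eval, eval_post, eval_bind, ih, h]

theorem eval_corolla (i : N) : (corolla i).eval 𝒯 g = g i := by
  simp [corolla, eval, 𝒯.post_id, 𝒯.bind_var]

theorem nodes_bind {y : C} (t : PTree f x y) (s : ∀ l, PTree f x' (x l))
    (hg : ∀ i, 𝒯.supp (g i) = Finset.univ.val) :
    ((t.bind s).nodes : Multiset N) =
      t.nodes + (𝒯.supp (t.eval 𝒯 g)).bind fun l => ((s l).nodes : Multiset N) := by
  induction t with
  | leaf l a => simp [bind, nodes, nodes_post, eval, 𝒯.supp_post, 𝒯.supp_var]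
  | node i a ch ih =>
    simp only [bind, coe_nodes_node, ih, eval, 𝒯.supp_post, 𝒯.supp_bind, hg,
      Multiset.bind_assoc, Multiset.bind_add, Multiset.cons_add]

theorem nodes_subst {y : C} (t : PTree f x y) (s : ∀ i, PTree f' (f i).src (f i).tgt)
    (h : ∀ i, (s i).eval 𝒯 g' = g i) (hg : ∀ i, 𝒯.supp (g i) = Finset.univ.val)
    (hg' : ∀ i, 𝒯.supp (g' i) = Finset.univ.val) :
    ((t.subst s).nodes : Multiset N') =
      (t.nodes : Multiset N).bind fun i => ((s i).nodes : Multiset N') := by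
  induction t with
  | leaf l a => simp [subst, nodes]
  | node i a ch ih =>
    rw [subst, nodes_post, nodes_bind (𝒯 := 𝒯) (g := g') _ _ hg', h, hg, coe_nodes_node]
    simp only [ih, Multiset.cons_bind, Multiset.bind_assoc]

end PTree

/-! ## Elements and slicing -/

namespace TermCalc

variable {C : Type u} [Category.{v} C]

/-- An element of a term calculus: an arrow with numbered inputs. -/
structure Elt (𝒯 : TermCalc.{u, v, w} C) where
  shape : Shape C
  tm : 𝒯.Tm shape.src shape.tgt
  lin : 𝒯.supp tm = Finset.univ.val

/-- A morphism `g ⟶ g'` of elements, for `g : (x₁,…,x_m) → x` and `g' : (y₁,…,y_m) → y`, is a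
permutation `σ` with object-morphisms `y_{σ i} ⟶ x_i` and `x ⟶ y` that take `g` to `g'`:
composing `g` with them gives an arrow with sources `y_{σ 1}, …, y_{σ m}`, whose `i`-th input
is the `σ i`-th input of `g'`. -/
@[ext] structure Elt.Hom {𝒯 : TermCalc.{u, v, w} C} (g g' : 𝒯.Elt) where
  σ : Fin g.shape.ar ≃ Fin g'.shape.ar
  pre : ∀ i, g'.shape.src (σ i) ⟶ g.shape.src i
  post : g.shape.tgt ⟶ g'.shape.tgt
  eq : 𝒯.post (𝒯.bind g.tm fun i => 𝒯.post (𝒯.var (σ i)) (pre i)) post = g'.tm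

instance Elt.category (𝒯 : TermCalc.{u, v, w} C) : Category 𝒯.Elt where
  Hom := Elt.Hom
  id g :=
    { σ := Equiv.refl _
      pre := fun _ => 𝟙 _
      post := 𝟙 _
      eq := by simp [𝒯.post_id, 𝒯.bind_var] }
  comp a b :=
    { σ := a.σ.trans b.σ
      pre := fun i => b.pre (a.σ i) ≫ a.pre i
      post := a.post ≫ b.post
      eq := by
        rw [← b.eq, ← a.eq]
        simp [𝒯.post_post, 𝒯.post_bind, 𝒯.bind_bind, 𝒯.var_bind] }
  id_comp a := by ext <;> simp
  comp_id a := by ext <;> simp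
  assoc a b c := by ext <;> simp

end TermCalc

namespace PTree

variable {C : Type u} [Category.{v} C] {N N' : Type} {f : N → Shape C} {f' : N' → Shape C}
  {𝒯 : TermCalc.{u, v, w} C} {a b c : 𝒯.Elt}

/-- The action of a morphism of elements on a tree: permute the labels of the leaves, and
compose the object-morphisms with the labels of the edges at the leaves and at the root. -/
def conj (t : PTree f a.shape.src a.shape.tgt) (α : a ⟶ b) :
    PTree f b.shape.src b.shape.tgt :=
  (t.bind fun p => leaf (α.σ p) (α.pre p)).post α.post

theorem conj_id (t : PTree f a.shape.src a.shape.tgt) : t.conj (𝟙 a) = t :=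
  (post_id _).trans (bind_leaf _)

theorem conj_comp (t : PTree f a.shape.src a.shape.tgt) (α : a ⟶ b) (β : b ⟶ c) :
    t.conj (α ≫ β) = (t.conj α).conj β := by
  simp only [conj, post_bind, post_post, bind_bind]
  rfl

theorem conj_subst (t : PTree f a.shape.src a.shape.tgt) (α : a ⟶ b)
    (s : ∀ i, PTree f' (f i).src (f i).tgt) : (t.conj α).subst s = (t.subst s).conj α := by
  simp only [conj, post_subst, bind_subst]
  rfl

theorem eval_conj {g : ∀ i, 𝒯.Tm (f i).src (f i).tgt} (t : PTree f a.shape.src a.shape.tgt)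
    (α : a ⟶ b) (h : t.eval 𝒯 g = a.tm) : (t.conj α).eval 𝒯 g = b.tm := by
  rw [conj, eval_post, eval_bind, h]
  exact α.eq

theorem nodes_conj {g : ∀ i, 𝒯.Tm (f i).src (f i).tgt} (hg : ∀ i, 𝒯.supp (g i) = Finset.univ.val)
    (t : PTree f a.shape.src a.shape.tgt) (α : a ⟶ b) :
    ((t.conj α).nodes : Multiset N) = t.nodes := by
  rw [conj, nodes_post, nodes_bind (𝒯 := 𝒯) _ _ hg]
  simp [PTree.nodes]

end PTree

namespace TermCalc

variable {C : Type u} [Category.{v} C] {𝒯 : TermCalc.{u, v, w} C} {G : Type u'}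
  [Category.{v'} G] (E : G ⥤ 𝒯.Elt)

/-- Trees with nodes labelled by `K`, the node `k` standing for the element `E (f k)`, whose
composite is the element `E g`. -/
def SliceTm {K : Type} (f : K → G) (g : G) : Type (max u v) :=
  {t : PTree (fun k => (E.obj (f k)).shape) (E.obj g).shape.src (E.obj g).shape.tgt //
    t.eval 𝒯 (fun k => (E.obj (f k)).tm) = (E.obj g).tm}

/-- The term calculus of trees: the inputs of a tree are its nodes, and substitution replaces
nodes by trees. -/
def slice : TermCalc.{u', v', max u v} G where
  Tm := SliceTm E
  var k := ⟨PTree.corolla k, PTree.eval_corolla _⟩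
  bind t s := ⟨t.1.subst fun k => (s k).1,
    (PTree.eval_subst _ _ fun k => (s k).2).trans t.2⟩
  post t α := ⟨t.1.conj (E.map α), PTree.eval_conj _ _ t.2⟩
  supp t := t.1.nodes
  var_bind k s := Subtype.ext (PTree.corolla_subst _ _)
  bind_var t := Subtype.ext (PTree.subst_corolla _)
  bind_bind t s r := Subtype.ext (PTree.subst_subst _ _ _)
  post_id t := Subtype.ext <| by
    rw [E.map_id]
    exact PTree.conj_id _
  post_post t a b := Subtype.ext <| by
    rw [E.map_comp]
    exact (PTree.conj_comp _ _ _).symm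
  post_bind t a s := Subtype.ext (PTree.conj_subst _ _ _)
  supp_var k := by simp [PTree.corolla, PTree.nodes]
  supp_bind t s := PTree.nodes_subst _ _ (fun k => (s k).2) (fun _ => Elt.lin _)
    (fun _ => Elt.lin _)
  supp_post t a := PTree.nodes_conj (fun k => (E.obj _).lin) _ _

end TermCalc

/-! ## The slice of a symmetric multicategory -/

namespace SymMulticat

/-- An arrow of `Q` with target `y` whose inputs are labelled by elements of `K`, an input
labelled `k` having the source `x k`. -/
structure LArr (Q : SymMulticat.{u, v, w}) {K : Type} (x : K → Q.Obj) (y : Q.Obj) where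
  ar : ℕ
  arr : Q.Arr ar
  lbl : Fin ar → K
  src_eq : ∀ i, Q.src arr i = x (lbl i)
  tgt_eq : Q.tgt arr = y

namespace LArr

variable {Q : SymMulticat.{u, v, w}} {K K' K'' : Type} {x : K → Q.Obj} {x' : K' → Q.Obj}
  {x'' : K'' → Q.Obj} {y : Q.Obj}

/-- `(f, ℓ)` and `(f σ, ℓ ∘ σ)` represent the same arrow with labelled inputs. -/
instance setoid (Q : SymMulticat.{u, v, w}) {K : Type} (x : K → Q.Obj) (y : Q.Obj) :
    Setoid (Q.LArr x y) where
  r F F' := ∃ σ : Fin F'.ar ≃ Fin F.ar, F'.arr = Q.act F.arr σ ∧ ∀ i, F'.lbl i = F.lbl (σ i)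
  iseqv :=
    { refl := fun F => ⟨Equiv.refl _, (Q.act_refl _).symm, fun _ => rfl⟩
      symm := by
        rintro F F' ⟨σ, h, h'⟩
        refine ⟨σ.symm, ?_, fun i => by simp [h']⟩
        rw [h, Q.act_act, Equiv.symm_trans_self, Q.act_refl]
      trans := by
        rintro F F' F'' ⟨σ, h, h'⟩ ⟨τ, k, k'⟩
        exact ⟨τ.trans σ, by rw [k, h, Q.act_act], fun i => by simp [k', h']⟩ }

/-- Substitution: compose an arrow with the arrows given by the labels of its inputs. -/
def bind (F : Q.LArr x y) (G : ∀ k, Q.LArr x' (x k)) : Q.LArr x' y where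
  ar := ∑ i, (G (F.lbl i)).ar
  arr := Q.comp F.arr (fun i => (G (F.lbl i)).arr)
    fun i => (G (F.lbl i)).tgt_eq.trans (F.src_eq i).symm
  lbl q := (G (F.lbl (finSigmaFinEquiv.symm q).1)).lbl (finSigmaFinEquiv.symm q).2
  src_eq q := by
    obtain ⟨⟨i, j⟩, rfl⟩ := finSigmaFinEquiv.surjective q
    rw [Q.src_comp, (G (F.lbl i)).src_eq, Equiv.symm_apply_apply]
  tgt_eq := (Q.tgt_comp _ _ _).trans F.tgt_eq

/-- The arrow given by an object-morphism, with its input labelled `k`. -/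
def ofHom (k : K) (a : x k ⟶ y) : Q.LArr x y where
  ar := 1
  arr := Q.ι a
  lbl _ := k
  src_eq := Q.src_ι a
  tgt_eq := Q.tgt_ι a

theorem bind_rel_left {F F' : Q.LArr x y} (G : ∀ k, Q.LArr x' (x k)) (h : F ≈ F') :
    F.bind G ≈ F'.bind G := by
  obtain ⟨n', f', l', s', t'⟩ := F'
  obtain ⟨σ, h₁, h₂⟩ := h
  dsimp only at σ h₁ h₂
  obtain rfl : l' = fun i => F.lbl (σ i) := funext h₂
  subst h₁
  refine ⟨blockPerm (fun i => (G (F.lbl i)).ar) σ,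
    Q.act_comp F.arr (fun i => (G (F.lbl i)).arr) _ σ _, fun q =>
      congrArg (fun s : Σ i, Fin (G (F.lbl i)).ar => (G (F.lbl s.1)).lbl s.2)
        (split_blockPerm (fun i => (G (F.lbl i)).ar) σ q).symm⟩

theorem bind_rel_right (F : Q.LArr x y) {G G' : ∀ k, Q.LArr x' (x k)} (h : ∀ k, G k ≈ G' k) :
    F.bind G ≈ F.bind G' := by
  choose τ h₁ h₂ using h
  refine ⟨juxtPerm fun i => τ (F.lbl i), ?_, fun q => ?_⟩
  · refine Eq.trans ?_ (Q.comp_act F.arr (fun i => (G (F.lbl i)).arr) _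
      (fun i => τ (F.lbl i)) fun i => ?_)
    · simp only [bind, h₁]
    · rw [← h₁]; exact (G' (F.lbl i)).tgt_eq.trans (F.src_eq i).symm
  · exact (h₂ _ _).trans
      (congrArg (fun s : Σ i, Fin (G (F.lbl i)).ar => (G (F.lbl s.1)).lbl s.2)
        (split_juxtPerm (fun i => τ (F.lbl i)) q).symm)

theorem bind_rel {F F' : Q.LArr x y} {G G' : ∀ k, Q.LArr x' (x k)} (h : F ≈ F')
    (h' : ∀ k, G k ≈ G' k) : F.bind G ≈ F'.bind G' :=
  Setoid.trans (bind_rel_left G h) (bind_rel_right F' h')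

theorem bind_bind_rel (F : Q.LArr x y) (G : ∀ k, Q.LArr x' (x k))
    (H : ∀ k, Q.LArr x'' (x' k)) : (F.bind G).bind H ≈ F.bind fun k => (G k).bind H :=
  ⟨assocPerm fun i j => (H ((G (F.lbl i)).lbl j)).ar,
    Q.assoc F.arr (fun i => (G (F.lbl i)).arr) (fun i j => (H ((G (F.lbl i)).lbl j)).arr) _ _ _ _,
    fun q => (congrArg (fun s : Σ i, Σ j, Fin (H ((G (F.lbl i)).lbl j)).ar =>
      (H ((G (F.lbl s.1)).lbl s.2.1)).lbl s.2.2) (assocPerm_triple _ q)).symm⟩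

theorem ofHom_id_bind (k : K) (G : ∀ k, Q.LArr x' (x k)) :
    (ofHom k (𝟙 (x k))).bind G ≈ G k := by
  have key : ∀ {n : ℕ} (f : Q.Arr n) (y : Q.Obj) (_ : Q.tgt f = y) (h),
      Q.act (Q.comp (Q.ι (𝟙 y)) (fun _ => f) h) (idCompPerm n) = f := by
    rintro n f y rfl h
    exact Q.id_comp f h
  refine ⟨idCompPerm _, (key (G k).arr (x k) (G k).tgt_eq _).symm, fun i =>
    congrArg (fun s : Σ _ : Fin 1, Fin (G k).ar => (G k).lbl s.2)
      (split_idCompPerm _ i).symm⟩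

theorem bind_ofHom_id (F : Q.LArr x y) : (F.bind fun k => ofHom k (𝟙 (x k))) ≈ F := by
  have key : ∀ {n : ℕ} (f : Q.Arr n) (y : Fin n → Q.Obj) (_ : ∀ i, Q.src f i = y i) (h),
      Q.act (Q.comp f (fun i => Q.ι (𝟙 (y i))) h) (compIdPerm n) = f := by
    intro n f y hy h
    obtain rfl : Q.src f = y := funext hy
    exact Q.comp_id f h
  refine ⟨compIdPerm _, (key F.arr (fun i => x (F.lbl i)) F.src_eq _).symm, fun i =>
    congrArg (fun s : Σ _ : Fin F.ar, Fin 1 => F.lbl s.1) (split_compIdPerm _ i).symm⟩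

theorem ofHom_bind_ofHom {z : Q.Obj} (k : K) (a : x k ⟶ y) (b : y ⟶ z) :
    (ofHom (x := fun _ : Unit => y) () b).bind (fun _ => ofHom k a) ≈ ofHom k (a ≫ b) :=
  ⟨idCompPerm 1, Q.ι_comp a b _, fun _ => rfl⟩

/-- The multiset of the labels. -/
def supp (F : Q.LArr x y) : Multiset K := (Finset.univ.val : Multiset (Fin F.ar)).map F.lbl

theorem supp_rel {F F' : Q.LArr x y} (h : F ≈ F') : F.supp = F'.supp := by
  obtain ⟨σ, -, h⟩ := h
  rw [supp, supp, ← TermCalc.univ_map_equiv σ, Multiset.map_map]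
  exact Multiset.map_congr rfl fun i _ => (h i).symm

theorem supp_bind (F : Q.LArr x y) (G : ∀ k, Q.LArr x' (x k)) :
    (F.bind G).supp = F.supp.bind fun k => (G k).supp := by
  have h := TermCalc.univ_sigma_bind (m := fun i => (G (F.lbl i)).ar)
  rw [supp, supp, Multiset.bind_map]
  change Multiset.map (fun q : Fin (∑ i, (G (F.lbl i)).ar) =>
    (G (F.lbl (finSigmaFinEquiv.symm q).1)).lbl (finSigmaFinEquiv.symm q).2)
    (Finset.univ.val : Multiset (Fin (∑ i, (G (F.lbl i)).ar))) = _
  rw [← h, Multiset.map_bind]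
  refine congrArg _ (funext fun i => ?_)
  rw [Multiset.map_map, supp]
  refine Multiset.map_congr rfl fun j _ => ?_
  dsimp only [Function.comp]
  rw [Equiv.symm_apply_apply]

theorem supp_ofHom (k : K) (a : x k ⟶ y) : (ofHom k a).supp = {k} := rfl

end LArr

/-- The term calculus of arrows of `Q` with labelled inputs. -/
noncomputable def terms (Q : SymMulticat.{u, v, w}) : TermCalc.{u, v, w} Q.Obj where
  Tm x y := Quotient (LArr.setoid Q x y)
  var k := ⟦LArr.ofHom k (𝟙 _)⟧
  bind t s := Quotient.lift (fun F : Q.LArr _ _ => ⟦F.bind fun k => (s k).out⟧)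
    (fun _ _ h => Quotient.sound (LArr.bind_rel_left _ h)) t
  post t a := Quotient.lift
    (fun F : Q.LArr _ _ => ⟦(LArr.ofHom (x := fun _ : Unit => _) () a).bind fun _ => F⟧)
    (fun _ _ h => Quotient.sound (LArr.bind_rel_right _ fun _ => h)) t
  supp t := Quotient.lift LArr.supp (fun _ _ h => LArr.supp_rel h) t
  var_bind k s := (Quotient.sound (LArr.ofHom_id_bind k _)).trans (Quotient.out_eq _)
  bind_var t := by
    induction t using Quotient.inductionOn with | _ F
    exact Quotient.sound (Setoid.trans
      (LArr.bind_rel_right F fun k => Quotient.mk_out _) (LArr.bind_ofHom_id F))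
  bind_bind t s r := by
    induction t using Quotient.inductionOn with | _ F
    refine Quotient.sound (Setoid.trans (LArr.bind_bind_rel F _ _)
      (LArr.bind_rel_right F fun k => ?_))
    refine Quotient.exact (Eq.trans ?_ (Quotient.out_eq _).symm)
    beta_reduce
    conv_rhs => rw [← Quotient.out_eq (s k)]
    rfl
  post_id t := by
    induction t using Quotient.inductionOn with | _ F
    exact Quotient.sound (LArr.ofHom_id_bind (x := fun _ : Unit => _) () fun _ => F)
  post_post t a b := by
    induction t using Quotient.inductionOn with | _ F
    exact Quotient.sound (Setoid.trans (Setoid.symm (LArr.bind_bind_rel _ _ _))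
      (LArr.bind_rel_left _ (LArr.ofHom_bind_ofHom (x := fun _ : Unit => _) () a b)))
  post_bind t a s := by
    induction t using Quotient.inductionOn with | _ F
    exact Quotient.sound (LArr.bind_bind_rel _ _ _)
  supp_var k := rfl
  supp_bind t s := by
    induction t using Quotient.inductionOn with | _ F
    refine (LArr.supp_bind F _).trans (congrArg _ (funext fun k => ?_))
    conv_rhs => rw [← Quotient.out_eq (s k)]
    rfl
  supp_post t a := by
    induction t using Quotient.inductionOn with | _ F
    refine (LArr.supp_bind _ _).trans ?_
    rw [LArr.supp_ofHom, Multiset.singleton_bind]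
    rfl

/-- The arrows of `Q`, as the objects of the category of elements of `Q`. -/
structure EltObj (Q : SymMulticat.{u, v, w}) where
  ar : ℕ
  arr : Q.Arr ar

/-- An arrow `f ∈ Q(x₁,…,x_k;y)` as a term, its `i`-th input being labelled `i`. -/
noncomputable def EltObj.toElt {Q : SymMulticat.{u, v, w}} (f : Q.EltObj) : Q.terms.Elt where
  shape := ⟨f.ar, Q.src f.arr, Q.tgt f.arr⟩
  tm := Quotient.mk (LArr.setoid Q _ _) ⟨f.ar, f.arr, fun i => i, fun _ => rfl, rfl⟩
  lin := by
    change Multiset.map (fun i => i) (Finset.univ.val : Multiset (Fin f.ar)) = _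
    exact Multiset.map_id' _

/-- The category of elements of `Q`. -/
noncomputable instance EltObj.category (Q : SymMulticat.{u, v, w}) : Category.{v} Q.EltObj where
  Hom f g := f.toElt ⟶ g.toElt
  id f := 𝟙 f.toElt
  comp {f g h} a b := CategoryStruct.comp (X := f.toElt) (Y := g.toElt) (Z := h.toElt) a b
  id_comp {f g} a := Category.id_comp (X := f.toElt) (Y := g.toElt) a
  comp_id {f g} a := Category.comp_id (X := f.toElt) (Y := g.toElt) a
  assoc {f g h k} a b c :=
    Category.assoc (W := f.toElt) (X := g.toElt) (Y := h.toElt) (Z := k.toElt) a b c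

/-- The functor regarding the arrows of `Q` as terms. -/
noncomputable def EltObj.functor (Q : SymMulticat.{u, v, w}) : Q.EltObj ⥤ Q.terms.Elt where
  obj := EltObj.toElt
  map a := a
  map_id _ := rfl
  map_comp _ _ := rfl

/-- The Baez–Dolan slice `Q⁺`. Its objects are the arrows of `Q`, with the morphisms of the
category of elements. An arrow `(f₁,…,f_n) → f` is a planar tree whose edges are labelled by
object-morphisms, whose nodes are labelled by `1,…,n`, each of them used exactly once, the node
with label `i` standing for `f_i` (this is the bijection `τ`), and whose leaves are labelled by
`1,…,k` (this is `ρ`), such that the composite of the tree in `Q`, with its inputs permuted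
according to the labels of the leaves, is `f`. -/
noncomputable def plus (Q : SymMulticat.{u, v, w}) : SymMulticat.{w, v, max w u v} :=
  (TermCalc.slice (EltObj.functor Q)).toSymMulticat

end SymMulticat

/-! ## The functor `ξ` -/

namespace GenMulticat

/-- An arrow of `M` with target `y` whose inputs are labelled by elements of `K`, an input
labelled `k` having the source `x k`. -/
structure LArr (M : GenMulticat.{u, w}) {K : Type} (x : K → M.Obj) (y : M.Obj) where
  arr : M.Arr
  lbl : Fin (M.ar arr) → K
  src_eq : ∀ i, M.src arr i = x (lbl i)
  tgt_eq : M.tgt arr = y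

namespace LArr

variable {M : GenMulticat.{u, w}} {K K' K'' : Type} {x : K → M.Obj} {z : K' → M.Obj}
  {z' : K'' → M.Obj} {y y' y'' : M.Obj}

theorem ext' {F F' : M.LArr x y} (h : F.arr = F'.arr)
    (h' : ∀ i : Fin (M.ar F.arr), ∃ j : Fin (M.ar F'.arr), (i : ℕ) = (j : ℕ) ∧ F.lbl i = F'.lbl j) : F = F' := by
  obtain ⟨f, l, s, t⟩ := F
  obtain ⟨f', l', s', t'⟩ := F'
  dsimp only at h h'
  subst h
  obtain rfl : l = l' := by
    funext i
    obtain ⟨j, hj, hl⟩ := h' i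
    rw [hl, Fin.ext hj]
  rfl

theorem amalg_cases (f : M.Arr) (p : Fin (M.ar f)) (g : M.Arr) (h : M.tgt g = M.src f p)
    {P : Fin (M.ar (M.comp f p g h)) → Prop}
    (hl : ∀ q, P (M.amalg f p g h (Sum.inl q))) (hr : ∀ r, P (M.amalg f p g h (Sum.inr r))) :
    ∀ i, P i := by
  intro i
  obtain ⟨q | r, rfl⟩ := (M.amalg f p g h).surjective i
  exacts [hl q, hr r]

/-- Substitute `g` for the `p`-th input of `F`; the other inputs keep their labels. -/
def subAt (F : M.LArr x y) (p : Fin (M.ar F.arr)) (g : M.LArr x y') (h : y' = x (F.lbl p)) :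
    M.LArr x y where
  arr := M.comp F.arr p g.arr (g.tgt_eq.trans (h.trans (F.src_eq p).symm))
  lbl i := Sum.elim (fun q => F.lbl q.1) g.lbl ((M.amalg F.arr p g.arr _).symm i)
  src_eq := by
    refine amalg_cases _ _ _ _ (fun q => ?_) fun r => ?_
    · rw [M.src_inl, Equiv.symm_apply_apply]; exact F.src_eq q
    · rw [M.src_inr, Equiv.symm_apply_apply]; exact g.src_eq r
  tgt_eq := (M.tgt_comp _ _ _ _).trans F.tgt_eq

/-- The position in `F.subAt p g` of the `q`-th input of `F`. -/
def posL (F : M.LArr x y) (p : Fin (M.ar F.arr)) (g : M.LArr x y') (h : y' = x (F.lbl p))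
    (q : {q : Fin (M.ar F.arr) // q ≠ p}) : Fin (M.ar (F.subAt p g h).arr) :=
  M.amalg F.arr p g.arr _ (Sum.inl q)

/-- The position in `F.subAt p g` of the `r`-th input of `g`. -/
def posR (F : M.LArr x y) (p : Fin (M.ar F.arr)) (g : M.LArr x y') (h : y' = x (F.lbl p))
    (r : Fin (M.ar g.arr)) : Fin (M.ar (F.subAt p g h).arr) :=
  M.amalg F.arr p g.arr _ (Sum.inr r)

section

variable (F : M.LArr x y) (p : Fin (M.ar F.arr)) (g : M.LArr x y') (h : y' = x (F.lbl p))

theorem pos_cases {P : Fin (M.ar (F.subAt p g h).arr) → Prop}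
    (hl : ∀ q, P (F.posL p g h q)) (hr : ∀ r, P (F.posR p g h r)) : ∀ i, P i :=
  amalg_cases _ _ _ _ hl hr

@[simp] theorem lbl_posL (q) : (F.subAt p g h).lbl (F.posL p g h q) = F.lbl q.1 := by
  simp [subAt, posL]

@[simp] theorem lbl_posR (r) : (F.subAt p g h).lbl (F.posR p g h r) = g.lbl r := by
  simp [subAt, posR]

theorem posL_injective : Function.Injective (F.posL p g h) := fun _ _ e =>
  Sum.inl_injective ((M.amalg _ _ _ _).injective e)

theorem posL_ne_posR (q r) : F.posL p g h q ≠ F.posR p g h r := fun e => by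
  cases (M.amalg _ _ _ _).injective e

theorem posR_injective : Function.Injective (F.posR p g h) := fun _ _ e =>
  Sum.inr_injective ((M.amalg _ _ _ _).injective e)

end

theorem subAt_assoc (F : M.LArr x y) (p : Fin (M.ar F.arr)) (g : M.LArr x y')
    (q : Fin (M.ar g.arr)) (k : M.LArr x y'') (e₁ : y' = x (F.lbl p)) (e₂ : y'' = x (g.lbl q))
    (e₃ : y'' = x ((F.subAt p g e₁).lbl (F.posR p g e₁ q))) :
    (F.subAt p g e₁).subAt (F.posR p g e₁ q) k e₃ = F.subAt p (g.subAt q k e₂) e₁ := by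
  refine ext' (M.assoc _ _ _ _ _ _ _ _ _) ?_
  refine pos_cases _ _ _ _ ?_ fun r => ?_
  · rintro ⟨i, hi⟩
    revert i
    refine pos_cases _ _ _ _ (fun r hi => ?_) fun r hi => ?_
    · refine ⟨F.posL p _ e₁ r, M.assoc_left _ _ _ _ _ _ _ _ _ r hi, ?_⟩
      rw [lbl_posL, lbl_posL, lbl_posL]
    · refine ⟨F.posR p _ e₁ (g.posL q k e₂ ⟨r, fun hr => hi (by rw [hr])⟩),
        M.assoc_mid _ _ _ _ _ _ _ _ _ ⟨r, fun hr => hi (by rw [hr])⟩ hi, ?_⟩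
      rw [lbl_posL, lbl_posR, lbl_posR, lbl_posL]
  · refine ⟨F.posR p _ e₁ (g.posR q k e₂ r), M.assoc_right _ _ _ _ _ _ _ _ _ r, ?_⟩
    rw [lbl_posR, lbl_posR, lbl_posR]

theorem subAt_comm (F : M.LArr x y) (p q : Fin (M.ar F.arr)) (hpq : p ≠ q) (g : M.LArr x y')
    (k : M.LArr x y'') (e₁ : y' = x (F.lbl p)) (e₂ : y'' = x (F.lbl q))
    (e₃ : y'' = x ((F.subAt p g e₁).lbl (F.posL p g e₁ ⟨q, hpq.symm⟩)))
    (e₄ : y' = x ((F.subAt q k e₂).lbl (F.posL q k e₂ ⟨p, hpq⟩))) :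
    (F.subAt p g e₁).subAt (F.posL p g e₁ ⟨q, hpq.symm⟩) k e₃ =
      (F.subAt q k e₂).subAt (F.posL q k e₂ ⟨p, hpq⟩) g e₄ := by
  refine ext' (M.comm _ _ _ hpq _ _ _ _ _ _) ?_
  refine pos_cases _ _ _ _ ?_ fun r => ?_
  · rintro ⟨i, hi⟩
    revert i
    refine pos_cases _ _ _ _ (fun r hi => ?_) fun r hi => ?_
    · have hq : r.1 ≠ q := fun hr => hi (congrArg _ (Subtype.ext hr))
      have n₂ : F.posL q k e₂ ⟨r.1, hq⟩ ≠ F.posL q k e₂ ⟨p, hpq⟩ := fun e =>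
        r.2 (congrArg Subtype.val (posL_injective _ _ _ _ e))
      refine ⟨posL _ _ g e₄ ⟨F.posL q k e₂ ⟨r.1, hq⟩, n₂⟩,
        M.comm_left _ _ _ hpq _ _ _ _ _ _ r.1 r.2 hq hi n₂, ?_⟩
      rw [lbl_posL, lbl_posL, lbl_posL, lbl_posL]
    · refine ⟨posR _ _ g e₄ r, M.comm_right _ _ _ hpq _ _ _ _ _ _ r hi, ?_⟩
      rw [lbl_posL, lbl_posR, lbl_posR]
  · have n := posL_ne_posR F q k e₂ ⟨p, hpq⟩ r
    refine ⟨posL _ _ g e₄ ⟨F.posR q k e₂ r, n.symm⟩,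
      (M.comm_right _ _ _ hpq.symm _ _ _ _ _ _ r n.symm).symm, ?_⟩
    rw [lbl_posR, lbl_posL, lbl_posR]

/-- Relabelling of the inputs. -/
def map (F : M.LArr x y) (e : K → K') (h : ∀ k, z (e k) = x k) : M.LArr z y where
  arr := F.arr
  lbl i := e (F.lbl i)
  src_eq i := (F.src_eq i).trans (h _).symm
  tgt_eq := F.tgt_eq

theorem subAt_map (F : M.LArr x y) (p : Fin (M.ar F.arr)) (g : M.LArr x y')
    (h : y' = x (F.lbl p)) (e : K → K') (he : ∀ k, z (e k) = x k) :
    (F.subAt p g h).map e he = (F.map e he).subAt p (g.map e he) (h.trans (he _).symm) := by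
  refine ext' rfl (pos_cases F p g h (fun r => ?_) fun r => ?_)
  · exact ⟨(F.map e he).posL p (g.map e he) _ r, rfl, by
      exact (congrArg e (lbl_posL _ _ _ _ _)).trans (lbl_posL (F.map e he) p (g.map e he) _ r).symm⟩
  · exact ⟨(F.map e he).posR p (g.map e he) _ r, rfl, by
      exact (congrArg e (lbl_posR _ _ _ _ _)).trans (lbl_posR (F.map e he) p (g.map e he) _ r).symm⟩

/-- The identity arrow of `x k` with its input labelled `k`. -/
def var (x : K → M.Obj) (k : K) : M.LArr x (x k) where
  arr := M.id (x k)
  lbl _ := k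
  src_eq := M.src_id _
  tgt_eq := M.tgt_id _

/-- Regard an arrow with another description of its target. -/
def castTgt (F : M.LArr x y) (h : y = y') : M.LArr x y' := { F with tgt_eq := F.tgt_eq.trans h }

theorem var_subAt (k : K) (p : Fin (M.ar (var x k).arr)) (g : M.LArr x y') (h : y' = x k) :
    (var x k).subAt p g h = g.castTgt h := by
  obtain ⟨f, l, s, t⟩ := g
  have key : ∀ (y : M.Obj) (p : Fin (M.ar (M.id y))) (_ : M.tgt f = y)
      (e : M.tgt f = M.src (M.id y) p), M.comp (M.id y) p f e = f ∧
      ∀ r, (M.amalg (M.id y) p f e (Sum.inr r) : ℕ) = r := by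
    rintro y p rfl e
    exact ⟨M.id_comp _ _ _, M.id_comp_inr _ _ _⟩
  obtain ⟨h₁, h₂⟩ := key (x k) p (t.trans h) (t.trans (h.trans (M.src_id _ _).symm))
  refine ext' h₁ (pos_cases _ _ _ _ (fun q => ?_) fun r => ?_)
  · have := M.ar_id (x k)
    exact (q.2 (Fin.ext (by have := q.1.2; have := p.2; simp only [var] at *; omega))).elim
  · exact ⟨r, h₂ r, lbl_posR (var x k) p _ h r⟩

/-- Substituting an identity for an input only changes its label. -/
theorem subAt_var (F : M.LArr x y) (p : Fin (M.ar F.arr)) (k : K) (h : x k = x (F.lbl p)) :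
    F.subAt p (var x k) h =
      { F with
        lbl := fun i => if i = p then k else F.lbl i
        src_eq := fun i => by
          split_ifs with hi
          · rw [hi, h, F.src_eq]
          · exact F.src_eq i } := by
  have key : ∀ (y : M.Obj) (_ : M.src F.arr p = y) (e : M.tgt (M.id y) = M.src F.arr p),
      M.comp F.arr p (M.id y) e = F.arr ∧
      (∀ q, (M.amalg F.arr p (M.id y) e (Sum.inl q) : ℕ) = (q.1 : Fin (M.ar F.arr))) ∧
      ∀ r, (M.amalg F.arr p (M.id y) e (Sum.inr r) : ℕ) = p := by
    rintro y rfl e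
    exact ⟨M.comp_id _ _ _, M.comp_id_inl _ _ _, M.comp_id_inr _ _ _⟩
  obtain ⟨h₁, h₂, h₃⟩ := key (x k) ((F.src_eq p).trans h.symm)
    ((M.tgt_id _).trans (h.trans (F.src_eq p).symm))
  refine ext' h₁ (pos_cases _ _ _ _ (fun q => ?_) fun r => ?_)
  · exact ⟨q.1, h₂ q, (lbl_posL _ _ _ _ _).trans (if_neg q.2).symm⟩
  · exact ⟨p, h₃ r, (lbl_posR _ _ _ _ _).trans (if_pos rfl).symm⟩

/-- The multiset of the labels. -/
def supp (F : M.LArr x y) : Multiset K := (Finset.univ.val : Multiset (Fin (M.ar F.arr))).map F.lbl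

theorem supp_subAt (F : M.LArr x y) (p : Fin (M.ar F.arr)) (g : M.LArr x y')
    (h : y' = x (F.lbl p)) : (F.subAt p g h).supp + {F.lbl p} = F.supp + g.supp := by
  have h₁ : (F.subAt p g h).supp =
      (Finset.univ.val : Multiset {q : Fin (M.ar F.arr) // q ≠ p}).map (fun q => F.lbl q.1) +
        g.supp := by
    have e := TermCalc.univ_map_equiv (M.amalg F.arr p g.arr
      (g.tgt_eq.trans (h.trans (F.src_eq p).symm)))
    refine (congrArg (Multiset.map (F.subAt p g h).lbl) e.symm).trans ?_
    refine (Multiset.map_map (F.subAt p g h).lbl (M.amalg F.arr p g.arr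
      (g.tgt_eq.trans (h.trans (F.src_eq p).symm))) _).trans ?_
    change Multiset.map _ (Multiset.disjSum Finset.univ.val Finset.univ.val) = _
    rw [Multiset.disjSum, Multiset.map_add, Multiset.map_map, Multiset.map_map]
    refine congrArg₂ (· + ·) (Multiset.map_congr rfl fun q _ => ?_)
      (Multiset.map_congr rfl fun r _ => ?_)
    · exact lbl_posL F p g h q
    · exact lbl_posR F p g h r
  have h₂ : F.supp = F.lbl p ::ₘ
      (Finset.univ.val : Multiset {q : Fin (M.ar F.arr) // q ≠ p}).map (fun q => F.lbl q.1) := by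
    have e := TermCalc.univ_map_equiv (Equiv.optionSubtypeNe p)
    have e' : (Finset.univ : Finset (Option {q : Fin (M.ar F.arr) // q ≠ p})).val =
        none ::ₘ Finset.univ.val.map some := by
      rw [univ_option]; rfl
    rw [supp, ← e, Multiset.map_map, e']
    rw [Multiset.map_cons, Multiset.map_map]
    simp [Function.comp_def]
  rw [h₁, h₂, ← Multiset.singleton_add]
  abel


section Sub

variable {L : Type} {u' : L → M.Obj}

/-- `F'` arises from `F` by substituting `G k` for an input labelled `Sum.inl k`. -/
def Step (G : ∀ k, M.LArr z (x k)) (F F' : M.LArr (Sum.elim x z) y) : Prop :=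
  ∃ (p : Fin (M.ar F.arr)) (k : K) (h : F.lbl p = Sum.inl k),
    F' = F.subAt p ((G k).map (z := Sum.elim x z) Sum.inr (Sum.elim_inr x z))
      (by rw [h]; rfl)

variable (G : ∀ k, M.LArr z (x k))

/-- The number of inputs labelled `Sum.inl k` for some `k`. -/
def pend (F : M.LArr (Sum.elim x z) y) : ℕ := F.supp.countP fun k => k.isLeft

variable {G}

theorem Step.pend_lt {F F' : M.LArr (Sum.elim x z) y} (h : Step G F F') : F'.pend < F.pend := by
  obtain ⟨p, k, hk, rfl⟩ := h
  have := congrArg (Multiset.countP fun k : K ⊕ K' => k.isLeft)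
    (supp_subAt F p ((G k).map (z := Sum.elim x z) Sum.inr (Sum.elim_inr x z)) (by rw [hk]; rfl))
  rw [Multiset.countP_add, Multiset.countP_add] at this
  have h₁ : Multiset.countP (fun k : K ⊕ K' => k.isLeft) {F.lbl p} = 1 := by
    rw [hk]; rfl
  have h₂ : Multiset.countP (fun k : K ⊕ K' => k.isLeft)
      ((G k).map (z := Sum.elim x z) Sum.inr (Sum.elim_inr x z)).supp = 0 := by
    rw [Multiset.countP_eq_zero]
    intro a ha
    obtain ⟨i, -, rfl⟩ := Multiset.mem_map.1 ha
    simp [map]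
  unfold pend
  omega

theorem exists_step_or (G : ∀ k, M.LArr z (x k)) (F : M.LArr (Sum.elim x z) y) :
    (∃ F', Step G F F') ∨ ∃ F' : M.LArr z y, F = F'.map Sum.inr (Sum.elim_inr x z) := by
  by_cases h : ∃ p k, F.lbl p = Sum.inl k
  · obtain ⟨p, k, h⟩ := h
    exact .inl ⟨_, p, k, h, rfl⟩
  · right
    have h' : ∀ p, ∃ k', F.lbl p = Sum.inr k' := fun p => by
      rcases hp : F.lbl p with k | k'
      · exact (h ⟨p, k, hp⟩).elim
      · exact ⟨k', rfl⟩
    choose l hl using h'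
    exact ⟨⟨F.arr, l, fun i => by rw [F.src_eq, hl]; rfl, F.tgt_eq⟩,
      ext' rfl fun i => ⟨i, rfl, hl i⟩⟩

theorem sub_induction (G : ∀ k, M.LArr z (x k)) {P : M.LArr (Sum.elim x z) y → Prop}
    (hn : ∀ F : M.LArr z y, P (F.map Sum.inr (Sum.elim_inr x z)))
    (hs : ∀ F F', Step G F F' → P F' → P F) (F) : P F := by
  rcases exists_step_or G F with ⟨F', h⟩ | ⟨F', rfl⟩
  · exact hs F F' h (sub_induction G hn hs F')
  · exact hn F'
termination_by F.pend
decreasing_by exact h.pend_lt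

theorem not_step_map_inr (F : M.LArr z y) (F') : ¬ Step G (F.map Sum.inr (Sum.elim_inr x z)) F' := by
  rintro ⟨p, k, h, -⟩
  cases h

theorem map_inr_injective {F F' : M.LArr z y}
    (h : F.map (z := Sum.elim x z) Sum.inr (fun _ => rfl) = F'.map Sum.inr (Sum.elim_inr x z)) :
    F = F' := by
  obtain ⟨f, l, s, t⟩ := F
  obtain ⟨f', l', s', t'⟩ := F'
  simp only [map, mk.injEq] at h
  obtain ⟨rfl, h⟩ := h
  obtain rfl : l = l' := funext fun i => Sum.inr_injective (congrFun (eq_of_heq h) i)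
  rfl

theorem step_diamond (F F₁ F₂ : M.LArr (Sum.elim x z) y) (h₁ : Step G F F₁) (h₂ : Step G F F₂) :
    ∃ F', Relation.ReflGen (Step G) F₁ F' ∧ Relation.ReflTransGen (Step G) F₂ F' := by
  obtain ⟨p, k, hk, rfl⟩ := h₁
  obtain ⟨q, l, hl, rfl⟩ := h₂
  by_cases hpq : p = q
  · subst hpq
    obtain rfl : k = l := Sum.inl_injective (hk.symm.trans hl)
    exact ⟨_, .refl, .refl⟩
  · refine ⟨_, .single ⟨posL _ _ _ _ ⟨q, Ne.symm hpq⟩, l, (lbl_posL _ _ _ _ _).trans hl, rfl⟩, ?_⟩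
    rw [subAt_comm F p q hpq _ _ _ (by rw [hl]; rfl)
      (e₄ := by rw [lbl_posL, hk]; rfl)]
    · exact .single ⟨posL _ _ _ _ ⟨p, hpq⟩, k, (lbl_posL _ _ _ _ _).trans hk, rfl⟩

theorem exists_sub (G : ∀ k, M.LArr z (x k)) (F : M.LArr (Sum.elim x z) y) :
    ∃ F' : M.LArr z y, Relation.ReflTransGen (Step G) F (F'.map Sum.inr (Sum.elim_inr x z)) := by
  induction F using sub_induction G with
  | hn F => exact ⟨F, .refl⟩
  | hs F F' h ih =>
    obtain ⟨F'', h'⟩ := ih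
    exact ⟨F'', .head h h'⟩

/-- Substitute `G k` for each input labelled `Sum.inl k`, one after the other. -/
noncomputable def sub (F : M.LArr (Sum.elim x z) y) (G : ∀ k, M.LArr z (x k)) : M.LArr z y :=
  (exists_sub G F).choose

theorem sub_eq_of_red {F : M.LArr (Sum.elim x z) y} {F' : M.LArr z y}
    (h : Relation.ReflTransGen (Step G) F (F'.map Sum.inr (Sum.elim_inr x z))) : F.sub G = F' := by
  obtain ⟨F'', h₁, h₂⟩ := Relation.church_rosser step_diamond (exists_sub G F).choose_spec h
  rcases h₁.cases_head with h₁ | ⟨_, h₁, -⟩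
  · rcases h₂.cases_head with h₂ | ⟨_, h₂, -⟩
    · exact map_inr_injective (h₁.trans h₂.symm)
    · exact (not_step_map_inr _ _ h₂).elim
  · exact (not_step_map_inr _ _ h₁).elim

theorem red_sub (F : M.LArr (Sum.elim x z) y) (G : ∀ k, M.LArr z (x k)) :
    Relation.ReflTransGen (Step G) F ((F.sub G).map Sum.inr (Sum.elim_inr x z)) :=
  (exists_sub G F).choose_spec

theorem sub_eq_of_step {F F' : M.LArr (Sum.elim x z) y} (h : Step G F F') :
    F.sub G = F'.sub G := sub_eq_of_red (.head h (red_sub F' G))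

theorem sub_eq_of_red' {F F' : M.LArr (Sum.elim x z) y} (h : Relation.ReflTransGen (Step G) F F') :
    F.sub G = F'.sub G := sub_eq_of_red (.trans h (red_sub F' G))

theorem sub_map_inr (F : M.LArr z y) (G : ∀ k, M.LArr z (x k)) :
    (F.map (z := Sum.elim x z) Sum.inr (Sum.elim_inr x z)).sub G = F := sub_eq_of_red .refl

/-- Substitution: compose an arrow with the arrows given by the labels of its inputs. -/
noncomputable def bind (F : M.LArr x y) (G : ∀ k, M.LArr z (x k)) : M.LArr z y :=
  (F.map (z := Sum.elim x z) Sum.inl (Sum.elim_inl x z)).sub G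

theorem Step.subAt {F : M.LArr (Sum.elim x z) y} {p : Fin (M.ar F.arr)}
    {g g' : M.LArr (Sum.elim x z) y'} (h : Step G g g') (e : y' = Sum.elim x z (F.lbl p)) :
    Step G (F.subAt p g e) (F.subAt p g' e) := by
  obtain ⟨q, k, hk, rfl⟩ := h
  refine ⟨F.posR p g e q, k, (lbl_posR _ _ _ _ _).trans hk, ?_⟩
  rw [subAt_assoc]

theorem bind_subAt (F : M.LArr x y) (p : Fin (M.ar F.arr)) (g : M.LArr x y')
    (h : y' = x (F.lbl p)) (G : ∀ k, M.LArr z (x k))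
    (hg : (g.bind G).castTgt h = G (F.lbl p)) : (F.subAt p g h).bind G = F.bind G := by
  subst h
  have h₁ : Relation.ReflTransGen (Step G)
      ((F.subAt p g rfl).map (z := Sum.elim x z) Sum.inl (Sum.elim_inl x z))
      ((F.map (z := Sum.elim x z) Sum.inl (Sum.elim_inl x z)).subAt p
        ((g.bind G).map (z := Sum.elim x z) Sum.inr (Sum.elim_inr x z)) rfl) := by
    rw [subAt_map]
    exact (red_sub (g.map (z := Sum.elim x z) Sum.inl (Sum.elim_inl x z)) G).lift
      (fun g => (F.map (z := Sum.elim x z) Sum.inl (Sum.elim_inl x z)).subAt p g rfl)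
      fun a b hab => hab.subAt _
  refine (sub_eq_of_red' h₁).trans (Eq.symm ?_)
  change (F.map (z := Sum.elim x z) Sum.inl (Sum.elim_inl x z)).sub G = _
  refine (sub_eq_of_step ⟨p, F.lbl p, rfl, rfl⟩).trans ?_
  rw [← hg]
  rfl

theorem map_inr_bind (F : M.LArr z y) (G : ∀ k, M.LArr u' (Sum.elim x z k)) :
    (F.map (z := Sum.elim x z) Sum.inr (Sum.elim_inr x z)).bind G = F.bind fun k => G (Sum.inr k) := by
  have h := (red_sub (F.map (z := Sum.elim z u') Sum.inl (Sum.elim_inl z u'))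
    (fun k => G (Sum.inr k))).lift (p := Step G)
    (fun F => F.map (z := Sum.elim (Sum.elim x z) u') (Sum.map Sum.inr fun k => k)
      fun k => by cases k <;> rfl) fun a b ⟨p, k, hk, hb⟩ => ⟨p, Sum.inr k, by
        simp [map, hk], by rw [hb]; exact subAt_map _ _ _ _ _ _⟩
  exact sub_eq_of_red h

theorem bind_bind_aux (G : ∀ k, M.LArr z (x k)) (H : ∀ k, M.LArr u' (z k))
    (F : M.LArr (Sum.elim x z) y) :
    F.bind (fun k => Sum.rec (motive := fun k => M.LArr u' (Sum.elim x z k))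
      (fun k => (G k).bind H) H k) = (F.sub G).bind H := by
  induction F using sub_induction G with
  | hn F => rw [map_inr_bind, sub_map_inr]
  | hs F F' h ih =>
    rw [sub_eq_of_step h, ← ih]
    obtain ⟨p, k, hk, rfl⟩ := h
    refine (bind_subAt _ _ _ _ _ ?_).symm
    rw [map_inr_bind]
    have key : ∀ (a : K ⊕ K') (e : x k = Sum.elim x z a), a = Sum.inl k →
        ((G k).bind H).castTgt e = Sum.rec (motive := fun k => M.LArr u' (Sum.elim x z k))
          (fun k => (G k).bind H) H a := by
      rintro _ e rfl
      rfl
    exact key _ _ hk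

theorem map_inl_bind (F : M.LArr x y) (G : ∀ k, M.LArr u' (Sum.elim x z k)) :
    (F.map (z := Sum.elim x z) Sum.inl (Sum.elim_inl x z)).bind G = F.bind fun k => G (Sum.inl k) := by
  have h := (red_sub (F.map (z := Sum.elim x u') Sum.inl (Sum.elim_inl x u'))
    (fun k => G (Sum.inl k))).lift (p := Step G)
    (fun F => F.map (z := Sum.elim (Sum.elim x z) u') (Sum.map Sum.inl fun k => k)
      fun k => by cases k <;> rfl) fun a b ⟨p, k, hk, hb⟩ => ⟨p, Sum.inl k, by
        simp [map, hk], by rw [hb]; exact subAt_map _ _ _ _ _ _⟩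
  exact sub_eq_of_red h

theorem bind_bind (F : M.LArr x y) (G : ∀ k, M.LArr z (x k)) (H : ∀ k, M.LArr u' (z k)) :
    (F.bind G).bind H = F.bind fun k => (G k).bind H :=
  (bind_bind_aux G H _).symm.trans (map_inl_bind F _)

theorem var_bind (k : K) (G : ∀ k, M.LArr z (x k)) : (var x k).bind G = G k := by
  have p : Fin (M.ar (var (Sum.elim x z) (Sum.inl k)).arr) := ⟨0, by simp [var, M.ar_id]⟩
  refine sub_eq_of_red (.single ⟨p, k, rfl, ?_⟩)
  exact (var_subAt (x := Sum.elim x z) (Sum.inl k) p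
    ((G k).map (z := Sum.elim x z) Sum.inr (Sum.elim_inr x z)) rfl).symm

theorem bind_var (F : M.LArr x y) : F.bind (fun k => var x k) = F := by
  have key : ∀ F : M.LArr (Sum.elim x x) y,
      F.sub (fun k => var x k) = F.map (Sum.elim (fun k => k) fun k => k) fun k => by cases k <;> rfl := by
    intro F
    induction F using sub_induction fun k => var x k with
    | hn F => rw [sub_map_inr]; rfl
    | hs F F' h ih =>
      rw [sub_eq_of_step h, ih]
      obtain ⟨p, k, hk, rfl⟩ := h
      refine (congrArg (fun F : M.LArr (Sum.elim x x) y => F.map (z := x)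
        (Sum.elim (fun k => k) fun k => k) fun k => by cases k <;> rfl)
        (subAt_var F p (Sum.inr k) (by rw [hk]; rfl))).trans ?_
      refine ext' rfl fun i => ⟨i, rfl, ?_⟩
      simp only [map]
      split_ifs with hi
      · rw [hi, hk]; rfl
      · rfl
  rw [bind, key]
  rfl

theorem supp_var (k : K) : (var x k).supp = {k} := by
  have key : ∀ n, n = 1 → (Finset.univ.val : Multiset (Fin n)).map (fun _ => k) = {k} := by
    rintro _ rfl; rfl
  exact key _ (M.ar_id _)

theorem supp_map (F : M.LArr x y) (e : K → K') (h : ∀ k, z (e k) = x k) :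
    (F.map e h).supp = F.supp.map e := (Multiset.map_map e F.lbl _).symm

theorem supp_bind (F : M.LArr x y) (G : ∀ k, M.LArr z (x k)) :
    (F.bind G).supp = F.supp.bind fun k => (G k).supp := by
  have key : ∀ F : M.LArr (Sum.elim x z) y, (F.sub G).supp =
      F.supp.bind (Sum.elim (fun k => (G k).supp) fun k => {k}) := by
    intro F
    induction F using sub_induction G with
    | hn F =>
      rw [sub_map_inr, supp_map, Multiset.bind_map]
      simp only [Sum.elim_inr]
      exact ((Multiset.bind_singleton _ _).trans (Multiset.map_id' _)).symm
    | hs F F' h ih =>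
      rw [sub_eq_of_step h, ih]
      obtain ⟨p, k, hk, rfl⟩ := h
      have := congrArg (fun s => Multiset.bind s (Sum.elim (fun k => (G k).supp) fun k => {k}))
        (supp_subAt F p ((G k).map (z := Sum.elim x z) Sum.inr (Sum.elim_inr x z)) (by rw [hk]; rfl))
      rw [Multiset.add_bind, Multiset.add_bind, Multiset.singleton_bind] at this
      refine add_right_cancel (this.trans (congrArg _ ?_))
      rw [supp_map, Multiset.bind_map, show Sum.elim _ _ (F.lbl p) = (G k).supp by rw [hk]; rfl]
      simp only [Sum.elim_inr]
      exact (Multiset.bind_singleton _ _).trans (Multiset.map_id' _)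
  rw [bind, key, supp_map, Multiset.bind_map]
  rfl

end Sub

end LArr

/-- The term calculus of arrows of `M` with labelled inputs. -/
noncomputable def terms (M : GenMulticat.{u, w}) : TermCalc.{u, u, w} (Discrete M.Obj) where
  Tm {K} x y := M.LArr (fun k => (x k).as) y.as
  var k := LArr.var _ k
  bind t s := t.bind s
  post t a := t.castTgt (Discrete.eq_of_hom a)
  supp t := t.supp
  var_bind k s := LArr.var_bind k s
  bind_var t := LArr.bind_var t
  bind_bind t s r := LArr.bind_bind t s r
  post_id t := rfl
  post_post t a b := rfl
  post_bind t a s := by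
    rename_i y y'
    obtain ⟨y⟩ := y
    obtain ⟨y'⟩ := y'
    obtain rfl : y = y' := Discrete.eq_of_hom a
    rfl
  supp_var k := LArr.supp_var k
  supp_bind t s := LArr.supp_bind t s
  supp_post t a := rfl

/-- The symmetric multicategory `ξ(M)`. Its category of objects is discrete; an arrow of arity
`k` is an arrow of `M` whose inputs are labelled by `1, …, k`, each label being used exactly
once, that is, a pair of an arrow and a permutation. -/
noncomputable def ξ (M : GenMulticat.{u, w}) : SymMulticat.{u, u, max u w} :=
  M.terms.toSymMulticat

end GenMulticat

/-! ## The slice of a generalised multicategory -/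

theorem exists_ext_inr {A B X Y : Type} (e : A ⊕ B ≃ X) (q : B) (a : A → Y)
    (b : ∀ r, r ≠ q → Y) : ∃ j : {x // x ≠ e (Sum.inr q)} → Y,
      (∀ r n, j ⟨e (Sum.inl r), n⟩ = a r) ∧ ∀ r hr n, j ⟨e (Sum.inr r), n⟩ = b r hr := by
  let c : ∀ s : A ⊕ B, s ≠ Sum.inr q → Y := fun s =>
    Sum.rec (motive := fun s => s ≠ Sum.inr q → Y) (fun r _ => a r)
      (fun r hr => b r fun e => hr (congrArg _ e)) s
  refine ⟨fun x => c (e.symm x.1) fun h => x.2 (e.symm_apply_eq.1 h), fun r n => ?_,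
    fun r hr n => ?_⟩
  · have : ∀ s hs, s = Sum.inl r → c s hs = a r := by rintro _ _ rfl; rfl
    exact this _ _ (e.symm_apply_apply _)
  · have : ∀ s hs, s = Sum.inr r → c s hs = b r hr := by rintro _ _ rfl; rfl
    exact this _ _ (e.symm_apply_apply _)

theorem exists_ext_inl {A B X Y : Type} (e : A ⊕ B ≃ X) (q : A) (a : ∀ r, r ≠ q → Y)
    (b : B → Y) : ∃ j : {x // x ≠ e (Sum.inl q)} → Y,
      (∀ r hr n, j ⟨e (Sum.inl r), n⟩ = a r hr) ∧ ∀ r n, j ⟨e (Sum.inr r), n⟩ = b r := by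
  obtain ⟨j, h₁, h₂⟩ := exists_ext_inr ((Equiv.sumComm B A).trans e) q b a
  exact ⟨j, h₂, h₁⟩

namespace TermCalc

/-- A choice, for each term, of an order on its inputs. It is to depend on the term alone and not
on the labels of its inputs: `ord t` is the list of the labels in the chosen order, and it
is compatible with relabelling. -/
structure InputOrder {C : Type u} [Category.{v} C] (𝒮 : TermCalc.{u, v, w} C) where
  ord : ∀ {K : Type} {x : K → C} {y : C}, 𝒮.Tm x y → List K
  coe_ord : ∀ {K : Type} {x : K → C} {y : C} (t : 𝒮.Tm x y), (ord t : Multiset K) = 𝒮.supp t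
  ord_map : ∀ {K K' : Type} {x : K → C} {z : K' → C} {y : C} (t : 𝒮.Tm x y) (e : K → K')
    (h : ∀ k, z (e k) = x k), ord (𝒮.map t e h) = (ord t).map e

section Discrete

variable {A : Type u} {𝒮 : TermCalc.{u, u, w} (Discrete A)} {K K' K'' : Type} {x : K → A}
  {z : K' → A} {z' : K'' → A} {y y' y'' : A}

/-- The terms over a discrete category. -/
abbrev DTm (𝒮 : TermCalc.{u, u, w} (Discrete A)) (x : K → A) (y : A) : Type w :=
  𝒮.Tm (fun k => Discrete.mk (x k)) (Discrete.mk y)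

/-- Regard a term with another description of its target. -/
def cast (t : 𝒮.DTm x y) (h : y = y') : 𝒮.DTm x y' := 𝒮.post t (eqToHom (congrArg Discrete.mk h))

/-- Relabelling of the inputs. -/
def dmap (t : 𝒮.DTm x y) (e : K → K') (h : ∀ k, z (e k) = x k) : 𝒮.DTm z y :=
  𝒮.map t e fun k => congrArg Discrete.mk (h k)

/-- Substitution. -/
def dbind (t : 𝒮.DTm x y) (s : ∀ k, 𝒮.DTm z (x k)) : 𝒮.DTm z y := 𝒮.bind t s

/-- The identity. -/
def dvar (𝒮 : TermCalc.{u, u, w} (Discrete A)) (x : K → A) (k : K) : 𝒮.DTm x (x k) :=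
  𝒮.var (x := fun k => Discrete.mk (x k)) k

@[simp] theorem cast_rfl (t : 𝒮.DTm x y) (h : y = y) : cast t h = t := 𝒮.post_id t

@[simp] theorem cast_cast (t : 𝒮.DTm x y) (h : y = y') (h' : y' = y'') :
    cast (cast t h) h' = cast t (h.trans h') := by
  subst h h'; simp

theorem cast_dbind (t : 𝒮.DTm x y) (h : y = y') (s : ∀ k, 𝒮.DTm z (x k)) :
    dbind (cast t h) s = cast (dbind t s) h := by
  subst h; simp

theorem cast_dmap (t : 𝒮.DTm x y) (h : y = y') (e : K → K') (he : ∀ k, z (e k) = x k) :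
    dmap (cast t h) e he = cast (dmap t e he) h := by
  subst h; simp

theorem dmap_eq (t : 𝒮.DTm x y) (e : K → K') (h : ∀ k, z (e k) = x k) :
    dmap t e h = dbind t fun k => cast (dvar 𝒮 z (e k)) (h k) := rfl

theorem dvar_dbind (k : K) (s : ∀ k, 𝒮.DTm z (x k)) : dbind (dvar 𝒮 x k) s = s k :=
  𝒮.var_bind k s

theorem dbind_dvar (t : 𝒮.DTm x y) : dbind t (fun k => dvar 𝒮 x k) = t := 𝒮.bind_var t

theorem dbind_dbind (t : 𝒮.DTm x y) (s : ∀ k, 𝒮.DTm z (x k)) (r : ∀ k, 𝒮.DTm z' (z k)) :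
    dbind (dbind t s) r = dbind t fun k => dbind (s k) r := 𝒮.bind_bind t s r

theorem dbind_congr (t : 𝒮.DTm x y) {s s' : ∀ k, 𝒮.DTm z (x k)} (h : ∀ k, s k = s' k) :
    dbind t s = dbind t s' := congrArg _ (funext h)

theorem dmap_dbind (t : 𝒮.DTm x y) (e : K → K') (h : ∀ k, z (e k) = x k)
    (s : ∀ k, 𝒮.DTm z' (z k)) :
    dbind (dmap t e h) s = dbind t fun k => cast (s (e k)) (h k) := by
  simp only [dmap_eq, dbind_dbind, cast_dbind, dvar_dbind]

theorem dbind_dmap (t : 𝒮.DTm x y) (s : ∀ k, 𝒮.DTm z (x k)) (e : K' → K'')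
    (h : ∀ k, z' (e k) = z k) : dmap (dbind t s) e h = dbind t fun k => dmap (s k) e h := by
  simp only [dmap_eq, dbind_dbind]

theorem dmap_dmap (t : 𝒮.DTm x y) (e : K → K') (h : ∀ k, z (e k) = x k) (e' : K' → K'')
    (h' : ∀ k, z' (e' k) = z k) :
    dmap (dmap t e h) e' h' = dmap t (fun k => e' (e k)) fun k => (h' _).trans (h k) := by
  simp only [dmap_eq, dbind_dbind, cast_dbind, dvar_dbind, cast_cast]

theorem dmap_congr (t : 𝒮.DTm x y) {e e' : K → K'} (h : ∀ k, z (e k) = x k)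
    (h' : ∀ k, z (e' k) = x k) (he : ∀ k, e k = e' k) : dmap t e h = dmap t e' h' := by
  obtain rfl : e = e' := funext he
  rfl

theorem dmap_id (t : 𝒮.DTm x y) (e : K → K) (h : ∀ k, x (e k) = x k) (he : ∀ k, e k = k) :
    dmap t e h = t := map_id t e he _

theorem cast_dvar_congr {k k' : K} (h : x k = y) (h' : x k' = y) (e : k = k') :
    cast (dvar 𝒮 x k) h = cast (dvar 𝒮 x k') h' := by
  subst e; rfl

/-- A family of terms given by one value at `p` and the values elsewhere. -/
def pick [DecidableEq K] (p : K) (a : 𝒮.DTm z (x p)) (b : ∀ i : {i // i ≠ p}, 𝒮.DTm z (x i))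
    (i : K) : 𝒮.DTm z (x i) :=
  if h : i = p then cast a (by rw [h]) else b ⟨i, h⟩

theorem pick_self [DecidableEq K] (p : K) (a : 𝒮.DTm z (x p))
    (b : ∀ i : {i // i ≠ p}, 𝒮.DTm z (x i)) : pick p a b p = a := by
  rw [pick, dif_pos rfl, cast_rfl]

theorem pick_ne [DecidableEq K] (p : K) (a : 𝒮.DTm z (x p))
    (b : ∀ i : {i // i ≠ p}, 𝒮.DTm z (x i)) (i : K) (h : i ≠ p) : pick p a b i = b ⟨i, h⟩ :=
  dif_neg h

theorem pick_unique [DecidableEq K] (p : K) (a : 𝒮.DTm z (x p))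
    (b : ∀ i : {i // i ≠ p}, 𝒮.DTm z (x i)) (s : ∀ i, 𝒮.DTm z (x i)) (h₁ : a = s p)
    (h₂ : ∀ i, b i = s i.1) (i : K) : pick p a b i = s i := by
  by_cases h : i = p
  · subst h; rw [pick_self, h₁]
  · rw [pick_ne _ _ _ _ h, h₂]

theorem pick_dbind [DecidableEq K] (p : K) (a : 𝒮.DTm z (x p))
    (b : ∀ i : {i // i ≠ p}, 𝒮.DTm z (x i)) (s : ∀ k, 𝒮.DTm z' (z k)) (i : K) :
    dbind (pick p a b i) s = pick p (dbind a s) (fun i => dbind (b i) s) i :=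
  (pick_unique _ _ _ (fun i => dbind (pick p a b i) s) (by rw [pick_self])
    (fun i => by rw [pick_ne _ _ _ _ i.2]) i).symm

namespace InputOrder

variable (o : 𝒮.InputOrder)

theorem ord_cast (t : 𝒮.DTm x y) (h : y = y') : o.ord (cast t h) = o.ord t := by
  subst h; simp

theorem ord_dmap (t : 𝒮.DTm x y) (e : K → K') (h : ∀ k, z (e k) = x k) :
    o.ord (dmap t e h) = (o.ord t).map e := o.ord_map t e _

/-- A term with inputs numbered according to the chosen order. -/
structure GArr (o : 𝒮.InputOrder) where
  ar : ℕ
  src : Fin ar → A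
  tgt : A
  tm : 𝒮.DTm src tgt
  ord_eq : o.ord tm = List.finRange ar

variable {o}

theorem GArr.ext' (P P' : o.GArr) (j : Fin P.ar → Fin P'.ar) (hs : ∀ i, P'.src (j i) = P.src i)
    (ht : P.tgt = P'.tgt) (h : cast (dmap P.tm j hs) ht = P'.tm) :
    P = P' ∧ ∀ i, (j i : ℕ) = i := by
  have h₁ : (List.finRange P.ar).map j = List.finRange P'.ar := by
    rw [← P'.ord_eq, ← h, ord_cast, ord_dmap, P.ord_eq]
  obtain ⟨n, s, t, tm, l⟩ := P
  obtain ⟨n', s', t', tm', l'⟩ := P'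
  obtain rfl : n = n' := by simpa using congrArg List.length h₁
  obtain rfl : j = fun i => i := by
    rw [← List.ofFn_eq_map, ← List.ofFn_id] at h₁
    exact List.ofFn_injective h₁
  obtain rfl : t = t' := ht
  obtain rfl : s' = s := funext hs
  refine ⟨?_, fun i => rfl⟩
  dsimp only at h
  rw [cast_rfl, dmap_id _ _ _ fun _ => rfl] at h
  subst h
  rfl

/-- A term is linear if each label is used exactly once. -/
def IsLin [Fintype K] (t : 𝒮.DTm x y) : Prop := 𝒮.supp t = Finset.univ.val

theorem nodup_ord [Fintype K] {t : 𝒮.DTm x y} (h : IsLin t) : (o.ord t).Nodup := by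
  rw [← Multiset.coe_nodup, o.coe_ord, h]
  exact Finset.nodup _

theorem mem_ord [Fintype K] {t : 𝒮.DTm x y} (h : IsLin t) (k : K) : k ∈ o.ord t := by
  rw [← Multiset.mem_coe, o.coe_ord, h]
  exact Finset.mem_univ k

open Classical in
/-- The numbering of the inputs of a linear term. -/
noncomputable def num (o : 𝒮.InputOrder) [Fintype K] (t : 𝒮.DTm x y) (h : IsLin t) :
    Fin (o.ord t).length ≃ K :=
  List.Nodup.getEquivOfForallMemList _ (nodup_ord h) (mem_ord h)

theorem num_symm (o : 𝒮.InputOrder) [Fintype K] (t : 𝒮.DTm x y) (h : IsLin t) (k : K) :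
    x (o.num t h ((o.num t h).symm k)) = x k :=
  congrArg x ((o.num t h).apply_symm_apply k)

/-- Forget the labels of a linear term. -/
noncomputable abbrev norm (o : 𝒮.InputOrder) [Fintype K] (t : 𝒮.DTm x y) (h : IsLin t) :
    o.GArr where
  ar := (o.ord t).length
  src i := x (o.num t h i)
  tgt := y
  tm := dmap t (o.num t h).symm (num_symm o t h)
  ord_eq := by
    rw [ord_dmap]
    refine (congrArg (List.map _) (List.map_get_finRange (o.ord t)).symm).trans ?_
    rw [List.map_map]
    refine (List.map_congr_left fun i _ => ?_).trans (List.map_id _)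
    exact (o.num t h).symm_apply_apply i

theorem norm_dmap [Fintype K] (t : 𝒮.DTm x y) (h : IsLin t) :
    dmap (o.norm t h).tm (o.num t h) (fun _ => rfl) = t := by
  refine (dmap_dmap t (o.num t h).symm (num_symm o t h) (o.num t h) fun _ => rfl).trans
    (dmap_id t _ _ fun k => (o.num t h).apply_symm_apply k)

theorem supp_dmap (t : 𝒮.DTm x y) (e : K → K') (h : ∀ k, z (e k) = x k) :
    𝒮.supp (dmap t e h) = (𝒮.supp t).map e := supp_map t e _

theorem supp_cast (t : 𝒮.DTm x y) (h : y = y') : 𝒮.supp (cast t h) = 𝒮.supp t :=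
  𝒮.supp_post t _

theorem supp_dvar (k : K) : 𝒮.supp (dvar 𝒮 x k) = {k} := 𝒮.supp_var k

theorem supp_dbind (t : 𝒮.DTm x y) (s : ∀ k, 𝒮.DTm z (x k)) :
    𝒮.supp (dbind t s) = (𝒮.supp t).bind fun k => 𝒮.supp (s k) := 𝒮.supp_bind t s

theorem GArr.lin (P : o.GArr) : IsLin P.tm := by
  rw [IsLin, ← o.coe_ord, P.ord_eq]
  rfl

/-- The composite as a term: the inputs of `f` except `p` and those of `g` are its inputs. -/
def compTm (f : o.GArr) (p : Fin f.ar) (g : o.GArr) (h : g.tgt = f.src p) :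
    𝒮.DTm (Sum.elim (fun q : {q : Fin f.ar // q ≠ p} => f.src q) g.src) f.tgt :=
  dbind f.tm (pick p (cast (dmap g.tm Sum.inr (Sum.elim_inr _ _)) h)
    fun q => cast (dvar 𝒮 _ (Sum.inl q)) (Sum.elim_inl _ _ _))

theorem compTm_lin (f : o.GArr) (p : Fin f.ar) (g : o.GArr) (h : g.tgt = f.src p) :
    IsLin (compTm f p g h) := by
  have e : (Finset.univ : Finset (Option {q : Fin f.ar // q ≠ p})).val =
      none ::ₘ Finset.univ.val.map some := by
    rw [univ_option]; rfl
  rw [IsLin, compTm, supp_dbind, f.lin, ← univ_map_equiv (Equiv.optionSubtypeNe p),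
    Multiset.bind_map, e, Multiset.cons_bind, Multiset.bind_map]
  simp only [Equiv.optionSubtypeNe_none, Equiv.optionSubtypeNe_some, pick_self]
  rw [supp_cast, supp_dmap, g.lin]
  refine (add_comm _ _).trans (congrArg₂ (· + ·) ?_ rfl)
  rw [← Multiset.bind_singleton]
  refine Multiset.bind_congr fun q _ => ?_
  rw [pick_ne _ _ _ _ q.2, supp_cast, supp_dvar]

/-- Composition. -/
noncomputable abbrev comp (f : o.GArr) (p : Fin f.ar) (g : o.GArr) (h : g.tgt = f.src p) : o.GArr :=
  o.norm (compTm f p g h) (compTm_lin f p g h)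

/-- The amalgamating maps. -/
noncomputable def amalg (f : o.GArr) (p : Fin f.ar) (g : o.GArr) (h : g.tgt = f.src p) :
    {q : Fin f.ar // q ≠ p} ⊕ Fin g.ar ≃ Fin (comp f p g h).ar :=
  (o.num (compTm f p g h) (compTm_lin f p g h)).symm

section

variable (f : o.GArr) (p : Fin f.ar) (g : o.GArr) (h : g.tgt = f.src p)

theorem src_inl (q) : (comp f p g h).src (amalg f p g h (Sum.inl q)) = f.src q :=
  congrArg (Sum.elim (fun q : {q : Fin f.ar // q ≠ p} => f.src q) g.src)
    (Equiv.apply_symm_apply _ _)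

theorem src_inr (r) : (comp f p g h).src (amalg f p g h (Sum.inr r)) = g.src r :=
  congrArg (Sum.elim (fun q : {q : Fin f.ar // q ≠ p} => f.src q) g.src)
    (Equiv.apply_symm_apply _ _)

theorem comp_dbind (s : ∀ i, 𝒮.DTm z ((comp f p g h).src i)) :
    dbind (comp f p g h).tm s = dbind f.tm (pick p
      (cast (dbind g.tm fun r => cast (s (amalg f p g h (Sum.inr r))) (src_inr f p g h r)) h)
      fun q => cast (s (amalg f p g h (Sum.inl q))) (src_inl f p g h q)) := by
  refine (dmap_dbind (compTm f p g h) (o.num _ (compTm_lin f p g h)).symm (num_symm o _ (compTm_lin f p g h)) s).trans ?_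
  refine (dbind_dbind f.tm _ _).trans (dbind_congr _ fun i => ?_)
  rw [pick_dbind]
  congr 1
  · rw [cast_dbind, dmap_dbind]
    simp only [cast_cast]
    rfl
  · funext q
    rw [cast_dbind, dvar_dbind, cast_cast]
    rfl

end

/-- The identity. -/
abbrev gid (o : 𝒮.InputOrder) (x : A) : o.GArr where
  ar := 1
  src _ := x
  tgt := x
  tm := dvar 𝒮 (fun _ : Fin 1 => x) 0
  ord_eq := by
    have := o.coe_ord (dvar 𝒮 (fun _ : Fin 1 => x) 0)
    rw [supp_dvar] at this
    exact Multiset.coe_eq_singleton.1 this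

theorem comp_dmap (f : o.GArr) (p : Fin f.ar) (g : o.GArr) (h : g.tgt = f.src p)
    (j : Fin (comp f p g h).ar → K) (hj : ∀ i, x (j i) = (comp f p g h).src i) :
    dmap (comp f p g h).tm j hj = dbind f.tm (pick p
      (cast (dmap g.tm (fun r => j (amalg f p g h (Sum.inr r)))
        fun r => (hj _).trans (src_inr f p g h r)) h)
      fun q => cast (dvar 𝒮 x (j (amalg f p g h (Sum.inl q))))
        ((hj _).trans (src_inl f p g h q))) := by
  rw [dmap_eq, comp_dbind]
  simp only [cast_cast]
  rfl

theorem id_comp (f : o.GArr) (p : Fin (gid o f.tgt).ar) (h : f.tgt = (gid o f.tgt).src p) :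
    comp (gid o f.tgt) p f h = f ∧ ∀ r, (amalg (gid o f.tgt) p f h (Sum.inr r) : ℕ) = r := by
  let j : Fin (comp (gid o f.tgt) p f h).ar → Fin f.ar := fun i =>
    Sum.elim (fun q => (q.2 (Subsingleton.elim (α := Fin 1) _ _)).elim) (fun r => r)
      ((amalg (gid o f.tgt) p f h).symm i)
  have hj : ∀ r, j (amalg (gid o f.tgt) p f h (Sum.inr r)) = r := fun r => by
    simp [j]
  have hs : ∀ i, f.src (j i) = (comp (gid o f.tgt) p f h).src i := by
    intro i
    obtain ⟨q | r, rfl⟩ := (amalg (gid o f.tgt) p f h).surjective i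
    · exact (q.2 (Subsingleton.elim (α := Fin 1) _ _)).elim
    · rw [hj, src_inr]
  obtain ⟨h₁, h₂⟩ := GArr.ext' (comp (gid o f.tgt) p f h) f j hs rfl (by
    rw [cast_rfl, comp_dmap]
    refine (dvar_dbind (x := fun _ : Fin 1 => f.tgt) 0 _).trans ?_
    obtain rfl : p = (0 : Fin 1) := Subsingleton.elim (α := Fin 1) _ _
    refine (pick_self (x := (gid o f.tgt).src) _ _ _).trans ?_
    rw [cast_rfl]
    exact dmap_id _ _ _ hj)
  exact ⟨h₁, fun r => by rw [← h₂, hj]⟩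

theorem comp_id (f : o.GArr) (p : Fin f.ar) (h : (gid o (f.src p)).tgt = f.src p) :
    comp f p (gid o (f.src p)) h = f ∧
      (∀ q, (amalg f p (gid o (f.src p)) h (Sum.inl q) : ℕ) = q.1) ∧
      ∀ r, (amalg f p (gid o (f.src p)) h (Sum.inr r) : ℕ) = p := by
  let j : Fin (comp f p (gid o (f.src p)) h).ar → Fin f.ar := fun i =>
    Sum.elim (fun q => q.1) (fun _ => p) ((amalg f p (gid o (f.src p)) h).symm i)
  have hl : ∀ q, j (amalg f p (gid o (f.src p)) h (Sum.inl q)) = q.1 := fun q => by simp [j]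
  have hr : ∀ r, j (amalg f p (gid o (f.src p)) h (Sum.inr r)) = p := fun r => by simp [j]
  have hs : ∀ i, f.src (j i) = (comp f p (gid o (f.src p)) h).src i := by
    intro i
    obtain ⟨q | r, rfl⟩ := (amalg f p (gid o (f.src p)) h).surjective i
    · rw [hl, src_inl]
    · rw [hr, src_inr]
  obtain ⟨h₁, h₂⟩ := GArr.ext' (comp f p (gid o (f.src p)) h) f j hs rfl (by
    rw [cast_rfl, comp_dmap]
    conv_rhs => rw [← dbind_dvar f.tm]
    refine dbind_congr _ (pick_unique _ _ _ _ ?_ fun q => ?_)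
    · rw [cast_rfl]
      refine (dvar_dbind (x := fun _ : Fin 1 => f.src p) 0 _).trans ?_
      exact (cast_dvar_congr (congrArg f.src (hr 0)) rfl (hr 0)).trans (cast_rfl _ _)
    · exact (cast_dvar_congr _ rfl (hl q)).trans (cast_rfl _ _))
  exact ⟨h₁, fun q => by rw [← h₂, hl], fun r => by rw [← h₂, hr]⟩

section

variable (f : o.GArr) (p : Fin f.ar) (g : o.GArr)

theorem amalg_cases {f : o.GArr} {p : Fin f.ar} {g : o.GArr} {h : g.tgt = f.src p}
    {P : Fin (comp f p g h).ar → Prop} (hl : ∀ q, P (amalg f p g h (Sum.inl q)))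
    (hr : ∀ r, P (amalg f p g h (Sum.inr r))) : ∀ i, P i := by
  intro i
  obtain ⟨q | r, rfl⟩ := (amalg f p g h).surjective i
  exacts [hl q, hr r]

theorem assoc (q : Fin g.ar) (h : o.GArr)
    (e₁ : g.tgt = f.src p) (e₂ : h.tgt = g.src q)
    (e₃ : h.tgt = (comp f p g e₁).src (amalg f p g e₁ (Sum.inr q)))
    (e₄ : (comp g q h e₂).tgt = f.src p) :
    comp (comp f p g e₁) (amalg f p g e₁ (Sum.inr q)) h e₃ = comp f p (comp g q h e₂) e₄ ∧
    (∀ (r : {r : Fin f.ar // r ≠ p})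
      (n₁ : amalg f p g e₁ (Sum.inl r) ≠ amalg f p g e₁ (Sum.inr q)),
      (amalg (comp f p g e₁) (amalg f p g e₁ (Sum.inr q)) h e₃
        (Sum.inl ⟨amalg f p g e₁ (Sum.inl r), n₁⟩) : ℕ) =
      amalg f p (comp g q h e₂) e₄ (Sum.inl r)) ∧
    (∀ (r : {r : Fin g.ar // r ≠ q})
      (n₁ : amalg f p g e₁ (Sum.inr r) ≠ amalg f p g e₁ (Sum.inr q)),
      (amalg (comp f p g e₁) (amalg f p g e₁ (Sum.inr q)) h e₃
        (Sum.inl ⟨amalg f p g e₁ (Sum.inr r), n₁⟩) : ℕ) =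
      amalg f p (comp g q h e₂) e₄ (Sum.inr (amalg g q h e₂ (Sum.inl r)))) ∧
    ∀ r : Fin h.ar,
      (amalg (comp f p g e₁) (amalg f p g e₁ (Sum.inr q)) h e₃ (Sum.inr r) : ℕ) =
      amalg f p (comp g q h e₂) e₄ (Sum.inr (amalg g q h e₂ (Sum.inr r))) := by
  have key : ∃ j : Fin (comp (comp f p g e₁) (amalg f p g e₁ (Sum.inr q)) h e₃).ar →
      Fin (comp f p (comp g q h e₂) e₄).ar,
      (∀ r n₁, j (amalg (comp f p g e₁) (amalg f p g e₁ (Sum.inr q)) h e₃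
        (Sum.inl ⟨amalg f p g e₁ (Sum.inl r), n₁⟩)) =
        amalg f p (comp g q h e₂) e₄ (Sum.inl r)) ∧
      (∀ (r : {r : Fin g.ar // r ≠ q}) n₁,
        j (amalg (comp f p g e₁) (amalg f p g e₁ (Sum.inr q)) h e₃
          (Sum.inl ⟨amalg f p g e₁ (Sum.inr r), n₁⟩)) =
        amalg f p (comp g q h e₂) e₄ (Sum.inr (amalg g q h e₂ (Sum.inl r)))) ∧
      ∀ r, j (amalg (comp f p g e₁) (amalg f p g e₁ (Sum.inr q)) h e₃ (Sum.inr r)) =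
        amalg f p (comp g q h e₂) e₄ (Sum.inr (amalg g q h e₂ (Sum.inr r))) := by
    obtain ⟨j, h₁, h₂⟩ := exists_ext_inr (amalg f p g e₁) q
      (fun r => amalg f p (comp g q h e₂) e₄ (Sum.inl r))
      fun r hr => amalg f p (comp g q h e₂) e₄ (Sum.inr (amalg g q h e₂ (Sum.inl ⟨r, hr⟩)))
    refine ⟨fun i => Sum.elim j
      (fun r => amalg f p (comp g q h e₂) e₄ (Sum.inr (amalg g q h e₂ (Sum.inr r))))
      ((amalg (comp f p g e₁) (amalg f p g e₁ (Sum.inr q)) h e₃).symm i), ?_, ?_, ?_⟩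
    · intro r n
      beta_reduce
      rw [Equiv.symm_apply_apply]
      exact h₁ r n
    · intro r n
      beta_reduce
      rw [Equiv.symm_apply_apply]
      exact h₂ r.1 r.2 n
    · intro r
      beta_reduce
      rw [Equiv.symm_apply_apply]
      rfl
  obtain ⟨j, j₁, j₂, j₃⟩ := key
  have n₁ : ∀ r : {r : Fin f.ar // r ≠ p},
      amalg f p g e₁ (Sum.inl r) ≠ amalg f p g e₁ (Sum.inr q) := fun r e => by simp at e
  have n₂ : ∀ r : {r : Fin g.ar // r ≠ q},
      amalg f p g e₁ (Sum.inr r) ≠ amalg f p g e₁ (Sum.inr q) := fun r e => r.2 (by simpa using e)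
  have hs : ∀ i, (comp f p (comp g q h e₂) e₄).src (j i) =
      (comp (comp f p g e₁) (amalg f p g e₁ (Sum.inr q)) h e₃).src i := by
    refine amalg_cases ?_ fun r => ?_
    · rintro ⟨i, hi⟩
      revert i
      refine amalg_cases (fun r hi => ?_) fun r hi => ?_
      · rw [j₁, src_inl, src_inl, src_inl]
      · rw [j₂ ⟨r, fun e => hi (by rw [e])⟩, src_inr, src_inl, src_inl, src_inr]
    · rw [j₃, src_inr, src_inr, src_inr]
  obtain ⟨h₁, h₂⟩ := GArr.ext' _ _ j hs rfl (by
    rw [cast_rfl, comp_dmap, comp_dbind,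
      ← dmap_id (comp f p (comp g q h e₂) e₄).tm (fun i => i) (fun _ => rfl) fun _ => rfl,
      comp_dmap]
    refine dbind_congr _ (pick_unique _ _ _ _ ?_ fun r => ?_)
    · rw [pick_self, comp_dmap]
      congr 1
      refine dbind_congr _ fun i => ?_
      by_cases hi : i = q
      · subst hi
        rw [pick_self, pick_self, cast_cast]
        congr 1
        exact dmap_congr _ _ _ j₃
      · rw [pick_ne _ _ _ _ hi, pick_ne _ _ _ _ (n₂ ⟨i, hi⟩), cast_cast]
        exact cast_dvar_congr _ _ (j₂ ⟨i, hi⟩ _)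
    · rw [pick_ne _ _ _ _ r.2, pick_ne _ _ _ _ (n₁ r), cast_cast]
      exact cast_dvar_congr _ _ (j₁ r _))
  exact ⟨h₁, fun r n => by rw [← h₂, j₁], fun r n => by rw [← h₂, j₂], fun r => by rw [← h₂, j₃]⟩

theorem comm (q : Fin f.ar) (hpq : p ≠ q) (h : o.GArr)
    (e₁ : g.tgt = f.src p) (e₂ : h.tgt = f.src q)
    (e₃ : h.tgt = (comp f p g e₁).src (amalg f p g e₁ (Sum.inl ⟨q, hpq.symm⟩)))
    (e₄ : g.tgt = (comp f q h e₂).src (amalg f q h e₂ (Sum.inl ⟨p, hpq⟩))) :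
    comp (comp f p g e₁) (amalg f p g e₁ (Sum.inl ⟨q, hpq.symm⟩)) h e₃ =
      comp (comp f q h e₂) (amalg f q h e₂ (Sum.inl ⟨p, hpq⟩)) g e₄ ∧
    (∀ (r : Fin f.ar) (hp : r ≠ p) (hq : r ≠ q)
      (n₁ : amalg f p g e₁ (Sum.inl ⟨r, hp⟩) ≠ amalg f p g e₁ (Sum.inl ⟨q, hpq.symm⟩))
      (n₂ : amalg f q h e₂ (Sum.inl ⟨r, hq⟩) ≠ amalg f q h e₂ (Sum.inl ⟨p, hpq⟩)),
      (amalg (comp f p g e₁) (amalg f p g e₁ (Sum.inl ⟨q, hpq.symm⟩)) h e₃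
        (Sum.inl ⟨amalg f p g e₁ (Sum.inl ⟨r, hp⟩), n₁⟩) : ℕ) =
      amalg (comp f q h e₂) (amalg f q h e₂ (Sum.inl ⟨p, hpq⟩)) g e₄
        (Sum.inl ⟨amalg f q h e₂ (Sum.inl ⟨r, hq⟩), n₂⟩)) ∧
    (∀ (r : Fin g.ar)
      (n₁ : amalg f p g e₁ (Sum.inr r) ≠ amalg f p g e₁ (Sum.inl ⟨q, hpq.symm⟩)),
      (amalg (comp f p g e₁) (amalg f p g e₁ (Sum.inl ⟨q, hpq.symm⟩)) h e₃
        (Sum.inl ⟨amalg f p g e₁ (Sum.inr r), n₁⟩) : ℕ) =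
      amalg (comp f q h e₂) (amalg f q h e₂ (Sum.inl ⟨p, hpq⟩)) g e₄ (Sum.inr r)) := by
  have n₁ : ∀ r (hp : r ≠ p), r ≠ q →
      amalg f p g e₁ (Sum.inl ⟨r, hp⟩) ≠ amalg f p g e₁ (Sum.inl ⟨q, hpq.symm⟩) :=
    fun r _ hr e => hr (by simpa using e)
  have n₂ : ∀ r (hq : r ≠ q), r ≠ p →
      amalg f q h e₂ (Sum.inl ⟨r, hq⟩) ≠ amalg f q h e₂ (Sum.inl ⟨p, hpq⟩) :=
    fun r _ hr e => hr (by simpa using e)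
  have n₃ : ∀ r, amalg f p g e₁ (Sum.inr r) ≠ amalg f p g e₁ (Sum.inl ⟨q, hpq.symm⟩) :=
    fun r e => by simp at e
  have n₄ : ∀ r, amalg f q h e₂ (Sum.inr r) ≠ amalg f q h e₂ (Sum.inl ⟨p, hpq⟩) :=
    fun r e => by simp at e
  have key : ∃ j : Fin (comp (comp f p g e₁) (amalg f p g e₁ (Sum.inl ⟨q, hpq.symm⟩)) h e₃).ar →
      Fin (comp (comp f q h e₂) (amalg f q h e₂ (Sum.inl ⟨p, hpq⟩)) g e₄).ar,
      (∀ r (hp : r ≠ p) (hq : r ≠ q), j (amalg (comp f p g e₁)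
        (amalg f p g e₁ (Sum.inl ⟨q, hpq.symm⟩)) h e₃
        (Sum.inl ⟨amalg f p g e₁ (Sum.inl ⟨r, hp⟩), n₁ r hp hq⟩)) =
        amalg (comp f q h e₂) (amalg f q h e₂ (Sum.inl ⟨p, hpq⟩)) g e₄
          (Sum.inl ⟨amalg f q h e₂ (Sum.inl ⟨r, hq⟩), n₂ r hq hp⟩)) ∧
      (∀ r, j (amalg (comp f p g e₁) (amalg f p g e₁ (Sum.inl ⟨q, hpq.symm⟩)) h e₃
          (Sum.inl ⟨amalg f p g e₁ (Sum.inr r), n₃ r⟩)) =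
        amalg (comp f q h e₂) (amalg f q h e₂ (Sum.inl ⟨p, hpq⟩)) g e₄ (Sum.inr r)) ∧
      ∀ r, j (amalg (comp f p g e₁) (amalg f p g e₁ (Sum.inl ⟨q, hpq.symm⟩)) h e₃
          (Sum.inr r)) =
        amalg (comp f q h e₂) (amalg f q h e₂ (Sum.inl ⟨p, hpq⟩)) g e₄
          (Sum.inl ⟨amalg f q h e₂ (Sum.inr r), n₄ r⟩) := by
    obtain ⟨j, h₁, h₂⟩ := exists_ext_inl (amalg f p g e₁) ⟨q, hpq.symm⟩
      (fun r hr => amalg (comp f q h e₂) (amalg f q h e₂ (Sum.inl ⟨p, hpq⟩)) g e₄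
        (Sum.inl ⟨amalg f q h e₂ (Sum.inl ⟨r.1, fun e => hr (Subtype.ext e)⟩), n₂ _ _ r.2⟩))
      fun r => amalg (comp f q h e₂) (amalg f q h e₂ (Sum.inl ⟨p, hpq⟩)) g e₄ (Sum.inr r)
    refine ⟨fun i => Sum.elim j
      (fun r => amalg (comp f q h e₂) (amalg f q h e₂ (Sum.inl ⟨p, hpq⟩)) g e₄
          (Sum.inl ⟨amalg f q h e₂ (Sum.inr r), n₄ r⟩))
      ((amalg (comp f p g e₁) (amalg f p g e₁ (Sum.inl ⟨q, hpq.symm⟩)) h e₃).symm i),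
      ?_, ?_, ?_⟩
    · intro r hp hq
      beta_reduce
      rw [Equiv.symm_apply_apply]
      exact h₁ ⟨r, hp⟩ (fun e => hq (congrArg Subtype.val e)) _
    · intro r
      beta_reduce
      rw [Equiv.symm_apply_apply]
      exact h₂ r _
    · intro r
      beta_reduce
      rw [Equiv.symm_apply_apply]
      rfl
  obtain ⟨j, j₁, j₂, j₃⟩ := key
  have hs : ∀ i, (comp (comp f q h e₂) (amalg f q h e₂ (Sum.inl ⟨p, hpq⟩)) g e₄).src (j i) =
      (comp (comp f p g e₁) (amalg f p g e₁ (Sum.inl ⟨q, hpq.symm⟩)) h e₃).src i := by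
    refine amalg_cases ?_ fun r => ?_
    · rintro ⟨i, hi⟩
      revert i
      refine amalg_cases (fun r hi => ?_) fun r hi => ?_
      · rw [j₁ r.1 r.2 (fun e => hi (congrArg _ (congrArg _ (Subtype.ext e)))), src_inl, src_inl,
          src_inl, src_inl]
      · rw [j₂, src_inr, src_inl, src_inr]
    · rw [j₃, src_inr, src_inl, src_inr]
  obtain ⟨h₁, h₂⟩ := GArr.ext' _ _ j hs rfl (by
    rw [cast_rfl, comp_dmap, comp_dbind,
      ← dmap_id (comp (comp f q h e₂) (amalg f q h e₂ (Sum.inl ⟨p, hpq⟩)) g e₄).tm (fun i => i)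
        (fun _ => rfl) fun _ => rfl, comp_dmap, comp_dbind]
    refine dbind_congr _ (pick_unique _ _ _ _ ?_ fun r => ?_)
    · rw [pick_ne _ _ _ _ hpq, pick_self, cast_cast]
      congr 1
      rw [dmap_eq]
      refine dbind_congr _ fun i => ?_
      rw [pick_ne _ _ _ _ (n₃ i), cast_cast]
      exact cast_dvar_congr _ (by rw [src_inr]) (j₂ i)
    · by_cases hr : r.1 = q
      · obtain ⟨r, hp⟩ := r
        obtain rfl : r = q := hr
        rw [pick_self, pick_self, cast_cast]
        congr 1
        rw [dmap_eq]
        refine dbind_congr _ fun i => ?_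
        rw [pick_ne _ _ _ _ (n₄ i), cast_cast]
        exact cast_dvar_congr _ _ (j₃ i)
      · rw [pick_ne _ _ _ _ hr, pick_ne _ _ _ _ (n₁ r.1 r.2 hr),
          pick_ne _ _ _ _ (n₂ r.1 hr r.2), cast_cast, cast_cast]
        exact cast_dvar_congr _ _ (j₁ r.1 r.2 hr))
  exact ⟨h₁, fun r hp hq _ _ => by rw [← h₂, j₁ r hp hq], fun r _ => by rw [← h₂, j₂]⟩

end

/-- The generalised multicategory of the linear terms, the inputs of each of them being put in
the chosen order. -/
noncomputable abbrev gen (o : 𝒮.InputOrder) : GenMulticat.{u, max u w} where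
  Obj := A
  Arr := o.GArr
  ar := GArr.ar
  src := GArr.src
  tgt := GArr.tgt
  comp := comp
  tgt_comp _ _ _ _ := rfl
  amalg := amalg
  src_inl := src_inl
  src_inr := src_inr
  id := gid o
  ar_id _ := rfl
  src_id _ _ := rfl
  tgt_id _ := rfl
  id_comp f p h := (id_comp f p h).1
  id_comp_inr f p h := (id_comp f p h).2
  comp_id f p h := (comp_id f p h).1
  comp_id_inl f p h := (comp_id f p h).2.1
  comp_id_inr f p h := (comp_id f p h).2.2
  assoc f p g q h e₁ e₂ e₃ e₄ := (assoc f p g q h e₁ e₂ e₃ e₄).1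
  assoc_left f p g q h e₁ e₂ e₃ e₄ := (assoc f p g q h e₁ e₂ e₃ e₄).2.1
  assoc_mid f p g q h e₁ e₂ e₃ e₄ := (assoc f p g q h e₁ e₂ e₃ e₄).2.2.1
  assoc_right f p g q h e₁ e₂ e₃ e₄ := (assoc f p g q h e₁ e₂ e₃ e₄).2.2.2
  comm f p q hpq g h e₁ e₂ e₃ e₄ := (comm f p g q hpq h e₁ e₂ e₃ e₄).1
  comm_left f p q hpq g h e₁ e₂ e₃ e₄ := (comm f p g q hpq h e₁ e₂ e₃ e₄).2.1
  comm_right f p q hpq g h e₁ e₂ e₃ e₄ := (comm f p g q hpq h e₁ e₂ e₃ e₄).2.2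

end InputOrder

end Discrete

end TermCalc

/-! ## Morphisms of term calculi -/

namespace TermCalc

variable {C : Type u} [Category.{v} C] {C' : Type u'} [Category.{v'} C']

/-- A morphism of term calculi. -/
structure Map (𝒯 : TermCalc.{u, v, w} C) (𝒯' : TermCalc.{u', v', w'} C') where
  F : C ⥤ C'
  map : ∀ {K : Type} {x : K → C} {y : C}, 𝒯.Tm x y → 𝒯'.Tm (fun k => F.obj (x k)) (F.obj y)
  map_var : ∀ {K : Type} {x : K → C} (k : K),
    map (𝒯.var (x := x) k) = 𝒯'.var (x := fun k => F.obj (x k)) k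
  map_bind : ∀ {K K' : Type} {x : K → C} {z : K' → C} {y : C} (t : 𝒯.Tm x y)
    (s : ∀ k, 𝒯.Tm z (x k)), map (𝒯.bind t s) = 𝒯'.bind (map t) fun k => map (s k)
  map_post : ∀ {K : Type} {x : K → C} {y y' : C} (t : 𝒯.Tm x y) (a : y ⟶ y'),
    map (𝒯.post t a) = 𝒯'.post (map t) (F.map a)
  supp_map : ∀ {K : Type} {x : K → C} {y : C} (t : 𝒯.Tm x y), 𝒯'.supp (map t) = 𝒯.supp t

variable {𝒯 : TermCalc.{u, v, w} C} {𝒯' : TermCalc.{u', v', w'} C'}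

theorem Map.map_map (Φ : Map 𝒯 𝒯') {K K' : Type} {x : K → C} {z : K' → C} {y : C}
    (t : 𝒯.Tm x y) (e : K → K') (h : ∀ k, z (e k) = x k) :
    Φ.map (𝒯.map t e h) = 𝒯'.map (Φ.map t) e fun k => congrArg Φ.F.obj (h k) := by
  simp only [TermCalc.map, Φ.map_bind, Φ.map_post, Φ.map_var, eqToHom_map]

/-- The induced function on linear terms. -/
abbrev Map.onLin (Φ : Map 𝒯 𝒯') {k : ℕ} (L : 𝒯.Lin k) : 𝒯'.Lin k where
  src i := Φ.F.obj (L.src i)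
  tgt := Φ.F.obj L.tgt
  tm := Φ.map L.tm
  lin := (Φ.supp_map _).trans L.lin

theorem Map.onLin_ι (Φ : Map 𝒯 𝒯') {x y : C} (a : x ⟶ y) :
    Φ.onLin (Lin.ι 𝒯 a) = Lin.ι 𝒯' (Φ.F.map a) := by
  refine Lin.mk_eq (fun _ => rfl) ?_
  rw [map_id _ _ fun _ => rfl]
  simp only [Φ.map_post, Φ.map_var]

theorem Map.onLin_act (Φ : Map 𝒯 𝒯') {k l : ℕ} (L : 𝒯.Lin k) (σ : Fin l ≃ Fin k) :
    Φ.onLin (L.act σ) = (Φ.onLin L).act σ := by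
  refine Lin.mk_eq (fun _ => rfl) ?_
  rw [map_id _ _ fun _ => rfl]
  simp only [Φ.map_map]

theorem Map.onLin_comp (Φ : Map 𝒯 𝒯') {k : ℕ} {m : Fin k → ℕ} (L : 𝒯.Lin k)
    (G : ∀ i, 𝒯.Lin (m i)) (h : ∀ i, (G i).tgt = L.src i) :
    Φ.onLin (L.comp G h) = (Φ.onLin L).comp (fun i => Φ.onLin (G i))
      fun i => congrArg Φ.F.obj (h i) := by
  refine Lin.mk_eq (fun _ => rfl) ?_
  rw [map_id _ _ fun _ => rfl]
  simp only [Φ.map_bind, Φ.map_post, Φ.map_map, eqToHom_map]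

/-! The terms obtained by labelling the inputs of a linear term. -/

/-- Label the inputs of a linear term. -/
def Lin.lab {k : ℕ} (L : 𝒯.Lin k) {K : Type} {x : K → C} {y : C} (e : Fin k → K)
    (h : ∀ i, x (e i) = L.src i) (h' : L.tgt = y) : 𝒯.Tm x y :=
  𝒯.post (𝒯.map L.tm e h) (eqToHom h')

theorem Lin.lab_congr {k : ℕ} {L L' : 𝒯.Lin k} (hL : L = L') {K : Type} {x : K → C} {y : C}
    {e e' : Fin k → K} (he : ∀ i, e i = e' i) (h : ∀ i, x (e i) = L.src i) (h' : L.tgt = y)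
    (h₁ : ∀ i, x (e' i) = L'.src i) (h₂ : L'.tgt = y) : L.lab e h h' = L'.lab e' h₁ h₂ := by
  subst hL
  obtain rfl : e = e' := funext he
  rfl

theorem Lin.lab_act {k l : ℕ} (L : 𝒯.Lin k) (σ : Fin l ≃ Fin k) {K : Type} {x : K → C} {y : C}
    (e : Fin k → K) (h : ∀ i, x (e (σ i)) = (L.act σ).src i) (h' : (L.act σ).tgt = y)
    (h₁ : ∀ i, x (e i) = L.src i) (h₂ : L.tgt = y) :
    (L.act σ).lab (fun i => e (σ i)) h h' = L.lab e h₁ h₂ := by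
  unfold lab
  refine congrArg (fun t => 𝒯.post t _) ((TermCalc.map_map _ _ _ _ _).trans ?_)
  exact map_congr _ _ fun i => by rw [σ.apply_symm_apply]

theorem Lin.lab_ι {x₀ y₀ : C} (a : x₀ ⟶ y₀) {K : Type} {x : K → C} {y : C} (k : K)
    (h : x k = x₀) (h' : y₀ = y) :
    (Lin.ι 𝒯 a).lab (fun _ => k) (fun _ => h) h' =
      𝒯.post (𝒯.var k) (eqToHom h ≫ a ≫ eqToHom h') := by
  unfold lab
  rw [post_map, var_map, 𝒯.post_post, 𝒯.post_post]

theorem Lin.lab_comp {k : ℕ} {m : Fin k → ℕ} (L : 𝒯.Lin k) (G : ∀ i, 𝒯.Lin (m i))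
    (hG : ∀ i, (G i).tgt = L.src i) {K : Type} {x : K → C} {y : C}
    (e : Fin (∑ i, m i) → K) (h : ∀ i, x (e i) = (L.comp G hG).src i)
    (h' : (L.comp G hG).tgt = y) (h₁ : ∀ i j, x (e (finSigmaFinEquiv ⟨i, j⟩)) = (G i).src j) :
    (L.comp G hG).lab e h h' = 𝒯.post (𝒯.bind L.tm fun i =>
      (G i).lab (fun j => e (finSigmaFinEquiv ⟨i, j⟩)) (h₁ i) (hG i)) (eqToHom h') := by
  unfold lab
  rw [bind_map]
  simp only [post_map, TermCalc.map_map]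

theorem Lin.supp_lab {k : ℕ} (L : 𝒯.Lin k) {K : Type} {x : K → C} {y : C} (e : Fin k → K)
    (h : ∀ i, x (e i) = L.src i) (h' : L.tgt = y) :
    𝒯.supp (L.lab e h h') = (Finset.univ.val : Multiset (Fin k)).map e := by
  rw [lab, 𝒯.supp_post, TermCalc.supp_map, L.lin]

theorem Lin.lab_bind {k : ℕ} (L : 𝒯.Lin k) {K K' : Type} {x : K → C} {z : K' → C} {y : C}
    (e : Fin k → K) (h : ∀ i, x (e i) = L.src i) (h' : L.tgt = y) (s : ∀ k, 𝒯.Tm z (x k)) :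
    𝒯.bind (L.lab e h h') s =
      𝒯.post (𝒯.bind L.tm fun i => 𝒯.post (s (e i)) (eqToHom (h i))) (eqToHom h') := by
  rw [lab, 𝒯.post_bind, map_bind]

end TermCalc

namespace SymMulticat

open TermCalc

variable {C : Type u'} [Category.{v'} C] {𝒯 : TermCalc.{u', v', w'} C}

section

variable {Q : SymMulticat.{u, v, w}} (φ : Q.Mor 𝒯.toSymMulticat)

/-- The linear term `φ f`. -/
abbrev Mor.lin {k : ℕ} (f : Q.Arr k) : 𝒯.Lin k := φ.map f

/-- The functor on objects. -/
abbrev Mor.obF : Q.Obj ⥤ C := φ.F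

/-- The value on an arrow with labelled inputs. -/
abbrev Mor.onLArr {K : Type} {x : K → Q.Obj} {y : Q.Obj} (F : Q.LArr x y) :
    𝒯.Tm (fun k => φ.obF.obj (x k)) (φ.obF.obj y) :=
  (φ.lin F.arr).lab F.lbl (fun i => ((φ.src_map F.arr i).trans (congrArg φ.F.obj (F.src_eq i))).symm)
    ((φ.tgt_map F.arr).trans (congrArg φ.F.obj F.tgt_eq))

theorem Mor.onLArr_rel {K : Type} {x : K → Q.Obj} {y : Q.Obj} {F F' : Q.LArr x y}
    (h : F ≈ F') : φ.onLArr F = φ.onLArr F' := by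
  obtain ⟨σ, h₁, h₂⟩ := h
  exact ((Lin.lab_congr ((congrArg φ.lin h₁).trans (φ.map_act F.arr σ)) h₂ _ _
    (fun i => ((φ.src_map F.arr _).trans (congrArg φ.F.obj (F.src_eq _))).symm)
    ((φ.tgt_map F.arr).trans (congrArg φ.F.obj F.tgt_eq))).trans
    (Lin.lab_act _ σ F.lbl _ _ _ _)).symm

theorem Mor.onLArr_bind {K K' : Type} {x : K → Q.Obj} {z : K' → Q.Obj} {y : Q.Obj}
    (F : Q.LArr x y) (G : ∀ k, Q.LArr z (x k)) :
    φ.onLArr (F.bind G) = 𝒯.bind (φ.onLArr F) fun k => φ.onLArr (G k) := by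
  have h : ∀ i, (φ.lin (G (F.lbl i)).arr).tgt = (φ.lin F.arr).src i := fun i =>
    (φ.tgt_map _).trans ((congrArg φ.F.obj ((G (F.lbl i)).tgt_eq.trans
      (F.src_eq i).symm)).trans (φ.src_map _ _).symm)
  have h₀ : ∀ i j, φ.obF.obj (z ((G (F.lbl i)).lbl j)) = (φ.lin (G (F.lbl i)).arr).src j :=
    fun i j => (congrArg φ.F.obj ((G (F.lbl i)).src_eq j)).symm.trans (φ.src_map _ _).symm
  have h₁ : ∀ i j, φ.obF.obj (z ((F.bind G).lbl (finSigmaFinEquiv ⟨i, j⟩))) =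
      (φ.lin (G (F.lbl i)).arr).src j := by
    intro i j
    exact (congrArg (fun s : Σ i, Fin (G (F.lbl i)).ar => φ.obF.obj
      (z ((G (F.lbl s.1)).lbl s.2))) (finSigmaFinEquiv.symm_apply_apply ⟨i, j⟩)).trans (h₀ i j)
  have h₂ : ∀ q, φ.obF.obj (z ((F.bind G).lbl q)) =
      ((φ.lin F.arr).comp (fun i => φ.lin (G (F.lbl i)).arr) h).src q := by
    intro q
    obtain ⟨⟨i, j⟩, rfl⟩ := finSigmaFinEquiv.surjective q
    exact (h₁ i j).trans
      (Lin.src_congr (fun i => φ.lin (G (F.lbl i)).arr)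
        (finSigmaFinEquiv.symm_apply_apply ⟨i, j⟩)).symm
  have h₃ : (φ.lin F.arr).tgt = φ.obF.obj y :=
    (φ.tgt_map F.arr).trans (congrArg φ.F.obj F.tgt_eq)
  refine (Lin.lab_congr (L' := (φ.lin F.arr).comp (fun i => φ.lin (G (F.lbl i)).arr) h)
    (x := fun k => φ.obF.obj (z k)) (y := φ.obF.obj y)
    (φ.map_comp F.arr _ _ h) (fun _ => rfl) _ _ h₂ h₃).trans
    ((Lin.lab_comp (x := fun k => φ.obF.obj (z k)) (y := φ.obF.obj y) _ _ h (F.bind G).lbl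
      h₂ h₃ h₁).trans ?_)
  refine Eq.trans ?_ (Lin.lab_bind (x := fun k => φ.obF.obj (x k)) _ _ _ _ _).symm
  refine congrArg (fun t => 𝒯.post t _) (bind_congr _ fun i => ?_)
  refine Eq.trans ?_ (𝒯.post_post _ _ _).symm
  refine Eq.trans (congrArg (fun t => 𝒯.post t _) (map_congr (φ.lin _).tm _ fun j => ?_))
    (congrArg (𝒯.post _) (eqToHom_trans _ _).symm)
  exact congrArg (fun s : Σ i, Fin (G (F.lbl i)).ar => (G (F.lbl s.1)).lbl s.2)
    (finSigmaFinEquiv.symm_apply_apply ⟨i, j⟩)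

theorem Mor.onLArr_ofHom {K : Type} {x : K → Q.Obj} {y : Q.Obj} (k : K) (a : x k ⟶ y) :
    φ.onLArr (LArr.ofHom k a) = 𝒯.post (𝒯.var k) (φ.obF.map a) := by
  refine (Lin.lab_congr (L' := Lin.ι 𝒯 (φ.obF.map a)) (x := fun k => φ.obF.obj (x k))
    (φ.map_ι a) (fun _ => rfl) _ _ (fun _ => rfl) rfl).trans
    ((Lin.lab_ι _ _ _ _).trans ?_)
  simp only [eqToHom_refl, Category.id_comp, Category.comp_id]

theorem Mor.supp_onLArr {K : Type} {x : K → Q.Obj} {y : Q.Obj} (F : Q.LArr x y) :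
    𝒯.supp (φ.onLArr F) = F.supp := Lin.supp_lab _ _ _ _

/-- The morphism of term calculi given by a morphism of symmetric multicategories. -/
noncomputable def Mor.toMap : Map Q.terms 𝒯 where
  F := φ.obF
  map t := Quotient.lift φ.onLArr (fun _ _ h => φ.onLArr_rel h) t
  map_var k := by
    refine (φ.onLArr_ofHom k _).trans ?_
    rw [φ.obF.map_id, 𝒯.post_id]
  map_bind t s := by
    induction t using Quotient.inductionOn with | _ F
    refine (φ.onLArr_bind F _).trans (bind_congr _ fun k => ?_)
    conv_rhs => rw [← Quotient.out_eq (s k)]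
    rfl
  map_post t a := by
    induction t using Quotient.inductionOn with | _ F
    refine (φ.onLArr_bind (LArr.ofHom (x := fun _ : Unit => _) () a) _).trans ?_
    rw [φ.onLArr_ofHom, 𝒯.post_bind, 𝒯.var_bind]
    rfl
  supp_map t := by
    induction t using Quotient.inductionOn with | _ F
    exact φ.supp_onLArr F

end

end SymMulticat

/-! ## Functoriality of slicing -/

/-- The image of a shape under a functor. -/
abbrev Shape.map {C : Type u} [Category.{v} C] {C' : Type u'} [Category.{v'} C'] (F : C ⥤ C')
    (s : Shape C) : Shape C' := ⟨s.ar, fun i => F.obj (s.src i), F.obj s.tgt⟩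

namespace PTree

variable {C : Type u} [Category.{v} C] {C' : Type u'} [Category.{v'} C'] (F : C ⥤ C')
  {N N' L L' : Type} {f : N → Shape C} {f' : N' → Shape C} {x : L → C} {x' : L' → C}

/-- Apply a functor to the labels of the edges. -/
def fmap {y : C} : PTree f x y →
    PTree (fun i => (f i).map F) (fun l => F.obj (x l)) (F.obj y)
  | leaf l a => leaf l (F.map a)
  | node i a ch => node i (F.map a) fun p => (ch p).fmap

theorem fmap_post {y y' : C} (t : PTree f x y) (a : y ⟶ y') :
    (t.post a).fmap F = (t.fmap F).post (F.map a) := by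
  cases t <;> simp [fmap]

theorem fmap_bind {y : C} (t : PTree f x y) (s : ∀ l, PTree f x' (x l)) :
    (t.bind s).fmap F = (t.fmap F).bind fun l => (s l).fmap F := by
  induction t with
  | leaf l a => simp [bind, fmap, fmap_post]
  | node i a ch ih => simp [bind, fmap, ih]

theorem fmap_subst {y : C} (t : PTree f x y) (s : ∀ i, PTree f' (f i).src (f i).tgt) :
    (t.subst s).fmap F = (t.fmap F).subst fun i => (s i).fmap F := by
  induction t with
  | leaf l a => simp [subst, fmap]
  | node i a ch ih => simp [subst, fmap, fmap_post, fmap_bind, ih]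

theorem fmap_corolla (i : N) : (corolla (f := f) i).fmap F = corolla i := by
  simp [corolla, fmap]

theorem nodes_fmap {y : C} (t : PTree f x y) : (t.fmap F).nodes = t.nodes := by
  induction t with
  | leaf l a => rfl
  | node i a ch ih => simp [nodes, fmap, ih]

theorem eval_fmap {𝒯 : TermCalc.{u, v, w} C} {𝒯' : TermCalc.{u', v', w'} C'}
    (Φ : TermCalc.Map 𝒯 𝒯') (g : ∀ i, 𝒯.Tm (f i).src (f i).tgt) {y : C} (t : PTree f x y) :
    (t.fmap Φ.F).eval 𝒯' (fun i => Φ.map (g i)) = Φ.map (t.eval 𝒯 g) := by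
  induction t with
  | leaf l a => simp [eval, fmap, Φ.map_post, Φ.map_var]
  | node i a ch ih => simp [eval, fmap, Φ.map_post, Φ.map_bind, ih]

end PTree

namespace TermCalc

variable {C : Type u} [Category.{v} C] {C' : Type u'} [Category.{v'} C']
  {𝒯 : TermCalc.{u, v, w} C} {𝒯' : TermCalc.{u', v', w'} C'}

/-- The induced functor on elements. -/
abbrev Map.elt (Φ : Map 𝒯 𝒯') : 𝒯.Elt ⥤ 𝒯'.Elt where
  obj a := ⟨a.shape.map Φ.F, Φ.map a.tm, (Φ.supp_map _).trans a.lin⟩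
  map α :=
    { σ := α.σ
      pre := fun i => Φ.F.map (α.pre i)
      post := Φ.F.map α.post
      eq := by
        refine Eq.trans ?_ (congrArg Φ.map α.eq)
        simp only [Φ.map_post, Φ.map_bind, Φ.map_var] }
  map_id a := Elt.Hom.ext rfl (heq_of_eq (funext fun i => Φ.F.map_id _)) (Φ.F.map_id _)
  map_comp α β := Elt.Hom.ext rfl (heq_of_eq (funext fun i => Φ.F.map_comp _ _))
    (Φ.F.map_comp _ _)

theorem _root_.PTree.fmap_conj {N : Type} {f : N → Shape C} (Φ : Map 𝒯 𝒯') {a b : 𝒯.Elt}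
    (t : PTree f a.shape.src a.shape.tgt) (α : a ⟶ b) :
    (t.conj α).fmap Φ.F = PTree.conj (a := Φ.elt.obj a) (t.fmap Φ.F) (Φ.elt.map α) := by
  simp only [PTree.conj, PTree.fmap_post, PTree.fmap_bind]
  rfl

section

universe u₁ v₁ u₂ v₂

variable {G : Type u₁} [Category.{v₁} G] {G' : Type u₂} [Category.{v₂} G'] {E : G ⥤ 𝒯.Elt} {E' : G' ⥤ 𝒯'.Elt}

variable (Φ : Map 𝒯 𝒯') (H : G ⥤ G') (θ : H ⋙ E' ≅ E ⋙ Φ.elt)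

/-- The tree with one node, standing for `E' (H g)`, transported along `θ g` to a tree with
composite `Φ (E g)`. -/
def Map.sliceNode {K : Type} (f : K → G) (k : K) :
    PTree (fun k => (E'.obj (H.obj (f k))).shape) (Φ.elt.obj (E.obj (f k))).shape.src
      (Φ.elt.obj (E.obj (f k))).shape.tgt :=
  PTree.conj (a := E'.obj (H.obj (f k))) (b := Φ.elt.obj (E.obj (f k)))
    (PTree.corolla k) (θ.hom.app (f k))

theorem Map.eval_sliceNode {K : Type} (f : K → G) (k : K) :
    (Map.sliceNode Φ H θ f k).eval 𝒯' (fun k => (E'.obj (H.obj (f k))).tm) =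
      Φ.map (E.obj (f k)).tm :=
  PTree.eval_conj (f := fun k => (E'.obj (H.obj (f k))).shape)
    (g := fun k => (E'.obj (H.obj (f k))).tm) (a := E'.obj (H.obj (f k)))
    (b := Φ.elt.obj (E.obj (f k))) (PTree.corolla k) (θ.hom.app (f k)) (PTree.eval_corolla _)

/-- Replace each node of a tree, standing for `Φ (E (f k))`, by the one standing for
`E' (H (f k))`, and transport the result, a tree with composite `Φ (E g)`, along `θ⁻¹`. -/
def Map.sliceTree {K : Type} {f : K → G} {g : G}
    (t : PTree (fun k => (Φ.elt.obj (E.obj (f k))).shape) (Φ.elt.obj (E.obj g)).shape.src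
      (Φ.elt.obj (E.obj g)).shape.tgt) :
    PTree (fun k => (E'.obj (H.obj (f k))).shape) (E'.obj (H.obj g)).shape.src
      (E'.obj (H.obj g)).shape.tgt :=
  PTree.conj (a := Φ.elt.obj (E.obj g)) (b := E'.obj (H.obj g))
    (t.subst (Map.sliceNode Φ H θ f)) (θ.inv.app g)

/-- A morphism `Φ` of term calculi, a functor `H` and isomorphisms `θ g : E' (H g) ≅ Φ (E g)`
take a tree to a tree: apply `Φ` to the labels of the edges, replace the nodes by those standing
for `E' (H (f k))`, with their inputs permuted and the labels of the adjacent edges composed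
according to `θ`, and do the same at the leaves and at the root. -/
def Map.slice : Map (TermCalc.slice E) (TermCalc.slice E') where
  F := H
  map {K f g} t := ⟨Map.sliceTree Φ H θ (t.1.fmap Φ.F), by
    refine PTree.eval_conj (a := Φ.elt.obj (E.obj g)) (b := E'.obj (H.obj g)) _ _
      ((PTree.eval_subst (g := fun k => Φ.map (E.obj (f k)).tm) _ _
        (Map.eval_sliceNode Φ H θ f)).trans ?_)
    exact (PTree.eval_fmap Φ _ t.1).trans (congrArg Φ.map t.2)⟩
  map_var {K f} k := Subtype.ext <| by
    change Map.sliceTree Φ H θ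
      ((PTree.corolla (f := fun k => (E.obj (f k)).shape) k).fmap Φ.F) =
      PTree.corolla (f := fun k => (E'.obj (H.obj (f k))).shape) k
    rw [PTree.fmap_corolla]
    refine (congrArg (fun t => PTree.conj (a := Φ.elt.obj (E.obj (f k)))
      (b := E'.obj (H.obj (f k))) t _) (PTree.corolla_subst k _)).trans ?_
    refine (PTree.conj_comp _ _ _).symm.trans ?_
    rw [Iso.hom_inv_id_app]
    exact PTree.conj_id _
  map_bind {K K' f f' g} t s := Subtype.ext <| by
    change Map.sliceTree Φ H θ ((t.1.subst fun k => (s k).1).fmap Φ.F) =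
      PTree.subst (Map.sliceTree Φ H θ (t.1.fmap Φ.F))
        fun k => Map.sliceTree Φ H θ ((s k).1.fmap Φ.F)
    rw [PTree.fmap_subst]
    refine Eq.trans ?_ (PTree.conj_subst (a := Φ.elt.obj (E.obj g)) (b := E'.obj (H.obj g))
      _ _ _).symm
    refine congrArg (fun t => PTree.conj (a := Φ.elt.obj (E.obj g)) (b := E'.obj (H.obj g)) t
      (θ.inv.app g)) ?_
    refine (PTree.subst_subst _ _ _).trans ((PTree.subst_subst _ _ _).trans ?_).symm
    refine congrArg _ (funext fun k => ?_)
    refine (PTree.conj_subst (a := E'.obj (H.obj (f k))) (b := Φ.elt.obj (E.obj (f k)))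
      _ _ _).trans ?_
    refine (congrArg (fun t => PTree.conj (a := E'.obj (H.obj (f k)))
      (b := Φ.elt.obj (E.obj (f k))) t _) (PTree.corolla_subst k _)).trans ?_
    refine (PTree.conj_comp _ _ _).symm.trans ?_
    rw [Iso.inv_hom_id_app]
    exact PTree.conj_id _
  map_post {K f g g'} t α := Subtype.ext <| by
    change Map.sliceTree Φ H θ ((t.1.conj (E.map α)).fmap Φ.F) =
      PTree.conj (Map.sliceTree Φ H θ (t.1.fmap Φ.F)) (E'.map (H.map α))
    rw [PTree.fmap_conj]
    refine (congrArg (fun t => PTree.conj (a := Φ.elt.obj (E.obj g'))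
      (b := E'.obj (H.obj g')) t _) (PTree.conj_subst (a := Φ.elt.obj (E.obj g))
      (b := Φ.elt.obj (E.obj g')) _ _ _)).trans ?_
    refine (PTree.conj_comp _ _ _).symm.trans (Eq.trans ?_ (PTree.conj_comp _ _ _))
    exact congrArg (PTree.conj _) (θ.inv.naturality α)
  supp_map {K f g} t := by
    refine (PTree.nodes_conj (fun k => (E'.obj (H.obj (f k))).lin) _ _).trans ?_
    refine (PTree.nodes_subst (𝒯 := 𝒯') (t.1.fmap Φ.F) _ (Map.eval_sliceNode Φ H θ f)
      (fun k => (Φ.elt.obj (E.obj (f k))).lin) (fun k => (E'.obj (H.obj (f k))).lin)).trans ?_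
    rw [PTree.nodes_fmap]
    refine Eq.trans (Multiset.bind_congr fun k _ => ?_)
      ((Multiset.bind_singleton _ fun k => k).trans (Multiset.map_id' _))
    refine (PTree.nodes_conj (fun k => (E'.obj (H.obj (f k))).lin) _ _).trans ?_
    simp [PTree.corolla, PTree.nodes]

end

/-- The morphism of symmetric multicategories given by a morphism of term calculi. -/
def Map.toMor (Φ : Map 𝒯 𝒯') : 𝒯.toSymMulticat.Mor 𝒯'.toSymMulticat where
  F := Φ.F
  map := Φ.onLin
  src_map _ _ := rfl
  tgt_map _ := rfl
  map_ι := Φ.onLin_ι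
  map_comp L G h _ := Φ.onLin_comp L G h
  map_act := Φ.onLin_act

end TermCalc

namespace GenMulticat

namespace LArr

variable {M : GenMulticat.{u, w}} {K K' L : Type} {x : K → M.Obj} {z : K' → M.Obj}
  {r : L → M.Obj} {y y' : M.Obj}

theorem map_bind (F : M.LArr x y) (e : K → K') (h : ∀ k, z (e k) = x k)
    (G : ∀ k, M.LArr r (z k)) :
    (F.map e h).bind G = F.bind fun k => (G (e k)).castTgt (h k) := by
  obtain rfl : x = fun k => z (e k) := funext fun k => (h k).symm
  have h := (red_sub (F.map (z := Sum.elim (fun k => z (e k)) r) Sum.inl (Sum.elim_inl _ _))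
    (fun k => G (e k))).lift (p := Step G)
    (fun F => F.map (z := Sum.elim z r) (Sum.map e fun k => k)
      fun k => by cases k <;> rfl) fun a b ⟨p, k, hk, hb⟩ => ⟨p, e k, by
        simp [map, hk], by rw [hb]; exact subAt_map _ _ _ _ _ _⟩
  exact sub_eq_of_red h

theorem bind_castTgt_var (F : M.LArr x y) (e : K → K') (h : ∀ k, z (e k) = x k) :
    (F.bind fun k => (var z (e k)).castTgt (h k)) = F.map e h := by
  rw [← map_bind, bind_var]

/-- The labelling of the inputs is a bijection if each label is used exactly once. -/
noncomputable def lblEquiv [Fintype K] (F : M.LArr x y) (h : F.supp = Finset.univ.val) :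
    Fin (M.ar F.arr) ≃ K :=
  Equiv.ofBijective F.lbl ⟨fun i j hij => by
      have : (F.supp).Nodup := h ▸ Finset.nodup _
      exact Multiset.inj_on_of_nodup_map this i (Finset.mem_univ i) j (Finset.mem_univ j) hij,
    fun k => by
      have : k ∈ F.supp := h ▸ Finset.mem_univ k
      obtain ⟨i, -, hi⟩ := Multiset.mem_map.1 this
      exact ⟨i, hi⟩⟩

end LArr

section

variable {M : GenMulticat.{u, w}}

/-- The arrow underlying an element. -/
abbrev eltArr (a : M.terms.Elt) : M.Arr := LArr.arr a.tm

/-- The numbering of the inputs of an element. -/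
abbrev eltLbl (a : M.terms.Elt) : Fin (M.ar (eltArr a)) → Fin a.shape.ar := LArr.lbl a.tm

theorem elt_hom_tm {a b : M.terms.Elt} (α : a ⟶ b) :
    LArr.castTgt (LArr.map (z := fun i => (b.shape.src i).as) a.tm α.σ
      fun i => Discrete.eq_of_hom (α.pre i)) (Discrete.eq_of_hom α.post) = b.tm := by
  refine Eq.trans ?_ α.eq
  exact congrArg (fun F : M.LArr _ _ => F.castTgt _) (LArr.bind_castTgt_var _ _ _).symm

theorem elt_hom_arr {a b : M.terms.Elt} (α : a ⟶ b) : eltArr a = eltArr b :=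
  congrArg LArr.arr (elt_hom_tm α)

theorem elt_hom_lbl {a b : M.terms.Elt} (α : a ⟶ b) (i : Fin (M.ar (eltArr a)))
    (j : Fin (M.ar (eltArr b))) (h : (i : ℕ) = j) : α.σ (eltLbl a i) = eltLbl b j := by
  have key : ∀ F : M.LArr (fun i => (b.shape.src i).as) b.shape.tgt.as,
      LArr.castTgt (LArr.map (z := fun i => (b.shape.src i).as) a.tm α.σ
      fun i => Discrete.eq_of_hom (α.pre i)) (Discrete.eq_of_hom α.post) = F →
      ∀ j : Fin (M.ar F.arr), (i : ℕ) = j → α.σ (eltLbl a i) = F.lbl j := by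
    rintro _ rfl j hj
    obtain rfl : i = j := Fin.ext hj
    rfl
  exact key _ (elt_hom_tm α) j h

instance elt_hom_subsingleton (a b : M.terms.Elt) : Subsingleton (a ⟶ b) where
  allEq α β := by
    have hσ : α.σ = β.σ := by
      ext1 i
      obtain ⟨i, rfl⟩ := (LArr.lblEquiv a.tm a.lin).surjective i
      have hi : (i : ℕ) < M.ar (eltArr b) := by rw [← elt_hom_arr α]; exact i.2
      exact (elt_hom_lbl α i ⟨i, hi⟩ rfl).trans (elt_hom_lbl β i ⟨i, hi⟩ rfl).symm
    obtain ⟨σ, p, q, e⟩ := α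
    obtain ⟨σ', p', q', e'⟩ := β
    dsimp only at hσ
    subst hσ
    obtain rfl : p = p' := funext fun i => Subsingleton.elim _ _
    obtain rfl : q = q' := Subsingleton.elim _ _
    rfl

theorem src_congr {f f' : M.Arr} (h : f = f') (i : Fin (M.ar f)) :
    M.src f' (finCongr (congrArg M.ar h) i) = M.src f i := by
  subst h; rfl

/-- The bijection between the inputs of two elements with the same underlying arrow. -/
noncomputable def eltPerm {a b : M.terms.Elt} (h : eltArr a = eltArr b) :
    Fin a.shape.ar ≃ Fin b.shape.ar :=
  (LArr.lblEquiv a.tm a.lin).symm.trans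
    ((finCongr (congrArg M.ar h)).trans (LArr.lblEquiv b.tm b.lin))

theorem eltPerm_lbl {a b : M.terms.Elt} (h : eltArr a = eltArr b) (i : Fin (M.ar (eltArr a))) :
    eltPerm h (eltLbl a i) = eltLbl b (finCongr (congrArg M.ar h) i) :=
  congrArg (fun i => eltLbl b (finCongr (congrArg M.ar h) i))
    ((LArr.lblEquiv a.tm a.lin).symm_apply_apply i)

theorem src_eltPerm {a b : M.terms.Elt} (h : eltArr a = eltArr b) (i : Fin a.shape.ar) :
    (b.shape.src (eltPerm h i)).as = (a.shape.src i).as := by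
  obtain ⟨i, rfl⟩ := (LArr.lblEquiv a.tm a.lin).surjective i
  refine (congrArg (fun i => (b.shape.src i).as) (eltPerm_lbl h i)).trans ?_
  refine (LArr.src_eq b.tm _).symm.trans ((src_congr h i).trans (LArr.src_eq a.tm i))

theorem tgt_eltArr {a b : M.terms.Elt} (h : eltArr a = eltArr b) :
    a.shape.tgt.as = b.shape.tgt.as :=
  (LArr.tgt_eq a.tm).symm.trans ((congrArg M.tgt h).trans (LArr.tgt_eq b.tm))

/-- The morphism between two elements with the same underlying arrow. -/
noncomputable def eltHom {a b : M.terms.Elt} (h : eltArr a = eltArr b) : a ⟶ b where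
  σ := eltPerm h
  pre i := Discrete.eqToHom (src_eltPerm h i)
  post := Discrete.eqToHom (tgt_eltArr h)
  eq := (congrArg (fun F : M.LArr _ _ => F.castTgt (tgt_eltArr h))
    (LArr.bind_castTgt_var a.tm (eltPerm h) (src_eltPerm h))).trans
    (LArr.ext' h fun i => ⟨finCongr (congrArg M.ar h) i, rfl, eltPerm_lbl h i⟩)

/-- Elements with the same underlying arrow are isomorphic. -/
noncomputable def eltIso {a b : M.terms.Elt} (h : eltArr a = eltArr b) : a ≅ b where
  hom := eltHom h
  inv := eltHom h.symm
  hom_inv_id := Subsingleton.elim _ _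
  inv_hom_id := Subsingleton.elim _ _

end

/-- An arrow of `M` as a term, its `i`-th input being labelled `i`. -/
noncomputable def toElt (M : GenMulticat.{u, w}) (a : M.Arr) : M.terms.Elt where
  shape := ⟨M.ar a, fun i => ⟨M.src a i⟩, ⟨M.tgt a⟩⟩
  tm := LArr.mk (x := fun i => M.src a i) a (fun i => i) (fun _ => rfl) rfl
  lin := by
    change Multiset.map (fun i => i) (Finset.univ.val : Multiset (Fin (M.ar a))) = _
    exact Multiset.map_id' _

/-- The functor regarding the arrows of `M` as terms. -/
noncomputable def elts (M : GenMulticat.{u, w}) : Discrete M.Arr ⥤ M.terms.Elt :=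
  Discrete.functor M.toElt

/-- The calculus of the trees of arrows of `M`: a term with inputs labelled by `K` and target
`g : M.Arr` is a planar tree whose nodes are labelled by elements `k : K`, the node with label `k`
standing for an arrow `f k` of `M`, and whose edges are labelled by (identities of) objects of
`M`, such that the composite of the tree in `M` is `g`, the leaves being labelled by the source
elements of `g` with which they are identified by the amalgamating maps. -/
noncomputable def trees (M : GenMulticat.{u, w}) : TermCalc.{w, w, u} (Discrete M.Arr) :=
  TermCalc.slice M.elts

/-- A choice, for each tree of arrows of `M`, of an order on its nodes. -/
abbrev NodeOrder (M : GenMulticat.{u, w}) : Type (max 1 u w) := M.trees.InputOrder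

theorem _root_.PTree.nodes_subst_corolla {C : Type u} [Category.{v} C] {N N' L : Type}
    {f : N' → Shape C} {x : L → C} {y : C} (e : N → N')
    (t : PTree (fun i => f (e i)) x y) :
    (t.subst fun i => PTree.corolla (f := f) (e i)).nodes = t.nodes.map e := by
  induction t with
  | leaf l a => simp [PTree.subst, PTree.nodes]
  | node i a ch ih =>
    simp only [PTree.subst, PTree.nodes_post]
    rw [PTree.corolla, PTree.bind, PTree.nodes, PTree.nodes, List.map_cons, List.map_flatMap]
    simp only [PTree.bind, PTree.post_id, ih]

/-- The choice of the depth first order on the nodes. -/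
noncomputable def planarOrder (M : GenMulticat.{u, w}) : M.NodeOrder where
  ord t := t.1.nodes
  coe_ord _ := rfl
  ord_map {K K' x z y} t e h := by
    obtain rfl : x = fun k => z (e k) := funext fun k => (h k).symm
    refine Eq.trans ?_ (PTree.nodes_subst_corolla
      (f := fun k => (M.elts.obj (z k)).shape) e t.1)
    refine congrArg (fun s => (PTree.subst t.1 s).nodes) (funext fun k => ?_)
    refine (congrArg (PTree.conj (a := M.elts.obj (z (e k))) (b := M.elts.obj (z (e k)))
      (PTree.corolla (f := fun k => (M.elts.obj (z k)).shape) (e k))) (M.elts.map_id _)).trans ?_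
    exact PTree.conj_id _

/-- The slice `M₊`: its objects are the arrows of `M` and its arrows are the trees of arrows of
`M`. The sources of a tree are the labels of its nodes in the chosen order, and the target is its
composite. Composition replaces a node by a tree. -/
noncomputable def slice (M : GenMulticat.{u, w}) (τ : M.NodeOrder) : GenMulticat.{w, max w u} :=
  τ.gen

end GenMulticat

/-! ## Comparison of the slices -/

namespace TermCalc.InputOrder

variable {A : Type u} {𝒮 : TermCalc.{u, u, w} (Discrete A)} {o : 𝒮.InputOrder} {K K' : Type}
  {x : K → A} {z : K' → A} {y y' : A}

/-- A linear term with its inputs in the chosen order, and with labelled inputs, as a term. -/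
def toTm (F : o.gen.LArr x y) : 𝒮.DTm x y :=
  cast (dmap (GArr.tm F.arr) F.lbl fun i => (F.src_eq i).symm) F.tgt_eq

theorem toTm_var (k : K) : toTm (GenMulticat.LArr.var (M := o.gen) x k) = dvar 𝒮 x k := by
  refine (cast_rfl (dmap (dvar 𝒮 (fun _ : Fin 1 => x k) 0) (fun _ => k) fun _ => rfl) rfl).trans ?_
  exact (dvar_dbind (x := fun _ : Fin 1 => x k) 0 _).trans (cast_rfl (dvar 𝒮 x k) rfl)

theorem toTm_castTgt (F : o.gen.LArr x y) (h : y = y') : toTm (F.castTgt h) = cast (toTm F) h :=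
  (cast_cast _ _ _).symm

theorem toTm_map (F : o.gen.LArr x y) (e : K → K') (h : ∀ k, z (e k) = x k) :
    toTm (F.map e h) = dmap (toTm F) e h := by
  refine Eq.trans ?_ (cast_dmap _ _ _ _).symm
  exact congrArg (fun t => cast t F.tgt_eq) (dmap_dmap F.arr.tm F.lbl (fun i => (F.src_eq i).symm) e h).symm

theorem supp_toTm (F : o.gen.LArr x y) : 𝒮.supp (toTm F) = F.supp :=
  (supp_cast _ _).trans ((supp_dmap _ _ _).trans (congrArg _ (GArr.lin F.arr)))

theorem toTm_dbind (F : o.gen.LArr x y) (s : ∀ k, 𝒮.DTm z (x k)) :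
    dbind (toTm F) s = cast (dbind (GArr.tm F.arr) fun i => cast (s (F.lbl i)) (F.src_eq i).symm)
      F.tgt_eq :=
  (cast_dbind _ _ _).trans (congrArg (fun t => cast t F.tgt_eq) (dmap_dbind _ _ _ _))

theorem cast_family_congr (s : ∀ k, 𝒮.DTm z (x k)) {k k' : K} (e : k = k') (h : x k = y)
    (h' : x k' = y) : cast (s k) h = cast (s k') h' := by
  subst e; rfl

theorem toTm_subAt (F : o.gen.LArr x y) (p : Fin (o.gen.ar F.arr)) (g : o.gen.LArr x y')
    (h : y' = x (F.lbl p)) (s : ∀ k, 𝒮.DTm z (x k))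
    (hs : dbind (toTm g) s = cast (s (F.lbl p)) h.symm) :
    dbind (toTm (F.subAt p g h)) s = dbind (toTm F) s := by
  refine (toTm_dbind (F.subAt p g h) s).trans (Eq.trans ?_ (toTm_dbind F s).symm)
  refine congrArg (fun t => cast t F.tgt_eq) ((comp_dbind _ _ _ _ _).trans
    (dbind_congr _ (pick_unique _ _ _ _ ?_ fun q => ?_)))
  · have h₁ := (toTm_dbind g s).symm.trans hs
    have h₂ := congrArg (fun t => cast t (h.trans (F.src_eq p).symm)) h₁
    replace h₂ := (cast_cast _ _ _).symm.trans (h₂.trans (cast_cast _ _ _))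
    refine Eq.trans ?_ h₂
    refine congrArg (fun t => cast t (g.tgt_eq.trans (h.trans (F.src_eq p).symm)))
      (dbind_congr _ fun r => ?_)
    exact (cast_cast _ _ _).trans
      (cast_family_congr s (GenMulticat.LArr.lbl_posR F p g h r) _ _)
  · refine (cast_cast _ _ _).trans ?_
    exact cast_family_congr s (GenMulticat.LArr.lbl_posL F p g h q) _ _

theorem toTm_bind (F : o.gen.LArr x y) (G : ∀ k, o.gen.LArr z (x k)) :
    toTm (F.bind G) = dbind (toTm F) fun k => toTm (G k) := by
  let S : ∀ k, 𝒮.DTm z (Sum.elim x z k) := fun k =>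
    Sum.rec (motive := fun k => 𝒮.DTm z (Sum.elim x z k)) (fun k => toTm (G k))
      (fun k => dvar 𝒮 z k) k
  have key : ∀ {y : A} (F : o.gen.LArr z y), dbind (toTm (F.map (z := Sum.elim x z) Sum.inr
      (Sum.elim_inr x z))) S = toTm F := by
    intro y F
    rw [toTm_map, dmap_dbind]
    refine Eq.trans (dbind_congr _ fun k => ?_) (dbind_dvar _)
    exact cast_rfl (dvar 𝒮 z k) rfl
  have key' : ∀ F : o.gen.LArr (Sum.elim x z) y, toTm (F.sub G) = dbind (toTm F) S := by
    intro F
    induction F using GenMulticat.LArr.sub_induction G with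
    | hn F => rw [GenMulticat.LArr.sub_map_inr, key]
    | hs F F' h ih =>
      rw [GenMulticat.LArr.sub_eq_of_step h, ih]
      obtain ⟨p, k, hk, rfl⟩ := h
      refine toTm_subAt F p _ _ S ((key (G k)).trans ?_)
      exact (cast_rfl (S (Sum.inl k)) rfl).symm.trans
        (cast_family_congr S hk.symm rfl (by rw [hk]))
  refine (key' _).trans ?_
  rw [toTm_map, dmap_dbind]
  exact dbind_congr _ fun k => cast_rfl (toTm (G k)) rfl

/-- The comparison of the terms over the generalised multicategory of linear terms with the
given terms. -/
def compare (o : 𝒮.InputOrder) : Map o.gen.terms 𝒮 where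
  F := 𝟭 (Discrete A)
  map t := toTm t
  map_var k := toTm_var k
  map_bind t s := toTm_bind t s
  map_post t a := (toTm_castTgt t (Discrete.eq_of_hom a)).trans (congrArg (𝒮.post _) (Subsingleton.elim _ _))
  supp_map t := supp_toTm t

theorem toTm_injective [Fintype K] {F F' : o.gen.LArr x y} (hF : F'.supp = Finset.univ.val)
    (h : toTm F = toTm F') : F = F' := by
  let e := F'.lblEquiv hF
  have he : ∀ k, F'.arr.src (e.symm k) = x k := fun k =>
    (F'.src_eq _).trans (congrArg x (e.apply_symm_apply k))
  have h₁ := congrArg (fun t => cast (dmap t e.symm he) F'.tgt_eq.symm) h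
  have h₂ : cast (dmap (toTm F') e.symm he) F'.tgt_eq.symm = F'.arr.tm := by
    refine (congrArg (fun t => cast t F'.tgt_eq.symm) (cast_dmap _ _ _ _)).trans
      ((cast_cast _ _ _).trans ((cast_rfl _ _).trans ?_))
    refine (dmap_dmap _ _ _ _ _).trans (dmap_id _ _ _ fun i => ?_)
    exact e.symm_apply_apply i
  have h₃ : cast (dmap (toTm F) e.symm he) F'.tgt_eq.symm =
      cast (dmap F.arr.tm (fun i => e.symm (F.lbl i)) fun i => (he _).trans (F.src_eq i).symm)
        (F.tgt_eq.trans F'.tgt_eq.symm) :=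
    (congrArg (fun t => cast t F'.tgt_eq.symm) (cast_dmap _ _ _ _)).trans
      ((cast_cast _ _ _).trans (congrArg (fun t => cast t _) (dmap_dmap _ _ _ _ _)))
  obtain ⟨h₄, h₅⟩ := GArr.ext' F.arr F'.arr (fun i => e.symm (F.lbl i)) _ _
    (h₃.symm.trans (h₁.trans h₂))
  exact GenMulticat.LArr.ext' h₄ fun i => ⟨e.symm (F.lbl i), (h₅ i).symm,
    (e.apply_symm_apply (F.lbl i)).symm⟩

/-- A linear term, with its inputs put in the chosen order and the numbers of the inputs as
labels. -/
noncomputable def ofTm (o : 𝒮.InputOrder) [Fintype K] (t : 𝒮.DTm x y) (h : IsLin t) :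
    o.gen.LArr x y where
  arr := o.norm t h
  lbl := o.num t h
  src_eq _ := rfl
  tgt_eq := rfl

theorem toTm_ofTm [Fintype K] (t : 𝒮.DTm x y) (h : IsLin t) : toTm (o.ofTm t h) = t :=
  (cast_rfl _ _).trans (norm_dmap t h)

/-- A linear term as an arrow of `ξ` of the generalised multicategory of linear terms. -/
noncomputable def ofLin (o : 𝒮.InputOrder) {k : ℕ} (L : 𝒮.Lin k) : o.gen.terms.Lin k where
  src := L.src
  tgt := L.tgt
  tm := o.ofTm (x := fun i => (L.src i).as) L.tm L.lin
  lin := (supp_toTm _).symm.trans ((congrArg 𝒮.supp (toTm_ofTm L.tm L.lin)).trans L.lin)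

theorem compare_ofLin {k : ℕ} (L : 𝒮.Lin k) : o.compare.onLin (o.ofLin L) = L := by
  refine Lin.mk_eq (fun _ => rfl) ((map_id _ _ (fun _ => rfl) _).trans ?_)
  exact toTm_ofTm L.tm L.lin

theorem compare_injective {k : ℕ} {L L' : o.gen.terms.Lin k}
    (h : o.compare.onLin L = o.compare.onLin L') : L = L' := by
  obtain ⟨s, t, F, l⟩ := L
  obtain ⟨s', t', F', l'⟩ := L'
  obtain rfl : s = s' := congrArg Lin.src h
  obtain rfl : t = t' := congrArg Lin.tgt h
  have h' : o.compare.map F = o.compare.map F' := by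
    simpa only [Lin.mk.injEq, true_and, heq_eq_eq] using h
  obtain rfl := toTm_injective l' h'
  rfl

theorem _root_.TermCalc.Lin.comp_congr {k : ℕ} {m : Fin k → ℕ} {L L' : 𝒮.Lin k}
    {G G' : ∀ i, 𝒮.Lin (m i)} (hL : L = L') (hG : ∀ i, G i = G' i)
    (h : ∀ i, (G i).tgt = L.src i) (h' : ∀ i, (G' i).tgt = L'.src i) :
    L.comp G h = L'.comp G' h' := by
  obtain rfl : G = G' := funext hG
  subst hL
  rfl

/-- A morphism into the symmetric multicategory of linear terms is one into `ξ` of the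
generalised multicategory of linear terms. -/
noncomputable def lift (o : 𝒮.InputOrder) {Q : SymMulticat.{u', v', w'}}
    (ψ : Q.Mor 𝒮.toSymMulticat) : Q.Mor o.gen.ξ where
  F := ψ.F
  map f := o.ofLin (ψ.map f)
  src_map f i := ψ.src_map f i
  tgt_map f := ψ.tgt_map f
  map_ι a := compare_injective <| by
    refine (compare_ofLin _).trans ((ψ.map_ι a).trans ?_)
    exact (o.compare.onLin_ι _).symm
  map_comp f g h h' := compare_injective <| by
    refine (compare_ofLin _).trans ((ψ.map_comp f g h h').trans ?_)
    refine Eq.trans ?_ (o.compare.onLin_comp (o.ofLin (ψ.map f))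
      (fun i => o.ofLin (ψ.map (g i))) h').symm
    exact Lin.comp_congr (G := fun i => ψ.map (g i))
      (G' := fun i => o.compare.onLin (o.ofLin (ψ.map (g i))))
      (compare_ofLin (o := o) (ψ.map f)).symm
      (fun i => (compare_ofLin (o := o) (ψ.map (g i))).symm) h' h'
  map_act f σ := compare_injective <| by
    refine (compare_ofLin _).trans ((ψ.map_act f σ).trans ?_)
    refine Eq.trans ?_ (o.compare.onLin_act _ _).symm
    exact (congrArg (fun L : 𝒮.Lin _ => L.act σ) (compare_ofLin (o := o) (ψ.map f))).symm

end TermCalc.InputOrder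

namespace SymMulticat

variable {Q : SymMulticat.{u, v, w}} {M : GenMulticat.{u', w'}}

/-- If `φ f = (g, σ)` then `φ.arr f = g`. -/
noncomputable def Mor.arr (φ : Q.Mor M.ξ) {k : ℕ} (f : Q.Arr k) : M.Arr :=
  GenMulticat.LArr.arr (TermCalc.Lin.tm (𝒯 := M.terms) (φ.map f))

theorem Mor.arr_toElt (φ : Q.Mor M.ξ) (f : Q.EltObj) :
    GenMulticat.eltArr ((Mor.toMap (𝒯 := M.terms) φ).elt.obj f.toElt) = φ.arr f.arr := by
  have h : ∀ {k : ℕ} (L : M.terms.Lin k) {K : Type} {x : K → Discrete M.Obj} {y : Discrete M.Obj}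
      (e : Fin k → K) (h : ∀ i, x (e i) = L.src i) (h' : L.tgt = y),
      GenMulticat.LArr.arr (L.lab e h h') = GenMulticat.LArr.arr L.tm := fun L K x y e h h' =>
    congrArg GenMulticat.LArr.arr (GenMulticat.LArr.bind_castTgt_var L.tm e fun i => congrArg Discrete.as (h i))
  exact h (y := φ.obF.obj (Q.tgt f.arr)) (φ.map f.arr) _ _ (φ.tgt_map f.arr)

/-- The functor `f ↦ g`, where `φ f = (g, σ)`, from the category of elements of `Q` to the
discrete category of arrows of `M`. -/
noncomputable def Mor.plusObj (φ : Q.Mor M.ξ) : Q.EltObj ⥤ Discrete M.Arr where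
  obj f := ⟨φ.arr f.arr⟩
  map {f f'} α := Discrete.eqToHom <| (φ.arr_toElt f).symm.trans <|
    (GenMulticat.elt_hom_arr ((Mor.toMap (𝒯 := M.terms) φ).elt.map ((EltObj.functor Q).map α))).trans
      (φ.arr_toElt f')
  map_id _ := Subsingleton.elim _ _
  map_comp _ _ := Subsingleton.elim _ _

/-- The twist: if `φ f = (g, σ)`, then the `p`-th input of `g` is the `σ p`-th one of `f`. -/
noncomputable def Mor.twist (φ : Q.Mor M.ξ) :
    φ.plusObj ⋙ M.elts ≅ EltObj.functor Q ⋙ (Mor.toMap (𝒯 := M.terms) φ).elt :=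
  NatIso.ofComponents (fun f => GenMulticat.eltIso (φ.arr_toElt f).symm) fun _ => Subsingleton.elim _ _

/-- The morphism `T ↦ T̄` on trees: replace the label `f` of a node by `g`, where `φ f = (g, σ)`,
twist the inputs of the node according to `σ`, make the edge labels identities, and comb. -/
noncomputable def Mor.bar (φ : Q.Mor M.ξ) :
    TermCalc.Map (TermCalc.slice (EltObj.functor Q)) M.trees :=
  TermCalc.Map.slice (Mor.toMap (𝒯 := M.terms) φ) φ.plusObj φ.twist

/-- The morphism `φ⁺ : Q⁺ ⟶ ξ(M₊)` induced by `φ : Q ⟶ ξ(M)`. -/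
noncomputable def Mor.plus (φ : Q.Mor M.ξ) (τ : M.NodeOrder) : Q.plus.Mor (M.slice τ).ξ :=
  τ.lift φ.bar.toMor

end SymMulticat

/-! ## Trees and slices along fully faithful functors -/

/-! ### Operations on trees that are bijective. -/

namespace PTree

variable {C : Type u} [Category.{v} C] {C' : Type u'} [Category.{v'} C'] (F : C ⥤ C')
  {N L : Type} {f : N → Shape C} {x : L → C}

/-! Both slices consist of trees whose node labels are used exactly once. On the side of `ξ(M₊)` the
nodes are moreover listed in the order chosen by `τ`, but this only fixes how an arrow is presented.
The heart of the matter is that `T ↦ T̄` is a bijection between the trees with given node labels and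
given composite.

This map is a composite of three operations: the functor underlying `φ` is applied to the edge
labels, every node is replaced by a one-node tree with permuted inputs, and the leaves and the root
are transported along an isomorphism of elements. The last two are invertible because an isomorphism
(`Mor.twist`) defines them. The first is bijective because the functor is full and faithful: the
objects at both ends of an edge are prescribed by the labels of nodes and leaves, so only morphisms
have to be lifted. This gives a bijection on trees before any condition on composites is imposed.
The composite of `T̄` is the image of the composite of `T`, transported along an isomorphism, so
injectivity of `φ` on arrows shows that `T` has the required composite as soon as `T̄` has it. This
is `Map.slice_isFF`; `Map.onHom_toMor_bijective` and `InputOrder.onHom_lift_bijective` carry it over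
to `φ⁺`.

The argument needs `φ` to be bijective on terms, that is, on arrows whose inputs carry arbitrary,
possibly repeated labels, taken modulo permutations. This is `Mor.IsEquivalence.toMap_isFF`. It
rests on the rigidity of `ξ(M)`: the inputs of an arrow of `M` are distinguished positions, so two
numberings of the same arrow differ by a permutation (`exists_act_of_lab_eq`).

On objects, `φ⁺` is the functor `f ↦ g`, where `φ f = (g, σ)`, with values in a discrete category.
Followed by the faithful functor `M.elts` it is isomorphic to the full and faithful functor that `φ`
induces on elements, hence it is itself full and faithful. It is essentially surjective because an
arrow of `M` with its inputs numbered by their positions is an arrow of `ξ(M)`, all of whose objects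
are images of objects of `Q` (`Mor.IsEquivalence.plusObj`). -/

theorem fmap_injective [F.Faithful] {y : C} :
    Function.Injective (fmap F : PTree f x y → _) := by
  intro t
  induction t with
  | leaf l a =>
    intro t' h
    cases t' with
    | leaf l' a' =>
      simp only [fmap, leaf.injEq] at h
      obtain ⟨rfl, h⟩ := h
      rw [F.map_injective (eq_of_heq h)]
    | node i' a' ch' => simp [fmap] at h
  | node i a ch ih =>
    intro t' h
    cases t' with
    | leaf l' a' => simp [fmap] at h
    | node i' a' ch' =>
      simp only [fmap, node.injEq] at h
      obtain ⟨rfl, h, h'⟩ := h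
      rw [F.map_injective (eq_of_heq h)]
      exact congrArg _ (funext fun p => ih p (congrFun (eq_of_heq h') p))

/-- Both ends of every edge are images under `F`: the object supplied from above comes from `f` or
`x`, the one required below from `f` or from the root. Every edge label is therefore a morphism
between images and lifts by fullness; no object has to be lifted. -/
theorem fmap_surjective [F.Full] {y : C} :
    Function.Surjective (fmap F : PTree f x y → _) := by
  -- The target is an index of the type of trees, and induction needs it to be a variable. It is
  -- therefore an arbitrary `y'` with an equation `y' = F.obj y`; for the subtree above the `p`-th
  -- input of a node `i`, the equation holds by `rfl` with `y = (f i).src p`.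
  have key : ∀ {y' : C'} (t' : PTree (fun i => (f i).map F) (fun l => F.obj (x l)) y') (y : C)
      (h : y' = F.obj y), ∃ t : PTree f x y, t.fmap F = h ▸ t' := by
    intro y' t'
    induction t' with
    | leaf l a =>
      rintro y rfl
      obtain ⟨b, rfl⟩ := F.map_surjective a
      exact ⟨leaf l b, rfl⟩
    | node i a ch ih =>
      rintro y rfl
      obtain ⟨b, rfl⟩ := F.map_surjective (X := (f i).tgt) a
      choose c hc using fun p => ih p ((f i).src p) rfl
      exact ⟨node i b c, congrArg _ (funext hc)⟩
  exact fun t' => key t' y rfl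

variable {𝒯 : TermCalc.{u, v, w} C} {a b : 𝒯.Elt}

/-- Transport is functorial in the morphism of elements (`conj_comp`, `conj_id`), so an isomorphism
acts invertibly. -/
theorem conj_bijective (α : a ≅ b) :
    Function.Bijective fun t : PTree f a.shape.src a.shape.tgt => t.conj α.hom :=
  Function.bijective_iff_has_inverse.2 ⟨fun t => t.conj α.inv,
    fun t => by dsimp only; rw [← conj_comp, α.hom_inv_id, conj_id],
    fun t => by dsimp only; rw [← conj_comp, α.inv_hom_id, conj_id]⟩

/-- Substitution for nodes is associative and has the corollas as units. Families that are inverse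
to each other node by node therefore act inversely on all trees, whatever their leaves. -/
theorem subst_bijective {f' : N → Shape C} {y : C} (s : ∀ i, PTree f' (f i).src (f i).tgt)
    (r : ∀ i, PTree f (f' i).src (f' i).tgt) (hs : ∀ i, (s i).subst r = corolla i)
    (hr : ∀ i, (r i).subst s = corolla i) :
    Function.Bijective fun t : PTree f x y => t.subst s :=
  Function.bijective_iff_has_inverse.2 ⟨fun t => t.subst r,
    fun t => by
      dsimp only; rw [subst_subst]; exact (congrArg _ (funext hs)).trans (subst_corolla t),
    fun t => by
      dsimp only; rw [subst_subst]; exact (congrArg _ (funext hr)).trans (subst_corolla t)⟩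

end PTree

/-! ### Morphisms of term calculi that are bijective on terms, and their slices. -/

namespace TermCalc

variable {C : Type u} [Category.{v} C] {C' : Type u'} [Category.{v'} C']
  {𝒯 : TermCalc.{u, v, w} C} {𝒯' : TermCalc.{u', v', w'} C'}

/-- A morphism of term calculi is full and faithful if it is bijective on terms. -/
def Map.IsFF (Φ : Map 𝒯 𝒯') : Prop :=
  ∀ {K : Type} (x : K → C) (y : C), Function.Bijective (Φ.map : 𝒯.Tm x y → _)

theorem Map.elt_faithful (Φ : Map 𝒯 𝒯') [Φ.F.Faithful] : Φ.elt.Faithful where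
  map_injective {a b} α β h := by
    obtain ⟨σ, p, q, e⟩ := α
    obtain ⟨σ', p', q', e'⟩ := β
    obtain rfl : σ = σ' := congrArg Elt.Hom.σ h
    obtain rfl : q = q' := Φ.F.map_injective (congrArg Elt.Hom.post h)
    obtain rfl : p = p' := by
      injection h with _ h
      exact funext fun i => Φ.F.map_injective (congrFun h i)
    rfl

/-- A morphism of elements is a permutation with object-morphisms, subject to one equation between
terms. Fullness of `Φ.F` lifts the data, and injectivity of `Φ` on terms reflects the equation. -/
theorem Map.elt_full (Φ : Map 𝒯 𝒯') [Φ.F.Full] (hΦ : Φ.IsFF) : Φ.elt.Full where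
  map_surjective {a b} α := by
    obtain ⟨σ, p, q, e⟩ := α
    choose p' hp using fun i => Φ.F.map_surjective (X := b.shape.src (σ i)) (p i)
    obtain rfl : (fun i => Φ.F.map (p' i)) = p := funext hp
    obtain ⟨q, rfl⟩ := Φ.F.map_surjective (X := a.shape.tgt) (Y := b.shape.tgt) q
    -- The image under `Φ` of the equation to be proved is the equation `e` of the given morphism.
    refine ⟨⟨σ, p', q, (hΦ _ _).1 (Eq.trans ?_ e)⟩, rfl⟩
    simp only [Φ.map_post, Φ.map_bind, Φ.map_var]

section

universe u₁ v₁ u₂ v₂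

variable {G : Type u₁} [Category.{v₁} G] {G' : Type u₂} [Category.{v₂} G'] {E : G ⥤ 𝒯.Elt}
  {E' : G' ⥤ 𝒯'.Elt} (Φ : Map 𝒯 𝒯') (H : G ⥤ G') (θ : H ⋙ E' ≅ E ⋙ Φ.elt)

/-- The node inserted for `f k` is a corolla transported along `θ.hom`; the inverse family consists
of the corollas transported along `θ.inv`. Substituting one into the other amounts to transporting a
corolla along `θ.hom ≫ θ.inv` or `θ.inv ≫ θ.hom`, that is, along an identity. -/
theorem Map.subst_sliceNode_bijective {K L : Type} (f : K → G) (x : L → C') (y : C') :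
    Function.Bijective fun t : PTree (fun k => (Φ.elt.obj (E.obj (f k))).shape) x y =>
      t.subst (Map.sliceNode Φ H θ f) := by
  refine PTree.subst_bijective (Map.sliceNode Φ H θ f)
    (fun k => PTree.conj (f := fun k => (Φ.elt.obj (E.obj (f k))).shape)
      (a := Φ.elt.obj (E.obj (f k))) (b := E'.obj (H.obj (f k)))
      (PTree.corolla k) (θ.inv.app (f k))) (fun k => ?_) fun k => ?_
  · refine (PTree.conj_subst (a := E'.obj (H.obj (f k))) (b := Φ.elt.obj (E.obj (f k)))
      _ _ _).trans ((congrArg (fun t => PTree.conj (a := E'.obj (H.obj (f k)))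
      (b := Φ.elt.obj (E.obj (f k))) t _) (PTree.corolla_subst k _)).trans ?_)
    refine (PTree.conj_comp _ _ _).symm.trans ?_
    rw [Iso.inv_hom_id_app]
    exact PTree.conj_id _
  · refine (PTree.conj_subst (a := Φ.elt.obj (E.obj (f k))) (b := E'.obj (H.obj (f k)))
      _ _ _).trans ((congrArg (fun t => PTree.conj (a := Φ.elt.obj (E.obj (f k)))
      (b := E'.obj (H.obj (f k))) t _) (PTree.corolla_subst k _)).trans ?_)
    refine (PTree.conj_comp _ _ _).symm.trans ?_
    rw [Iso.hom_inv_id_app]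
    exact PTree.conj_id _

/-- The edge labels already lie in `C'` here, so invertibility of `θ` is all that matters: at the
nodes through the substitution, at the leaves and the root through `θ.inv.app g`. -/
theorem Map.sliceTree_bijective {K : Type} (f : K → G) (g : G) :
    Function.Bijective (Map.sliceTree Φ H θ (f := f) (g := g)) :=
  (PTree.conj_bijective (θ.symm.app g)).comp (Map.subst_sliceNode_bijective Φ H θ f _ _)

/-- This holds for every tree `t`, whether or not its composite is `E g`. That generality is what
allows the condition on composites to be reflected in `Map.slice_isFF`: the composite of the new
tree is `Φ` of the old one, transported along `θ.inv.app g`. -/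
theorem Map.eval_sliceTree {K : Type} {f : K → G} {g : G}
    (t : PTree (fun k => (E.obj (f k)).shape) (E.obj g).shape.src (E.obj g).shape.tgt) :
    (Map.sliceTree Φ H θ (t.fmap Φ.F)).eval 𝒯' (fun k => (E'.obj (H.obj (f k))).tm) =
      𝒯'.post (𝒯'.bind (Φ.map (t.eval 𝒯 fun k => (E.obj (f k)).tm)) fun i =>
        𝒯'.post (𝒯'.var ((θ.inv.app g).σ i)) ((θ.inv.app g).pre i)) (θ.inv.app g).post := by
  refine (PTree.eval_post _ _).trans (congrArg (fun t => 𝒯'.post t _)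
    ((PTree.eval_bind _ _).trans ?_))
  exact congrArg (fun t => 𝒯'.bind t _)
    ((PTree.eval_subst (g := fun k => Φ.map (E.obj (f k)).tm) _ _
      (Map.eval_sliceNode Φ H θ f)).trans (PTree.eval_fmap Φ _ t))

/-- Composing with an isomorphism of elements is injective on terms. -/
theorem Elt.conj_injective {a b : 𝒯.Elt} (α : a ≅ b) : Function.Injective
    fun t : 𝒯.Tm a.shape.src a.shape.tgt => 𝒯.post
      (𝒯.bind t fun i => 𝒯.post (𝒯.var (α.hom.σ i)) (α.hom.pre i)) α.hom.post := by
  -- Transport along an identity does nothing. It is stated for a variable `β` equal to the identity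
  -- so that it applies to `α.hom ≫ α.inv`.
  have key : ∀ β : a ⟶ a, β = 𝟙 a → ∀ t : 𝒯.Tm a.shape.src a.shape.tgt, 𝒯.post
      (𝒯.bind t fun i => 𝒯.post (𝒯.var (β.σ i)) (β.pre i)) β.post = t := by
    rintro _ rfl t
    refine (𝒯.post_id _).trans (Eq.trans ?_ (𝒯.bind_var t))
    exact bind_congr _ fun i => 𝒯.post_id _
  refine Function.LeftInverse.injective (g := fun t => 𝒯.post
      (𝒯.bind t fun i => 𝒯.post (𝒯.var (α.inv.σ i)) (α.inv.pre i)) α.inv.post) fun t => ?_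
  refine Eq.trans ?_ (key _ α.hom_inv_id t)
  -- Two successive transports merge into one, whose permutation and object-morphisms are by
  -- definition those of the composite of the two morphisms.
  simp only [𝒯.post_bind, 𝒯.bind_bind, 𝒯.post_post, 𝒯.var_bind]
  rfl

/-- On trees without a condition on the composite the map is bijective, since `Φ.F` is bijective on
edge labels and `θ` is invertible. The condition on composites is preserved by construction, and it
is reflected because transport along an isomorphism and `Φ` itself are injective on terms. -/
theorem Map.slice_isFF [Φ.F.Full] [Φ.F.Faithful] (hΦ : Φ.IsFF) : (Map.slice Φ H θ).IsFF := by
  intro K f g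
  have hb : Function.Bijective fun t : PTree (fun k => (E.obj (f k)).shape)
      (E.obj g).shape.src (E.obj g).shape.tgt => Map.sliceTree Φ H θ (t.fmap Φ.F) :=
    (Map.sliceTree_bijective Φ H θ f g).comp ⟨PTree.fmap_injective Φ.F, PTree.fmap_surjective Φ.F⟩
  refine ⟨fun t t' h => Subtype.ext (hb.1 (congrArg Subtype.val h)), fun t' => ?_⟩
  obtain ⟨t, ht⟩ := hb.2 t'.1
  -- The preimage `t` of the underlying tree is an admissible term only if its composite is `E g`.
  -- By the two injectivities this may be checked after applying `Φ` and transporting along `θ⁻¹`.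
  refine ⟨⟨t, (hΦ _ _).1 (Elt.conj_injective (θ.symm.app g) ?_)⟩, Subtype.ext ht⟩
  refine (Map.eval_sliceTree Φ H θ t).symm.trans ?_
  -- The transported composite of `t` is that of `t'`, namely `E' (H g)`, and the defining equation
  -- of the morphism `θ.inv.app g` says that `Φ (E g)` is transported to the same element.
  refine (congrArg (PTree.eval 𝒯' _) ht).trans (t'.2.trans ?_)
  exact (θ.inv.app g).eq.symm

end

/-- With sources and target fixed, the arrows are the terms whose support contains each label once.
Since `Φ` preserves supports, a bijection on all terms restricts to one on these. -/
theorem Map.onHom_toMor_bijective (Φ : Map 𝒯 𝒯') (hΦ : Φ.IsFF) {k : ℕ} (x : Fin k → C) (y : C) :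
    Function.Bijective (Φ.toMor.onHom x y) := by
  refine ⟨?_, ?_⟩
  · rintro ⟨⟨s, r, t, l⟩, h₁, h₂⟩ ⟨⟨s', r', t', l'⟩, h₁', h₂'⟩ e
    obtain rfl : s = _ := h₁
    obtain rfl : r = _ := h₂
    obtain rfl : s' = _ := h₁'
    obtain rfl : r' = _ := h₂'
    have e' := congrArg Subtype.val e
    have e'' : Φ.map t = Φ.map t' := by
      injection e'
    obtain rfl := (hΦ _ _).1 e''
    rfl
  · rintro ⟨⟨s, r, t, l⟩, h, h'⟩
    obtain rfl : s = _ := h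
    obtain rfl : r = _ := h'
    obtain ⟨t, rfl⟩ := (hΦ _ _).2 t
    -- The preimage is linear because it has the same support as its linear image.
    exact ⟨⟨⟨x, y, t, (Φ.supp_map _).symm.trans l⟩, rfl, rfl⟩, rfl⟩

end TermCalc

/-! ### Independence of the chosen order on inputs. -/

namespace TermCalc.InputOrder

variable {A : Type u} {𝒮 : TermCalc.{u, u, w} (Discrete A)}

/-- The order affects only the presentation: `ofLin` and `compare.onLin` are inverse bijections
between the linear terms and the arrows of `ξ` of the associated generalised multicategory. As
`o.lift ψ` is `ψ` followed by `ofLin`, it is bijective wherever `ψ` is. -/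
theorem onHom_lift_bijective (o : 𝒮.InputOrder) {Q : SymMulticat.{u', v', w'}}
    (ψ : Q.Mor 𝒮.toSymMulticat) {k : ℕ} (x : Fin k → Q.Obj) (y : Q.Obj)
    (h : Function.Bijective (ψ.onHom x y)) : Function.Bijective ((o.lift ψ).onHom x y) := by
  refine ⟨fun f f' e => h.1 (Subtype.ext ?_), fun L => ?_⟩
  · have e' : o.ofLin (ψ.map f.1) = o.ofLin (ψ.map f'.1) := congrArg Subtype.val e
    exact (compare_ofLin _).symm.trans ((congrArg o.compare.onLin e').trans (compare_ofLin _))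
  -- The functor of `compare` is the identity, so the proof `L.2` about sources and target serves
  -- for the compared term as well.
  · obtain ⟨f, hf⟩ := h.2 ⟨o.compare.onLin L.1, L.2⟩
    refine ⟨f, Subtype.ext (compare_injective ?_)⟩
    exact (compare_ofLin (ψ.map f.1)).trans (congrArg Subtype.val hf)

end TermCalc.InputOrder

/-! ## Equivalences onto `ξ(M)` -/

/-! ### Rigidity of the arrows of `M` with labelled inputs. -/

namespace GenMulticat

variable {M : GenMulticat.{u, w}} {K : Type} {x : K → Discrete M.Obj} {y : Discrete M.Obj}

/-- Labelling is defined by substituting relabelled identities, and in `M` this changes neither the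
arrow nor its positions. In this form the underlying arrow of a labelled term and the labels at its
positions can be read off. -/
theorem lab_eq {k : ℕ} (L : M.terms.Lin k) (e : Fin k → K) (h : ∀ i, x (e i) = L.src i)
    (h' : L.tgt = y) : L.lab e h h' =
      LArr.castTgt (LArr.map (x := fun i => (L.src i).as) (z := fun k => (x k).as) L.tm e
        fun i => congrArg Discrete.as (h i)) (congrArg Discrete.as h') :=
  congrArg (fun F : M.LArr _ _ => F.castTgt (congrArg Discrete.as h'))
    (LArr.bind_castTgt_var (x := fun i => (L.src i).as) (z := fun k => (x k).as) L.tm e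
      fun i => congrArg Discrete.as (h i))

/-- Two labellings of linear terms that give the same term differ by a permutation. -/
theorem exists_act_of_lab_eq {k l : ℕ} (L : M.terms.Lin k) (L' : M.terms.Lin l) (e : Fin k → K)
    (e' : Fin l → K) (h₁ : ∀ i, x (e i) = L.src i) (h₂ : L.tgt = y)
    (h₁' : ∀ i, x (e' i) = L'.src i) (h₂' : L'.tgt = y) (h : L.lab e h₁ h₂ = L'.lab e' h₁' h₂') :
    ∃ σ : Fin l ≃ Fin k, L' = L.act σ ∧ ∀ i, e' i = e (σ i) := by
  rw [lab_eq, lab_eq] at h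
  obtain ⟨s, t, F, lin⟩ := L
  obtain ⟨s', t', F', lin'⟩ := L'
  obtain ⟨a, b, hs, ht⟩ := F
  obtain ⟨a', b', hs', ht'⟩ := F'
  obtain rfl : t = y := h₂
  obtain rfl : t' = t := h₂'
  -- Equal terms have the same underlying arrow. What remains free are the two numberings `b` and
  -- `b'` of its input positions, and composing them with `e` and `e'` gives the same labels,
  -- position by position.
  obtain rfl : a = a' := congrArg LArr.arr h
  have hb : (fun i => e (b i)) = fun i => e' (b' i) := by injection h
  -- By linearity both numberings are bijections from the positions of `a`, and the permutation
  -- sought is `b ∘ b'⁻¹`. The positions are matched by the common arrow and not by their labels, so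
  -- repeated values of `e` do no harm.
  let E := LArr.lblEquiv (LArr.mk (x := fun i => (s i).as) (y := t'.as) a b hs ht) lin
  let E' := LArr.lblEquiv (LArr.mk (x := fun i => (s' i).as) (y := t'.as) a b' hs' ht') lin'
  have hE : ∀ i, e' i = e ((E'.symm.trans E) i) := fun i => by
    obtain ⟨j, rfl⟩ := E'.surjective i
    rw [Equiv.trans_apply, Equiv.symm_apply_apply]
    exact (congrFun hb j).symm
  have hs'' : ∀ i, s ((E'.symm.trans E) i) = s' i := fun i =>
    (h₁ _).symm.trans ((congrArg x (hE i).symm).trans (h₁' i))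
  -- The action of `σ` renames the number `b i` of a position to `σ⁻¹ (b i) = b' i`, while the arrow
  -- stays the same. This is the numbering of the second term.
  refine ⟨E'.symm.trans E, (TermCalc.Lin.mk_eq (fun i => (hs'' i).symm) ?_).symm, hE⟩
  refine (TermCalc.map_map _ _ _ _ _).trans ((LArr.bind_castTgt_var
    (LArr.mk (x := fun i => (s i).as) (y := t'.as) a b hs ht) (z := fun i => (s' i).as)
    (E'.symm.trans E).symm fun i => congrArg Discrete.as ((hs'' _).symm.trans
      (congrArg s ((E'.symm.trans E).apply_symm_apply i)))).trans ?_)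
  refine LArr.ext' rfl fun i => ⟨i, rfl, ?_⟩
  exact congrArg E' (E.symm_apply_apply i)

/-- An arrow of `M` as a linear term, its `i`-th input being labelled `i`. -/
noncomputable def toLin (a : M.Arr) (s : Fin (M.ar a) → Discrete M.Obj) (t : Discrete M.Obj)
    (hs : ∀ i, M.src a i = (s i).as) (ht : M.tgt a = t.as) : M.terms.Lin (M.ar a) where
  src := s
  tgt := t
  tm := LArr.mk (x := fun i => (s i).as) (y := t.as) a (fun i => i) hs ht
  lin := by
    change Multiset.map (fun i => i) (Finset.univ.val : Multiset (Fin (M.ar a))) = _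
    exact Multiset.map_id' _

/-- There is at most one morphism between two objects of a discrete category. Faithfulness serves to
cancel `M.elts` from a composite in the proof that `plusObj` is full. -/
instance elts_faithful (M : GenMulticat.{u, w}) : M.elts.Faithful where
  map_injective _ := Subsingleton.elim _ _

end GenMulticat

/-! ### Consequences of `φ` being an equivalence. -/

namespace SymMulticat

variable {Q : SymMulticat.{u, v, w}} {M : GenMulticat.{u', w'}}

/-- The hypothesis concerns arrows with numbered inputs and has to be extended to inputs labelled by
any `K`. Terms of `Q` are labelled arrows modulo permutation, so for injectivity a permutation must
be produced from an equality in `M`, which rigidity provides. For surjectivity, the positions of an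
arrow of `M` supply the missing numbering. -/
theorem Mor.IsEquivalence.toMap_isFF {φ : Q.Mor M.ξ} (hφ : φ.IsEquivalence) :
    (Mor.toMap (𝒯 := M.terms) φ).IsFF := by
  intro K x y
  refine ⟨fun t t' h => ?_, fun F => ?_⟩
  · induction t using Quotient.inductionOn with | _ F
    induction t' using Quotient.inductionOn with | _ F'
    -- The arrows `φ F'.arr` and `φ F.arr` differ by a permutation `σ` compatible with the labels.
    -- It remains to see that `F'.arr` and `F.arr` differ by the same `σ`.
    obtain ⟨σ, h₁, h₂⟩ := GenMulticat.exists_act_of_lab_eq _ _ _ _ _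
      ((φ.tgt_map F.arr).trans (congrArg φ.F.obj F.tgt_eq)) _
      ((φ.tgt_map F'.arr).trans (congrArg φ.F.obj F'.tgt_eq)) h
    refine Quotient.sound ⟨σ, ?_, h₂⟩
    -- Injectivity of `φ` is available only within one set of arrows `Q(x₁,…,x_k;y)`, so the sources
    -- of `F.arr σ` are first identified with those of `F'.arr`.
    have hs : ∀ i, Q.src (Q.act F.arr σ) i = x (F'.lbl i) := fun i =>
      (Q.src_act _ _ _).trans ((F.src_eq _).trans (congrArg x (h₂ i).symm))
    refine congrArg Subtype.val ((hφ.2 _ (fun i => x (F'.lbl i)) y).1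
      (a₁ := ⟨F'.arr, funext F'.src_eq, F'.tgt_eq⟩)
      (a₂ := ⟨Q.act F.arr σ, funext hs, (Q.tgt_act _ _).trans F.tgt_eq⟩) (Subtype.ext ?_))
    exact h₁.trans (φ.map_act F.arr σ).symm
  · obtain ⟨a, l, hs, ht⟩ := F
    -- The inputs of `a` are numbered by their positions, forgetting the labels `l`. The sources are
    -- written as images under `φ` so that fullness applies; the labels are put back on the lifted
    -- arrow `f`.
    let L := GenMulticat.toLin a (fun i => φ.obF.obj (x (l i))) (φ.obF.obj y) hs ht
    obtain ⟨⟨f, hf, hf'⟩, e⟩ := (hφ.2 _ (fun i => x (l i)) y).2 ⟨L, rfl, rfl⟩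
    replace e : φ.map f = L := congrArg Subtype.val e
    refine ⟨Quotient.mk _ ⟨_, f, l, congrFun hf, hf'⟩, ?_⟩
    refine (TermCalc.Lin.lab_congr (𝒯 := M.terms) (x := fun k => φ.obF.obj (x k))
      (y := φ.obF.obj y) e (fun _ => rfl) _ ((φ.tgt_map f).trans (congrArg φ.F.obj hf'))
      (fun _ => rfl) rfl).trans ?_
    exact GenMulticat.lab_eq (x := fun k => φ.obF.obj (x k)) (y := φ.obF.obj y) L l
      (fun _ => rfl) rfl

/-- Numbered by its positions, `a` is an arrow of `ξ(M)`. Its source objects and its target are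
images of objects of `Q`, so it lies in a set of arrows onto which `φ` is surjective. -/
theorem Mor.IsEquivalence.exists_arr_eq {φ : Q.Mor M.ξ} (hφ : φ.IsEquivalence) (a : M.Arr) :
    ∃ f : Q.EltObj, φ.arr f.arr = a := by
  have := hφ.1
  -- Essential surjectivity gives an isomorphism, which is an equality because the objects of `ξ(M)`
  -- form a discrete category.
  have hob : ∀ x : M.Obj, ∃ z : Q.Obj, φ.obF.obj z = ⟨x⟩ := fun x =>
    ⟨φ.F.objPreimage (⟨x⟩ : Discrete M.Obj), Discrete.ext
      (Discrete.eq_of_hom (φ.F.objObjPreimageIso (⟨x⟩ : Discrete M.Obj)).hom)⟩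
  choose x hx using fun i => hob (M.src a i)
  obtain ⟨y, hy⟩ := hob (M.tgt a)
  let L := GenMulticat.toLin a (fun i => φ.obF.obj (x i)) (φ.obF.obj y)
    (fun i => (congrArg Discrete.as (hx i)).symm) (congrArg Discrete.as hy).symm
  obtain ⟨f, e⟩ := (hφ.2 _ x y).2 ⟨L, rfl, rfl⟩
  replace e : φ.map f.1 = L := congrArg Subtype.val e
  exact ⟨⟨_, f.1⟩, congrArg (fun L : M.terms.Lin _ => GenMulticat.LArr.arr L.tm) e⟩

/-- Although `plusObj` sends all morphisms to identities, it is full and faithful: by the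
isomorphism `φ.twist`, following it with `M.elts` gives the functor that `φ` induces on elements,
which is full and faithful since `φ` is bijective on terms and on object-morphisms. Hence two arrows
of `Q` lying over the same arrow of `M` are joined by exactly one morphism, and others by none. -/
theorem Mor.IsEquivalence.plusObj {φ : Q.Mor M.ξ} (hφ : φ.IsEquivalence) :
    φ.plusObj.IsEquivalence := by
  have := hφ.1
  have : (Mor.toMap (𝒯 := M.terms) φ).F.Full := inferInstanceAs φ.F.Full
  have : (Mor.toMap (𝒯 := M.terms) φ).F.Faithful := inferInstanceAs φ.F.Faithful
  have := (Mor.toMap (𝒯 := M.terms) φ).elt_faithful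
  have := (Mor.toMap (𝒯 := M.terms) φ).elt_full hφ.toMap_isFF
  -- Morphisms between arrows of `Q` are by definition the morphisms between the corresponding
  -- elements.
  have : (EltObj.functor Q).Full := ⟨fun a => ⟨a, rfl⟩⟩
  have : (EltObj.functor Q).Faithful := ⟨fun h => h⟩
  exact
    -- Faithfulness passes from a composite to its first factor; fullness does so because the second
    -- factor `M.elts` is faithful.
    { faithful := Functor.Faithful.of_comp_iso φ.twist
      full := Functor.Full.of_comp_faithful_iso φ.twist
      essSurj := ⟨fun ⟨a⟩ => by
        obtain ⟨f, rfl⟩ := hφ.exists_arr_eq a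
        exact ⟨f, ⟨Iso.refl _⟩⟩⟩ }

end SymMulticat

theorem mainTheorem4 (Q : SymMulticat.{u, v, w}) (M : GenMulticat.{u', w'}) (τ : M.NodeOrder)
    (φ : Q.Mor M.ξ) (hφ : φ.IsEquivalence) : (φ.plus τ).IsEquivalence := by
  have := hφ.1
  -- The functor of `Mor.toMap φ` is that of `φ`, hence an equivalence, which provides the fullness
  -- and faithfulness needed for the edge labels.
  have : (SymMulticat.Mor.toMap (𝒯 := M.terms) φ).F.Full := inferInstanceAs φ.F.Full
  have : (SymMulticat.Mor.toMap (𝒯 := M.terms) φ).F.Faithful := inferInstanceAs φ.F.Faithful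
  -- Neither `toMor` nor `lift` changes the functor on objects, so that of `φ⁺` is `plusObj`. On
  -- arrows, the bijection on trees is restricted to linear terms and then composed with the passage
  -- to the order `τ`.
  exact ⟨hφ.plusObj, fun _ x y => τ.onHom_lift_bijective φ.bar.toMor x y
    (φ.bar.onHom_toMor_bijective (TermCalc.Map.slice_isFF _ _ _ hφ.toMap_isFF) x y)⟩
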